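/- **Setting.** Write $\mathbb R_+=(0,\infty)$, $\mathbb R^2_+=\mathbb R_+\times\mathbb R_+$. Let $BV(\mathbb R_+)$ be the space of bounded functions on $\mathbb R_+$ with finite total variation on $(0,T)$ for every $T>0$, always represented by their right continuous representative. Let $\mathcal U\subset\mathbb R^N$ be open and convex and let $f:\mathcal U\to\mathbb R^N$ be smooth. A convex (resp. strictly convex) entropy pair is a pair $(U,F)$ of $C^2$ functions $\mathcal U\to\mathbb R$ with $\nabla F^T=\nabla U^T\nabla f$ and $\nabla^2U\ge0$ (resp. $\nabla^2U$ positive definite) on $\mathcal U$. Assume that a strictly convex entropy pair exists. Let $u_I\in L^\infty(\mathbb R_+;\mathcal U)$ and let $u_B\in BV(\mathbb R_+)$ take values in $\mathcal U$. Let $\epsilon\to0+$ along a sequence; let $u_I^\epsilon$ be bounded in $L^\infty(\mathbb R_+)$ and $u_B^\epsilon$ be bounded in $L^\infty(\mathbb R_+)$ and in $BV(0,T)$ for every $T>0$, uniformly in $\epsilon$, with $u_I^\epsilon\to u_I$ and $u_B^\epsilon\to u_B$ almost everywhere. Let $u^\epsilon:[0,\infty)^2\to\mathcal U$ be classical solutions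 (continuous on $[0,\infty)^2$ and $C^2$ on $\{x\ge0,\ t>0\}$) of $$\partial_tu^\epsilon+\partial_xf(u^\epsilon)=\epsilon\,\partial_{xx}u^\epsilon\quad(x,t>0),\qquad u^\epsilon(x,0)=u^\epsilon_I(x)\ (x>0),\qquad u^\epsilon(0,t)=u_B^\epsilon(t)\ (t>0),$$ that are bounded uniformly in $\epsilon$, and set $v^\epsilon(y,t)=u^\epsilon(\epsilon y,t)$. Let $\nu=(\nu_{x,t})$ and $\mu=(\mu_{y,t})$ be Young measures associated with $u^\epsilon$ and $v^\epsilon$: measurable maps from $\mathbb R^2_+$ to the probability measures on $\mathcal U$ such that, for every continuous $g:\mathcal U\to\mathbb R$, $g(u^\epsilon)\rightharpoonup\langle\nu,g\rangle$ and $g(v^\epsilon)\rightharpoonup\langle\mu,g\rangle$ weakly-$\star$ in $L^\infty(\mathbb R^2_+)$. A *boundary Young measure* is a measurable family, indexed by $t>0$, of probability measures carried by one compact subset of $\mathcal U$. Limits of time averages as $y\to0+$ or $x\to0+$ are taken outside a null set, since these averages are defined for almost every $y$, $x$. **Theorem 2.1.** For a convex entropy pair $(U,F)$, $\theta\in BV(\mathbb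 R_+)$ and $0\le T_1<T_2<\infty$, consider the distribution on $\mathbb R_+$ $$G(y)=\int_{T_1}^{T_2}\langle\mu_{y,t},F\rangle\,\theta(t)\,dt-\frac{d}{dy}\int_{T_1}^{T_2}\langle\mu_{y,t},U\rangle\,\theta(t)\,dt .$$ 1) If $\theta\ge0$, or if $(U,F)=(u_j,f_j)$ for some $1\le j\le N$ and $\theta$ has arbitrary sign, then $G$ is a function in $BV(\mathbb R_+)$, hence defined pointwise as a right continuous function, and $x\mapsto\int_{T_1}^{T_2}\langle\nu_{x,t},F\rangle\theta(t)\,dt$ agrees almost everywhere with a function in $BV(\mathbb R_+)$. There is a boundary Young measure $\mu_{0,t}$ such that, for all convex entropy pairs $(U,F)$, all $\theta\in BV(\mathbb R_+)$ and all $0\le T_1<T_2$, $$\lim_{y\to0+}\int_{T_1}^{T_2}\langle\mu_{y,t},U\rangle\,\theta(t)\,dt=\int_{T_1}^{T_2}\langle\mu_{0,t},U\rangle\,\theta(t)\,dt,$$ and there is a boundary Young measure $\nu_{0,t}$ such that, for all such $(U,F)$, $\theta$, $T_1,T_2$, $$\lim_{x\to0+}\int_{T_1}^{T_2}\langle\nu_{x,t},F\rangle\,\theta(t)\,dt=\int_{T_1}^{T_2}\langle\nu_{0,t},F\rangle\,\theta(t)\,dt.$$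 2) For every such $\nu_{0,t}$, every convex entropy pair $(U,F)$ and all $0<y_1<y_2$, in the sense of distributions in $t\in\mathbb R_+$, $$F(u_B)+\nabla U(u_B)\bigl(\langle\nu_{0,t},f\rangle-f(u_B)\bigr)\ \ge\ \langle\mu_{y_1,t},F\rangle-\partial_y\langle\mu_{y_1,t},U\rangle\ \ge\ \langle\mu_{y_2,t},F\rangle-\partial_y\langle\mu_{y_2,t},U\rangle\ \ge\ \langle\nu_{0,t},F\rangle;$$ more strongly, for all $\theta\in BV(\mathbb R_+)$ with $\theta\ge0$, all $0\le T_1<T_2$ and all $0<y_1<y_2$, $$\int_{T_1}^{T_2}\Bigl(F(u_B)+\nabla U(u_B)\bigl(\langle\nu_{0,t},f\rangle-f(u_B)\bigr)\Bigr)\theta\,dt\ \ge\ G(y_1)\ \ge\ G(y_2)\ \ge\ \int_{T_1}^{T_2}\langle\nu_{0,t},F\rangle\,\theta\,dt .$$ 3) For every such $\mu_{0,t}$, $\mu_{0,t}=\delta_{u_B(t)}$ for almost every $t>0$. For every such $\nu_{0,t}$, every convex entropy pair, every $\theta\in BV(\mathbb R_+)$ with $\theta\ge0$ and all $0\le T_1<T_2$,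 the limit $\lim_{y\to\infty}G(y)$ exists, is finite, and satisfies $$\lim_{y\to\infty}G(y)\ \ge\ \int_{T_1}^{T_2}\langle\nu_{0,t},F\rangle\,\theta(t)\,dt .$$ -/

import Mathlib

open MeasureTheory ProbabilityTheory Filter Topology Set
open scoped ContDiff

noncomputable section

namespace BoundaryLayer

/-- The state space `ℝ^N` with its Euclidean norm. -/
abbrev State (N : ℕ) : Type := EuclideanSpace ℝ (Fin N)

/-- Lebesgue measure on the half line `ℝ₊ = (0, ∞)`. -/
abbrev volHalf : Measure ℝ := volume.restrict (Ioi 0)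

/-- Lebesgue measure on the quarter plane `ℝ²₊ = (0, ∞) × (0, ∞)`. -/
abbrev volQuarter : Measure (ℝ × ℝ) := volume.restrict (Ioi 0 ×ˢ Ioi 0)

/-- The space `BV(ℝ₊)`: bounded functions on `(0, ∞)` with finite total variation on every
interval `(0, T)`, normalized to be right continuous. (For the right continuous representative
the pointwise variation is the total mass of the distributional derivative.) Values on `(-∞, 0]`
are irrelevant. -/
structure IsBV {V : Type*} [NormedAddCommGroup V] (w : ℝ → V) : Prop where
  bounded : ∃ C : ℝ, ∀ t, 0 < t → ‖w t‖ ≤ C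
  variation : ∀ T : ℝ, BoundedVariationOn w (Ioo 0 T)
  right_continuous : ∀ t, 0 < t → ContinuousWithinAt w (Ici t) t

/-- `(U, F)` is an entropy pair of class `C²` for the flux `f` on `𝒰`: `∇Fᵀ = ∇Uᵀ ∇f`. -/
structure IsEntropyPair {N : ℕ} (𝒰 : Set (State N)) (f : State N → State N)
    (U F : State N → ℝ) : Prop where
  contDiffOn_entropy : ContDiffOn ℝ 2 U 𝒰
  contDiffOn_flux : ContDiffOn ℝ 2 F 𝒰
  compatible : ∀ u ∈ 𝒰, fderiv ℝ F u = (fderiv ℝ U u).comp (fderiv ℝ f u)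

/-- Entropy pair with non-negative Hessian `∇²U` on `𝒰`. -/
structure IsConvexEntropyPair {N : ℕ} (𝒰 : Set (State N)) (f : State N → State N)
    (U F : State N → ℝ) : Prop extends IsEntropyPair 𝒰 f U F where
  hessian_nonneg : ∀ u ∈ 𝒰, ∀ w : State N, 0 ≤ fderiv ℝ (fderiv ℝ U) u w w

/-- Entropy pair with positive definite Hessian `∇²U` on `𝒰`. -/
structure IsStrictlyConvexEntropyPair {N : ℕ} (𝒰 : Set (State N)) (f : State N → State N)
    (U F : State N → ℝ) : Prop extends IsEntropyPair 𝒰 f U F where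
  hessian_pos : ∀ u ∈ 𝒰, ∀ w : State N, w ≠ 0 → 0 < fderiv ℝ (fderiv ℝ U) u w w

/-- `u = u(x, t)` is a classical `𝒰`-valued solution of `u_t + f(u)_x = ε u_xx` in the quarter
plane with initial data `uI` and boundary data `uB`: continuous on the closed quarter plane and
of class `C²` up to the boundary `x = 0` for positive times. -/
structure IsViscousSolution {N : ℕ} (𝒰 : Set (State N)) (f : State N → State N) (ε : ℝ)
    (uI uB : ℝ → State N) (u : ℝ → ℝ → State N) : Prop where
  mem : ∀ x t, 0 ≤ x → 0 ≤ t → u x t ∈ 𝒰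
  continuousOn : ContinuousOn (fun p : ℝ × ℝ => u p.1 p.2) (Ici 0 ×ˢ Ici 0)
  contDiffOn : ContDiffOn ℝ 2 (fun p : ℝ × ℝ => u p.1 p.2) (Ici 0 ×ˢ Ioi 0)
  equation : ∀ x t, 0 < x → 0 < t →
    deriv (fun s => u x s) t + deriv (fun z => f (u z t)) x
      = ε • deriv (deriv (fun z => u z t)) x
  initial : ∀ x, 0 < x → u x 0 = uI x
  boundary : ∀ t, 0 < t → u 0 t = uB t

/-- The functions `h n` converge to `h'` weakly-`⋆` in `L^∞(ℝ²₊)`. -/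
structure WeakStarTendsto (h : ℕ → ℝ × ℝ → ℝ) (h' : ℝ × ℝ → ℝ) : Prop where
  memLp : ∀ n, MemLp (h n) ⊤ volQuarter
  memLp_limit : MemLp h' ⊤ volQuarter
  tendsto : ∀ φ : ℝ × ℝ → ℝ, Integrable φ volQuarter →
    Tendsto (fun n => ∫ p, h n p * φ p ∂volQuarter) atTop (𝓝 (∫ p, h' p * φ p ∂volQuarter))

/-- `κ` is a Young measure with values in `Prob(𝒰)` associated with the sequence `w n`:
`g(w n) ⇀ ⟨κ, g⟩` weakly-`⋆` in `L^∞(ℝ²₊)` for every continuous `g : 𝒰 → ℝ`. -/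
structure IsYoungMeasure {N : ℕ} (𝒰 : Set (State N)) (w : ℕ → ℝ × ℝ → State N)
    (κ : Kernel (ℝ × ℝ) (State N)) : Prop where
  markov : IsMarkovKernel κ
  concentrated : ∀ p ∈ (Ioi 0 ×ˢ Ioi 0 : Set (ℝ × ℝ)), κ p 𝒰ᶜ = 0
  weakStar : ∀ g : State N → ℝ, ContinuousOn g 𝒰 →
    WeakStarTendsto (fun n p => g (w n p)) (fun p => ∫ z, g z ∂(κ p))

/-- The time average `z ↦ ∫_{T₁}^{T₂} ⟨κ_{z,t}, g⟩ θ(t) dt`. -/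
def timeAvg {N : ℕ} (κ : Kernel (ℝ × ℝ) (State N)) (g : State N → ℝ) (θ : ℝ → ℝ)
    (T₁ T₂ : ℝ) (z : ℝ) : ℝ :=
  ∫ t in T₁..T₂, (∫ w, g w ∂(κ (z, t))) * θ t

/-- The distribution
`∫_{T₁}^{T₂} ⟨μ_{y,t}, F⟩ θ(t) dt - d/dy ∫_{T₁}^{T₂} ⟨μ_{y,t}, U⟩ θ(t) dt` on `(0, ∞)` is the
function `G`. -/
def IsLayerFlux {N : ℕ} (μ : Kernel (ℝ × ℝ) (State N)) (U F : State N → ℝ) (θ : ℝ → ℝ)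
    (T₁ T₂ : ℝ) (G : ℝ → ℝ) : Prop :=
  ∀ φ : ℝ → ℝ, ContDiff ℝ ∞ φ → HasCompactSupport φ → tsupport φ ⊆ Ioi 0 →
    ∫ y in Ioi 0, (timeAvg μ F θ T₁ T₂ y * φ y + timeAvg μ U θ T₁ T₂ y * deriv φ y)
      = ∫ y in Ioi 0, G y * φ y

/-- `κ₀` is a (bounded) Young measure on the boundary: a measurable family `κ₀ t`, `t > 0`, of
probability measures carried by one compact subset of `𝒰`. -/
structure IsBoundaryYoungMeasure {N : ℕ} (𝒰 : Set (State N)) (κ₀ : Kernel ℝ (State N)) :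
    Prop where
  markov : IsMarkovKernel κ₀
  support : ∃ K : Set (State N), IsCompact K ∧ K ⊆ 𝒰 ∧ ∀ t, 0 < t → κ₀ t Kᶜ = 0

/-- The time averages of `⟨κ_{z,t}, g⟩` against `θ` on `(T₁, T₂)`, which are defined for almost
every `z > 0`, tend to that of `⟨κ₀_t, g⟩` as `z → 0+` (limit outside a null set of `z`). -/
def HasTraceOn {N : ℕ} (κ : Kernel (ℝ × ℝ) (State N)) (κ₀ : Kernel ℝ (State N))
    (g : State N → ℝ) (θ : ℝ → ℝ) (T₁ T₂ : ℝ) : Prop :=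
  Tendsto (timeAvg κ g θ T₁ T₂) (𝓝[>] 0 ⊓ ae volume)
    (𝓝 (∫ t in T₁..T₂, (∫ w, g w ∂(κ₀ t)) * θ t))

/-- `μ₀` is a trace at `y = 0` of `μ`, tested on all convex entropies `U`. -/
structure IsEntropyTrace {N : ℕ} (𝒰 : Set (State N)) (f : State N → State N)
    (μ : Kernel (ℝ × ℝ) (State N)) (μ₀ : Kernel ℝ (State N)) : Prop
    extends IsBoundaryYoungMeasure 𝒰 μ₀ where
  trace : ∀ U F : State N → ℝ, IsConvexEntropyPair 𝒰 f U F → ∀ θ : ℝ → ℝ, IsBV θ →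
    ∀ T₁ T₂ : ℝ, 0 ≤ T₁ → T₁ < T₂ → HasTraceOn μ μ₀ U θ T₁ T₂

/-- `ν₀` is a trace at `x = 0` of `ν`, tested on the fluxes `F` of all convex entropies. -/
structure IsFluxTrace {N : ℕ} (𝒰 : Set (State N)) (f : State N → State N)
    (ν : Kernel (ℝ × ℝ) (State N)) (ν₀ : Kernel ℝ (State N)) : Prop
    extends IsBoundaryYoungMeasure 𝒰 ν₀ where
  trace : ∀ U F : State N → ℝ, IsConvexEntropyPair 𝒰 f U F → ∀ θ : ℝ → ℝ, IsBV θ →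
    ∀ T₁ T₂ : ℝ, 0 ≤ T₁ → T₁ < T₂ → HasTraceOn ν ν₀ F θ T₁ T₂

end BoundaryLayer

end

open scoped BoundedContinuousFunction

/-! ### Pairing a weight of bounded variation with a time derivative -/

namespace BoundaryLayer

/-! The central object is the averaged viscous flux `Φₙ(x) = ∫ (F(u) - ε ∂ₓU(u)) θ dt` (`viscFlux`).
The entropy identity gives `Φₙ' = -∫ ∂ₜU(u) θ dt - ε ∫ ∇²U(uₓ, uₓ) θ dt`. For `θ ≥ 0` the
dissipation term is nonpositive, and since `θ` has bounded variation the first term is at most `M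
sup |U|`, however large `∂ₜu` is (`abs_integral_mul_deriv_le`). So `Φₙ(x) - C x` is nonincreasing on
`[0, ∞)` with `C` independent of `n` (`viscFlux_le`).

Weak-star convergence of `F(u)` and `U(u)`, with one integration by parts in space, gives
convergence of `Φₙ` as distributions. For almost monotone functions this improves to pointwise
convergence off a countable set (`exists_limit_of_almost_antitone`). At the scale `x` the viscous
term disappears, and the limit is the average of `⟨ν, F⟩`. At the scale `x = ε y` the viscous term
survives while the slope `ε C` vanishes, so the limit `G` is truly nonincreasing. Comparing `Φₙ` at
`0 ≤ ε y ≤ x`, letting `n → ∞` and then `x → 0`, produces the chain of inequalities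
(`exists_layer_bounds`).

The limit of `Φₙ(0)` is computed by linearity: at the wall `∇U(u)` is the known function
`∇U(u_B^ε)`, so `Φₙ(0)` is an explicit term plus momentum fluxes with weights `∂ⱼU(u_B^ε) θ`,
uniformly of bounded variation. Coordinates have zero Hessian, hence their fluxes are Lipschitz in
`x` uniformly in `n`, and their values at the wall converge to the trace of `⟨ν, fⱼ⟩`
(`tendsto_boundary_flux`).

Existence of `ν₀`: weak compactness gives a limit kernel along an ultrafilter, and bounded variation
shows that the full limits exist (`exists_fluxTrace`). For `μ₀`: bounds on the flux make the
averages of `U(v)` Lipschitz at `y = 0` uniformly in `n`, so they tend to the average of `U(u_B)`,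
and `δ_{u_B}` is a trace. Any other trace has barycenter `u_B` and saturates Jensen's inequality for
a strictly convex `U`, so it is that Dirac mass.

All estimates need the solutions to stay in one compact convex subset of `𝒰`. This is extracted from
the Young measure hypothesis by testing with `1 / dist(·, 𝒰ᶜ)` (`exists_compact_range`). -/

theorem sum_abel_abs_le (p g : ℕ → ℝ) {A B : ℝ} (m : ℕ) (hA : ∀ i ≤ m, |p i| ≤ A)
    (hB : ∀ i ≤ m, |g i| ≤ B) :
    |∑ i ∈ Finset.range m, p i * (g (i + 1) - g i)|
      ≤ 2 * A * B + B * ∑ i ∈ Finset.range m, |p (i + 1) - p i| := by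
  have hA0 : 0 ≤ A := (abs_nonneg _).trans (hA 0 (Nat.zero_le _))
  have hB0 : 0 ≤ B := (abs_nonneg _).trans (hB 0 (Nat.zero_le _))
  have key : ∑ i ∈ Finset.range m, p i * (g (i + 1) - g i)
      = p m * g m - p 0 * g 0 - ∑ i ∈ Finset.range m, g (i + 1) * (p (i + 1) - p i) := by
    rw [← Finset.sum_range_sub (fun i => p i * g i) m, ← Finset.sum_sub_distrib]
    exact Finset.sum_congr rfl fun i _ => by ring
  have h1 : |∑ i ∈ Finset.range m, g (i + 1) * (p (i + 1) - p i)|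
      ≤ B * ∑ i ∈ Finset.range m, |p (i + 1) - p i| := by
    rw [Finset.mul_sum]
    refine (Finset.abs_sum_le_sum_abs _ _).trans (Finset.sum_le_sum fun i hi => ?_)
    rw [abs_mul]
    exact mul_le_mul_of_nonneg_right (hB _ (Finset.mem_range.1 hi)) (abs_nonneg _)
  have h2 : |p m * g m| ≤ A * B := by
    rw [abs_mul]; exact mul_le_mul (hA m le_rfl) (hB m le_rfl) (abs_nonneg _) hA0
  have h3 : |p 0 * g 0| ≤ A * B := by
    rw [abs_mul]
    exact mul_le_mul (hA 0 (Nat.zero_le _)) (hB 0 (Nat.zero_le _)) (abs_nonneg _) hA0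
  rw [key]
  rw [abs_le] at h1 h2 h3 ⊢
  constructor <;> linarith [h1.1, h1.2, h2.1, h2.2, h3.1, h3.2]

theorem aemeasurable_of_boundedVariationOn {ψ : ℝ → ℝ} {s : Set ℝ} (hs : MeasurableSet s)
    (h : BoundedVariationOn ψ s) : AEMeasurable ψ (volume.restrict s) := by
  obtain ⟨p, q, hp, hq, rfl⟩ := h.locallyBoundedVariationOn.exists_monotoneOn_sub_monotoneOn
  exact (aemeasurable_restrict_of_monotoneOn hs hp).sub (aemeasurable_restrict_of_monotoneOn hs hq)

theorem intervalIntegrable_mul_of_boundedVariationOn {ψ g : ℝ → ℝ} {a b A : ℝ} (hab : a ≤ b)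
    (hA : ∀ t ∈ Icc a b, |ψ t| ≤ A) (hV : BoundedVariationOn ψ (Icc a b))
    (hg : ContinuousOn g (Icc a b)) :
    IntervalIntegrable (fun t => ψ t * g t) volume a b := by
  rw [intervalIntegrable_iff_integrableOn_Icc_of_le hab]
  have : IntegrableOn g (Icc a b) := hg.integrableOn_Icc
  refine Integrable.bdd_mul (c := A) this
    (aemeasurable_of_boundedVariationOn measurableSet_Icc hV).aestronglyMeasurable ?_
  filter_upwards [ae_restrict_mem measurableSet_Icc] with t ht using hA t ht

/-- Pairing of a function of bounded variation with a derivative. -/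
theorem abs_integral_mul_deriv_le {ψ g g' : ℝ → ℝ} {a b A B : ℝ} (hab : a ≤ b)
    (hA : ∀ t ∈ Icc a b, |ψ t| ≤ A) (hV : BoundedVariationOn ψ (Icc a b))
    (hg : ∀ t ∈ Icc a b, HasDerivAt g (g' t) t) (hg' : ContinuousOn g' (Icc a b))
    (hB : ∀ t ∈ Icc a b, |g t| ≤ B) :
    |∫ t in a..b, ψ t * g' t| ≤ (2 * A + (eVariationOn ψ (Icc a b)).toReal) * B := by
  set V := (eVariationOn ψ (Icc a b)).toReal with hVdef
  obtain ⟨C, hC⟩ := isCompact_Icc.exists_bound_of_continuousOn hg'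
  have hC0 : 0 ≤ C := (norm_nonneg _).trans (hC a (left_mem_Icc.2 hab))
  have hB0 : 0 ≤ B := (abs_nonneg _).trans (hB a (left_mem_Icc.2 hab))
  have hV0 : 0 ≤ V := ENNReal.toReal_nonneg
  -- Riemann-Stieltjes approximation on `m + 1` equal cells: freezing `ψ` at the left endpoint of
  -- each cell costs at most `V C d` in total, and Abel summation moves the differences of `g` onto
  -- `ψ`. The term `2 A B` comes from the two endpoints.
  have main : ∀ m : ℕ, |∫ t in a..b, ψ t * g' t|
      ≤ (2 * A + V) * B + V * C * (b - a) / (m + 1 : ℝ) := by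
    intro m
    set d : ℝ := (b - a) / (m + 1 : ℝ) with hd
    have hm : (0 : ℝ) < m + 1 := by positivity
    have hd0 : 0 ≤ d := div_nonneg (sub_nonneg.2 hab) hm.le
    have hdm : d * (m + 1) = b - a := by rw [hd]; field_simp
    set τ : ℕ → ℝ := fun i => a + i * d with hτ
    have hτm : Monotone τ := fun i j hij => by
      simp only [hτ]; gcongr
    have hτ0 : τ 0 = a := by simp [hτ]
    have hτe : τ (m + 1) = b := by simp only [hτ]; push_cast; linarith
    have hmem : ∀ i ≤ m + 1, τ i ∈ Icc a b := fun i hi =>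
      ⟨hτ0 ▸ hτm (Nat.zero_le i), hτe ▸ hτm hi⟩
    have hsub : ∀ i < m + 1, Icc (τ i) (τ (i + 1)) ⊆ Icc a b := fun i hi =>
      Icc_subset_Icc (hmem i hi.le).1 (hmem (i + 1) hi).2
    set v : ℕ → ℝ := fun i => (eVariationOn ψ (Icc (τ i) (τ (i + 1)))).toReal with hv
    have hvsum : ∑ i ∈ Finset.range (m + 1), v i = V := by
      have h := eVariationOn.sum' ψ hτm (n := m + 1)
      rw [hτ0, hτe] at h
      rw [hVdef, ← h, ENNReal.toReal_sum]
      intro i hi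
      exact hV.mono (hsub i (Finset.mem_range.1 hi))
    have hosc : ∀ i < m + 1, ∀ t ∈ Icc (τ i) (τ (i + 1)), |ψ t - ψ (τ i)| ≤ v i := by
      intro i hi t ht
      exact (hV.mono (hsub i hi)).dist_le ht (left_mem_Icc.2 (hτm (Nat.le_succ i)))
    have h_int : ∀ i < m + 1, IntervalIntegrable (fun t => ψ t * g' t) volume (τ i) (τ (i + 1)) :=
      fun i hi => intervalIntegrable_mul_of_boundedVariationOn (hτm (Nat.le_succ i))
        (fun t ht => hA t (hsub i hi ht)) (hV.mono (hsub i hi)) (hg'.mono (hsub i hi))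
    have h_int' : ∀ i < m + 1, IntervalIntegrable g' volume (τ i) (τ (i + 1)) := fun i hi =>
      (hg'.mono (hsub i hi)).intervalIntegrable_of_Icc (hτm (Nat.le_succ i))
    have hpiece : ∀ i < m + 1, |(∫ t in τ i..τ (i + 1), ψ t * g' t)
        - ψ (τ i) * (g (τ (i + 1)) - g (τ i))| ≤ v i * C * d := by
      intro i hi
      have hle := hτm (Nat.le_succ i)
      have h1 : ∫ t in τ i..τ (i + 1), g' t = g (τ (i + 1)) - g (τ i) := by
        refine intervalIntegral.integral_eq_sub_of_hasDerivAt (fun t ht => hg t ?_) (h_int' i hi)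
        rw [uIcc_of_le hle] at ht
        exact hsub i hi ht
      rw [← h1, ← intervalIntegral.integral_const_mul,
        ← intervalIntegral.integral_sub (h_int i hi) ((h_int' i hi).const_mul _)]
      have h2 := intervalIntegral.norm_integral_le_of_norm_le_const (a := τ i) (b := τ (i + 1))
        (f := fun t => ψ t * g' t - ψ (τ i) * g' t) (C := v i * C) (by
          intro t ht
          rw [uIoc_of_le hle] at ht
          have ht' := Ioc_subset_Icc_self ht
          rw [← sub_mul, norm_mul]
          exact mul_le_mul (hosc i hi t ht') (hC t (hsub i hi ht')) (norm_nonneg _)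
            ENNReal.toReal_nonneg)
      have h3 : |τ (i + 1) - τ i| = d := by
        simp only [hτ]; push_cast
        rw [show a + ((i : ℝ) + 1) * d - (a + i * d) = d by ring, abs_of_nonneg hd0]
      rw [h3] at h2
      exact h2
    have hsplit : ∫ t in a..b, ψ t * g' t
        = ∑ i ∈ Finset.range (m + 1), ∫ t in τ i..τ (i + 1), ψ t * g' t := by
      rw [intervalIntegral.sum_integral_adjacent_intervals (fun i hi => h_int i hi), hτ0, hτe]
    have hR : |∑ i ∈ Finset.range (m + 1), ψ (τ i) * (g (τ (i + 1)) - g (τ i))|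
        ≤ 2 * A * B + B * V := by
      refine (sum_abel_abs_le (fun i => ψ (τ i)) (fun i => g (τ i)) (m + 1)
        (fun i hi => hA _ (hmem i hi)) (fun i hi => hB _ (hmem i hi))).trans ?_
      gcongr
      rw [← hvsum]
      exact Finset.sum_le_sum fun i hi => hosc i (Finset.mem_range.1 hi) _
        (right_mem_Icc.2 (hτm (Nat.le_succ i)))
    have hdiff : |(∫ t in a..b, ψ t * g' t)
        - ∑ i ∈ Finset.range (m + 1), ψ (τ i) * (g (τ (i + 1)) - g (τ i))| ≤ V * C * d := by
      rw [hsplit, ← Finset.sum_sub_distrib, ← hvsum, Finset.sum_mul, Finset.sum_mul]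
      exact (Finset.abs_sum_le_sum_abs _ _).trans
        (Finset.sum_le_sum fun i hi => hpiece i (Finset.mem_range.1 hi))
    have hd' : V * C * (b - a) / (m + 1 : ℝ) = V * C * d := by rw [hd]; ring
    rw [hd']
    rw [abs_le] at hR hdiff ⊢
    constructor <;> linarith [hR.1, hR.2, hdiff.1, hdiff.2]
  have hlim : Tendsto (fun m : ℕ => (2 * A + V) * B + V * C * (b - a) / ((m : ℝ) + 1)) atTop
      (𝓝 ((2 * A + V) * B + 0)) := by
    refine tendsto_const_nhds.add ?_
    have := tendsto_one_div_add_atTop_nhds_zero_nat (𝕜 := ℝ)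
    simpa [div_eq_mul_inv] using this.const_mul (V * C * (b - a))
  rw [add_zero] at hlim
  exact ge_of_tendsto' hlim main

end BoundaryLayer

/-! ### Distributional limits of almost antitone functions -/

namespace BoundaryLayer

/-- Test functions: smooth with compact support in the open set `s`. -/
structure IsTest (s : Set ℝ) (φ : ℝ → ℝ) : Prop where
  smooth : ContDiff ℝ ∞ φ
  compact : HasCompactSupport φ
  supp : tsupport φ ⊆ s

theorem IsTest.mono {s t : Set ℝ} {φ : ℝ → ℝ} (h : IsTest s φ) (hst : s ⊆ t) : IsTest t φ :=
  ⟨h.smooth, h.compact, h.supp.trans hst⟩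

theorem IsTest.eq_zero {s : Set ℝ} {φ : ℝ → ℝ} (h : IsTest s φ) {x : ℝ} (hx : x ∉ s) : φ x = 0 :=
  image_eq_zero_of_notMem_tsupport fun h' => hx (h.supp h')

/-- The tests are supported in a compact subinterval. -/
theorem IsTest.exists_Icc {α : ℝ} {φ : ℝ → ℝ} (h : IsTest (Ioi α) φ) :
    ∃ a b, α < a ∧ a < b ∧ tsupport φ ⊆ Icc a b := by
  rcases (tsupport φ).eq_empty_or_nonempty with he | hne
  · exact ⟨α + 1, α + 2, by linarith, by linarith, by simp [he]⟩
  · have hc : IsCompact (tsupport φ) := h.compact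
    have h1 := hc.sInf_mem hne
    refine ⟨sInf (tsupport φ), sSup (tsupport φ) + 1, h.supp h1, ?_, fun x hx =>
      ⟨csInf_le hc.bddBelow hx, (le_csSup hc.bddAbove hx).trans (by linarith)⟩⟩
    linarith [le_csSup hc.bddAbove h1]

theorem setIntegral_Ioi_eq {g : ℝ → ℝ} {a b : ℝ} (ha : 0 < a) (hab : a ≤ b)
    (hg : ∀ x, x ∉ Icc a b → g x = 0) : ∫ x in Ioi 0, g x = ∫ x in a..b, g x := by
  rw [intervalIntegral.integral_of_le hab, ← integral_Icc_eq_integral_Ioc]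
  refine setIntegral_eq_of_subset_of_forall_sdiff_eq_zero measurableSet_Ioi
    (fun x hx => ha.trans_le hx.1) fun x hx => hg x hx.2

theorem integrableOn_mul_test {g φ : ℝ → ℝ} (hg : ContinuousOn g (Ioi 0))
    (hφ : IsTest (Ioi 0) φ) : IntegrableOn (fun x => g x * φ x) (Ioi 0) := by
  obtain ⟨a, b, ha, hab, hs⟩ := hφ.exists_Icc
  have h1 : IntegrableOn (fun x => g x * φ x) (Icc a b) :=
    ((hg.mono fun x hx => ha.trans_le hx.1).mul hφ.smooth.continuous.continuousOn).integrableOn_Icc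
  refine IntegrableOn.of_forall_sdiff_eq_zero h1 measurableSet_Ioi fun x hx => ?_
  rw [image_eq_zero_of_notMem_tsupport fun h' => hx.2 (hs h'), mul_zero]

/-- Normalized nonnegative test functions. -/
structure IsBump (s : Set ℝ) (φ : ℝ → ℝ) : Prop extends IsTest s φ where
  nonneg : ∀ x, 0 ≤ φ x
  integral_eq : ∫ x, φ x = 1

theorem exists_isBump {α β : ℝ} (h : α < β) : ∃ φ, IsBump (Ioo α β) φ := by
  let f : ContDiffBump ((α + β) / 2) := ⟨(β - α) / 8, (β - α) / 4, by linarith, by linarith⟩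
  refine ⟨f.normed volume, ⟨f.contDiff_normed, f.hasCompactSupport_normed, ?_⟩,
    f.nonneg_normed, f.integral_normed⟩
  rw [f.tsupport_normed_eq]
  intro x hx
  rw [Metric.mem_closedBall, Real.dist_eq, abs_le] at hx
  have : f.rOut = (β - α) / 4 := rfl
  constructor <;> linarith [hx.1, hx.2]

theorem IsBump.setIntegral_eq {s : Set ℝ} {φ : ℝ → ℝ} (h : IsBump s φ) {t : Set ℝ}
    (hst : s ⊆ t) : ∫ x in t, φ x = 1 := by
  rw [← h.integral_eq]
  exact setIntegral_eq_integral_of_forall_compl_eq_zero fun x hx =>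
    h.toIsTest.eq_zero fun h' => hx (hst h')

theorem IsBump.le_integral {m φ : ℝ → ℝ} {s : Set ℝ} (hφ : IsBump s φ) (hs : s ⊆ Ioi 0)
    (hm : ContinuousOn m (Ioi 0)) {c : ℝ} (hc : ∀ x ∈ s, c ≤ m x) :
    c ≤ ∫ x in Ioi 0, m x * φ x := by
  have h1 : ∫ x in Ioi (0 : ℝ), c * φ x = c := by
    rw [integral_const_mul, hφ.setIntegral_eq hs, mul_one]
  rw [← h1]
  refine setIntegral_mono_on (integrableOn_mul_test continuousOn_const (hφ.toIsTest.mono hs))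
    (integrableOn_mul_test hm (hφ.toIsTest.mono hs)) measurableSet_Ioi fun x _ => ?_
  by_cases hx : x ∈ s
  · exact mul_le_mul_of_nonneg_right (hc x hx) (hφ.nonneg x)
  · simp [hφ.toIsTest.eq_zero hx]

theorem IsBump.integral_le {m φ : ℝ → ℝ} {s : Set ℝ} (hφ : IsBump s φ) (hs : s ⊆ Ioi 0)
    (hm : ContinuousOn m (Ioi 0)) {c : ℝ} (hc : ∀ x ∈ s, m x ≤ c) :
    ∫ x in Ioi 0, m x * φ x ≤ c := by
  have := hφ.le_integral (m := fun x => -m x) hs hm.neg (c := -c) fun x hx => neg_le_neg (hc x hx)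
  simp only [neg_mul, integral_neg] at this
  linarith

/-- Antitone functions on `(0, ∞)` converging as distributions have a right continuous antitone
limit, and converge pointwise outside a countable set. -/
theorem exists_antitoneOn_limit {m : ℕ → ℝ → ℝ} (hcont : ∀ n, ContinuousOn (m n) (Ioi 0))
    (hmono : ∀ n, AntitoneOn (m n) (Ioi 0)) (L : (ℝ → ℝ) → ℝ)
    (hL : ∀ φ, IsTest (Ioi 0) φ →
      Tendsto (fun n => ∫ y in Ioi 0, m n y * φ y) atTop (𝓝 (L φ))) :
    ∃ G : ℝ → ℝ, AntitoneOn G (Ioi 0) ∧ (∀ t, 0 < t → ContinuousWithinAt G (Ici t) t) ∧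
      (∃ S : Set ℝ, S.Countable ∧ ∀ y, 0 < y → y ∉ S →
        Tendsto (fun n => m n y) atTop (𝓝 (G y))) ∧
      ∀ φ, IsTest (Ioi 0) φ → L φ = ∫ y in Ioi 0, G y * φ y := by
  have hIoi : ∀ {y : ℝ}, 0 < y → Ioi y ⊆ Ioi 0 := fun hy x hx => lt_trans hy hx
  -- Averages over bumps to the right of `y` lie below `m n y`, those over bumps to the left lie
  -- above it. Every comparison between `L` and pointwise values rests on these two bounds.
  have hup : ∀ y, 0 < y → ∀ φ, IsBump (Ioi y) φ → ∀ n, ∫ x in Ioi 0, m n x * φ x ≤ m n y :=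
    fun y hy φ hφ n => hφ.integral_le (hIoi hy) (hcont n) fun x hx =>
      hmono n hy (hIoi hy hx) (le_of_lt hx)
  have hlow : ∀ y y', 0 < y' → ∀ φ, IsBump (Ioo y' y) φ → ∀ n,
      m n y ≤ ∫ x in Ioi 0, m n x * φ x := fun y y' hy φ hφ n =>
    hφ.le_integral (fun x hx => lt_trans hy hx.1) (hcont n) fun x hx =>
      hmono n (lt_trans hy hx.1) (hy.trans (hx.1.trans hx.2)) hx.2.le
  -- The limit at `y` is defined as the supremum of `L` over normalized bumps to the right of `y`;
  -- this choice selects the right continuous representative.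
  set A : ℝ → Set ℝ := fun y => {r | ∃ φ, IsBump (Ioi y) φ ∧ r = L φ} with hA
  set G : ℝ → ℝ := fun y => sSup (A y) with hG
  have hAne : ∀ y, (A y).Nonempty := fun y => by
    obtain ⟨φ, hφ⟩ := exists_isBump (lt_add_one y)
    exact ⟨L φ, φ, ⟨hφ.toIsTest.mono Ioo_subset_Ioi_self, hφ.nonneg, hφ.integral_eq⟩, rfl⟩
  have hAle : ∀ y y', 0 < y' → ∀ φ, IsBump (Ioo y' y) φ → ∀ r ∈ A y, r ≤ L φ := by
    rintro y y' hy' φ hφ r ⟨χ, hχ, rfl⟩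
    rcases lt_or_ge y' y with hlt | hge
    · refine le_of_tendsto_of_tendsto' (hL χ (hχ.toIsTest.mono (hIoi (hy'.trans hlt))))
        (hL φ (hφ.toIsTest.mono fun x hx => lt_trans hy' hx.1)) fun n => ?_
      exact (hup y (hy'.trans hlt) χ hχ n).trans (hlow y y' hy' φ hφ n)
    · exfalso
      have h0 : φ = 0 := funext fun x => hφ.toIsTest.eq_zero (by simp [Ioo_eq_empty hge.not_gt])
      have := hφ.integral_eq
      simp [h0] at this
  have hAbdd : ∀ y, 0 < y → BddAbove (A y) := fun y hy => by
    obtain ⟨φ, hφ⟩ := exists_isBump (half_lt_self hy)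
    exact ⟨L φ, fun r hr => hAle y (y / 2) (half_pos hy) φ hφ r hr⟩
  have hanti : AntitoneOn G (Ioi 0) := by
    intro x hx y _ hxy
    refine csSup_le_csSup (hAbdd x hx) (hAne y) ?_
    rintro r ⟨φ, hφ, rfl⟩
    exact ⟨φ, ⟨hφ.toIsTest.mono (Ioi_subset_Ioi hxy), hφ.nonneg, hφ.integral_eq⟩, rfl⟩
  have hright : ∀ t, 0 < t → ContinuousWithinAt G (Ici t) t := by
    intro t ht
    rw [Metric.continuousWithinAt_iff']
    intro e he
    obtain ⟨r, ⟨φ, hφ, rfl⟩, hr⟩ := exists_lt_of_lt_csSup (hAne t) (sub_lt_self (G t) he)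
    -- A nearly optimal bump has compact support in `(t, ∞)`, so it still competes in the supremum
    -- at every point of `[t, a)`. This yields right continuity.
    obtain ⟨a, b, hta, -, hab⟩ := hφ.toIsTest.exists_Icc
    have : ∀ᶠ x in 𝓝[≥] t, x ∈ Ico t a := Ico_mem_nhdsGE hta
    filter_upwards [this] with x hx
    have h1 : L φ ≤ G x := le_csSup (hAbdd x (ht.trans_le hx.1))
      ⟨φ, ⟨⟨hφ.smooth, hφ.compact, fun z hz => hx.2.trans_le (hab hz).1⟩, hφ.nonneg,
        hφ.integral_eq⟩, rfl⟩
    have h2 : G x ≤ G t := hanti ht (ht.trans_le hx.1) hx.1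
    rw [Real.dist_eq, abs_lt]
    constructor <;> linarith
  obtain ⟨S, hS, hSc⟩ : ∃ S : Set ℝ, S.Countable ∧ ∀ y, 0 < y → y ∉ S →
      ContinuousWithinAt G (Ioi 0) y :=
    ⟨_, hanti.countable_not_continuousWithinAt, fun y hy hyS => by
      by_contra h; exact hyS ⟨hy, h⟩⟩
  have hptw : ∀ y, 0 < y → y ∉ S → Tendsto (fun n => m n y) atTop (𝓝 (G y)) := by
    intro y hy hyS
    rw [tendsto_order]
    constructor
    · intro c hc
      obtain ⟨r, ⟨φ, hφ, rfl⟩, hr⟩ := exists_lt_of_lt_csSup (hAne y) hc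
      filter_upwards [(hL φ (hφ.toIsTest.mono (hIoi hy))).eventually (lt_mem_nhds hr)] with n hn
      exact hn.trans_le (hup y hy φ hφ n)
    · intro c hc
      -- Continuity of `G` at `y` supplies `y' < y` with `G y' < c`; a bump in `(y', y)` then bounds
      -- `m n y` from above.
      have h1 : ∀ᶠ x in 𝓝[Ioi 0] y, G x < c := (hSc y hy hyS).eventually (gt_mem_nhds hc)
      rw [(isOpen_Ioi.nhdsWithin_eq hy : 𝓝[Ioi 0] y = 𝓝 y)] at h1
      have h2 : ∀ᶠ x in 𝓝[<] y, G x < c := nhdsWithin_le_nhds h1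
      have h3 : ∀ᶠ x in 𝓝[<] y, x ∈ Ioo 0 y := Ioo_mem_nhdsLT hy
      obtain ⟨y', hy'c, hy'⟩ := (h2.and h3).exists
      obtain ⟨φ, hφ⟩ := exists_isBump hy'.2
      have hLφ : L φ ≤ G y' := le_csSup (hAbdd y' hy'.1)
        ⟨φ, ⟨hφ.toIsTest.mono Ioo_subset_Ioi_self, hφ.nonneg, hφ.integral_eq⟩, rfl⟩
      filter_upwards [(hL φ (hφ.toIsTest.mono fun x hx => hy'.1.trans hx.1)).eventually
        (gt_mem_nhds (hLφ.trans_lt hy'c))] with n hn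
      exact (hlow y y' hy'.1 φ hφ n).trans_lt hn
  refine ⟨G, hanti, hright, ⟨S, hS, hptw⟩, fun φ hφ => ?_⟩
  obtain ⟨a, b, ha, hab, hsupp⟩ := hφ.exists_Icc
  have hgood : ∀ c d : ℝ, c < d → ∃ x ∈ Ioo c d, x ∉ S := fun c d hcd => by
    obtain ⟨x, hx, hxS⟩ := (hS.dense_compl ℝ).exists_mem_open isOpen_Ioo (nonempty_Ioo.2 hcd)
    exact ⟨x, hxS, hx⟩
  -- At good points on either side of the support the sequence converges, hence is bounded;
  -- monotonicity turns these two bounds into a uniform bound on the support, for dominated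
  -- convergence.
  obtain ⟨α, hα, hαS⟩ := hgood 0 a ha
  obtain ⟨β, hβ, hβS⟩ := hgood b (b + 1) (by linarith)
  have hβ0 : 0 < β := by linarith [hβ.1, hα.1]
  obtain ⟨C₁, hC₁⟩ := (hptw α hα.1 hαS).bddAbove_range
  obtain ⟨C₂, hC₂⟩ := (hptw β hβ0 hβS).bddBelow_range
  refine tendsto_nhds_unique (hL φ hφ) ?_
  refine tendsto_integral_of_dominated_convergence (fun y => (|C₁| + |C₂|) * |φ y|)
    (fun n => (integrableOn_mul_test (hcont n) hφ).aestronglyMeasurable) ?_ ?_ ?_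
  · exact ((hφ.smooth.continuous.abs.integrable_of_hasCompactSupport
      hφ.compact.norm).const_mul _).integrableOn
  · intro n
    filter_upwards [ae_restrict_mem measurableSet_Ioi] with y hy
    by_cases hys : y ∈ Icc a b
    · rw [norm_mul]
      refine mul_le_mul_of_nonneg_right ?_ (abs_nonneg _)
      have h1 : m n y ≤ C₁ := (hmono n hα.1 hy (hα.2.le.trans hys.1)).trans (hC₁ ⟨n, rfl⟩)
      have h2 : C₂ ≤ m n y := le_trans (hC₂ ⟨n, rfl⟩) (hmono n hy hβ0 (hys.2.trans hβ.1.le))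
      rw [Real.norm_eq_abs, abs_le]
      constructor <;> linarith [le_abs_self C₁, neg_abs_le C₂, abs_nonneg C₁, abs_nonneg C₂]
    · rw [image_eq_zero_of_notMem_tsupport fun h' => hys (hsupp h')]
      simp
  · have : ∀ᵐ y ∂(volume.restrict (Ioi (0 : ℝ))), y ∉ S := ae_restrict_of_ae
      (measure_eq_zero_iff_ae_notMem.1 (hS.measure_zero volume))
    filter_upwards [this, ae_restrict_mem measurableSet_Ioi] with y hyS hy
    exact (hptw y hy hyS).mul_const _

/-- Subtracting `c n * y` makes the functions antitone. The slopes converge, so the subtracted part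
converges both pointwise and as a distribution and can be added back. -/
theorem exists_limit_of_almost_antitone {h : ℕ → ℝ → ℝ} {c : ℕ → ℝ} {c₀ : ℝ}
    (hc : Tendsto c atTop (𝓝 c₀)) (hcont : ∀ n, ContinuousOn (h n) (Ioi 0))
    (hmono : ∀ n x y, 0 < x → x ≤ y → h n y ≤ h n x + c n * (y - x)) (L : (ℝ → ℝ) → ℝ)
    (hL : ∀ φ, IsTest (Ioi 0) φ →
      Tendsto (fun n => ∫ y in Ioi 0, h n y * φ y) atTop (𝓝 (L φ))) :
    ∃ G : ℝ → ℝ, (∀ x y, 0 < x → x ≤ y → G y ≤ G x + c₀ * (y - x)) ∧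
      (∀ t, 0 < t → ContinuousWithinAt G (Ici t) t) ∧
      (∃ S : Set ℝ, S.Countable ∧ ∀ y, 0 < y → y ∉ S →
        Tendsto (fun n => h n y) atTop (𝓝 (G y))) ∧
      ∀ φ, IsTest (Ioi 0) φ → L φ = ∫ y in Ioi 0, G y * φ y := by
  have hid : ∀ d : ℝ, ContinuousOn (fun y : ℝ => d * y) (Ioi 0) := fun d => by fun_prop
  obtain ⟨G, hanti, hright, ⟨S, hS, hptw⟩, hG⟩ := exists_antitoneOn_limit
    (m := fun n y => h n y - c n * y) (fun n => (hcont n).sub (hid _))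
    (fun n x hx y _ hxy => by
      have := hmono n x y hx hxy
      simp only
      linarith)
    (fun φ => L φ - c₀ * ∫ y in Ioi 0, y * φ y) (fun φ hφ => by
      have h1 := (hL φ hφ).sub (hc.mul_const (∫ y in Ioi 0, y * φ y))
      refine h1.congr fun n => ?_
      rw [← integral_const_mul, ← integral_sub (integrableOn_mul_test (hcont n) hφ)]
      · exact integral_congr_ae (ae_of_all _ fun y => by simp only; ring)
      · simpa only [IntegrableOn, mul_assoc] using integrableOn_mul_test (hid (c n)) hφ)
  refine ⟨fun y => G y + c₀ * y, fun x y hx hxy => ?_, fun t ht =>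
    (hright t ht).add (by fun_prop), ⟨S, hS, fun y hy hyS => ?_⟩, fun φ hφ => ?_⟩
  · have := hanti hx (hx.trans_le hxy) hxy
    simp only
    linarith
  · exact ((hptw y hy hyS).add (hc.mul_const y)).congr fun n => by ring
  · have h1 := hG φ hφ
    rw [sub_eq_iff_eq_add] at h1
    obtain ⟨a, b, ha, hab, hsupp⟩ := hφ.exists_Icc
    have hI1 : IntegrableOn (fun y => G y * φ y) (Ioi 0) := by
      have hb : IntegrableOn (fun y => G y * φ y) (Icc a b) := by
        have : IntegrableOn G (Icc a b) :=
          (hanti.mono fun x hx => ha.trans_le hx.1).integrableOn_isCompact isCompact_Icc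
        exact this.mul_continuousOn hφ.smooth.continuous.continuousOn isCompact_Icc
      refine IntegrableOn.of_forall_sdiff_eq_zero hb measurableSet_Ioi fun x hx => ?_
      rw [image_eq_zero_of_notMem_tsupport fun h' => hx.2 (hsupp h'), mul_zero]
    rw [h1, ← integral_const_mul, ← integral_add hI1]
    · exact integral_congr_ae (ae_of_all _ fun y => by simp only; ring)
    · simpa only [IntegrableOn, mul_assoc] using integrableOn_mul_test (hid c₀) hφ

end BoundaryLayer

/-! ### Time averages of a viscous solution and the viscous entropy flux -/

namespace BoundaryLayer

theorem intervalIntegrable_continuousOn_mul {P : ℝ × ℝ → ℝ} {ψ : ℝ → ℝ} {a b x : ℝ} {s : Set ℝ}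
    (hP : ContinuousOn P (s ×ˢ Ioi 0)) (ha : 0 < a) (hab : a ≤ b)
    (hψ : IntervalIntegrable ψ volume a b) (hx : x ∈ s) :
    IntervalIntegrable (fun t => P (x, t) * ψ t) volume a b := by
  refine hψ.continuousOn_mul ?_
  rw [uIcc_of_le hab]
  exact hP.comp (by fun_prop) fun t ht => ⟨hx, ha.trans_le ht.1⟩

/-- Since `a > 0`, the window stays in the region `t > 0` where regularity reaches the wall, so
continuity holds up to `x = 0`. This is what permits comparisons with the boundary value. -/
theorem continuousOn_integral_mul {P : ℝ × ℝ → ℝ} {ψ : ℝ → ℝ} {a b : ℝ}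
    (hP : ContinuousOn P (Ici 0 ×ˢ Ioi 0)) (ha : 0 < a) (hab : a ≤ b)
    (hψ : IntervalIntegrable ψ volume a b) :
    ContinuousOn (fun x => ∫ t in a..b, P (x, t) * ψ t) (Ici 0) := by
  intro x₀ hx₀
  have hcomp : IsCompact (Icc (0 : ℝ) (x₀ + 1) ×ˢ Icc a b) := isCompact_Icc.prod isCompact_Icc
  obtain ⟨C, hC⟩ := hcomp.exists_bound_of_continuousOn (f := P)
    (hP.mono (prod_mono (fun x hx => hx.1) fun t ht => ha.trans_le ht.1))
  have hnear : ∀ᶠ x in 𝓝[Ici 0] x₀, x ∈ Icc 0 (x₀ + 1) := by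
    filter_upwards [self_mem_nhdsWithin, nhdsWithin_le_nhds (Iio_mem_nhds (lt_add_one x₀))]
      with x h1 h2 using ⟨h1, le_of_lt h2⟩
  refine intervalIntegral.continuousWithinAt_of_dominated_interval (bound := fun t => C * ‖ψ t‖)
    ?_ ?_ (hψ.norm.const_mul C) ?_
  · filter_upwards [self_mem_nhdsWithin] with x hx
    exact (intervalIntegrable_continuousOn_mul hP ha hab hψ hx).def'.aestronglyMeasurable
  · filter_upwards [hnear] with x hx
    refine ae_of_all _ fun t ht => ?_
    rw [uIoc_of_le hab] at ht
    rw [norm_mul]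
    exact mul_le_mul_of_nonneg_right (hC (x, t) ⟨hx, Ioc_subset_Icc_self ht⟩) (norm_nonneg _)
  · refine ae_of_all _ fun t ht => ?_
    rw [uIoc_of_le hab] at ht
    have : ContinuousWithinAt P (Ici 0 ×ˢ Ioi 0) (x₀, t) := hP _ ⟨hx₀, ha.trans ht.1⟩
    exact (this.comp (f := fun x => (x, t)) (s := Ici 0) (by fun_prop)
      fun x hx => ⟨hx, ha.trans ht.1⟩).mul_const _

theorem hasDerivAt_integral_mul {P : ℝ × ℝ → ℝ} {ψ : ℝ → ℝ} {a b : ℝ}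
    (hP : ContDiffOn ℝ 1 P (Ici 0 ×ˢ Ioi 0)) (ha : 0 < a) (hab : a ≤ b)
    (hψ : IntervalIntegrable ψ volume a b) {P' : ℝ → ℝ → ℝ} (hP' : ∀ x t, 0 < x → 0 < t →
      HasDerivAt (fun z => P (z, t)) (P' x t) x) {x₀ : ℝ} (hx₀ : 0 < x₀) :
    IntervalIntegrable (fun t => P' x₀ t * ψ t) volume a b ∧
    HasDerivAt (fun x => ∫ t in a..b, P (x, t) * ψ t) (∫ t in a..b, P' x₀ t * ψ t) x₀ := by
  have hQ : IsOpen (Ioi (0 : ℝ) ×ˢ Ioi (0 : ℝ)) := isOpen_Ioi.prod isOpen_Ioi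
  have hP1 : ContDiffOn ℝ 1 P (Ioi 0 ×ˢ Ioi 0) := hP.mono (prod_mono Ioi_subset_Ici_self subset_rfl)
  have hD : ContinuousOn (fun p => fderiv ℝ P p (1, 0)) (Ioi 0 ×ˢ Ioi 0) :=
    (hP1.continuousOn_fderiv_of_isOpen hQ le_rfl).clm_apply continuousOn_const
  have hEq : ∀ x t, 0 < x → 0 < t → P' x t = fderiv ℝ P (x, t) (1, 0) := by
    intro x t hx ht
    have h1 : HasFDerivAt P (fderiv ℝ P (x, t)) (x, t) :=
      ((hP1.differentiableOn one_ne_zero).differentiableAt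
        (hQ.mem_nhds (mk_mem_prod hx ht))).hasFDerivAt
    have h2 : HasDerivAt (fun z : ℝ => (z, t)) ((1 : ℝ), (0 : ℝ)) x :=
      (hasDerivAt_id x).prodMk (hasDerivAt_const x t)
    exact (hP' x t hx ht).unique (h1.comp_hasDerivAt x h2)
  have hcomp : IsCompact (Icc (x₀ / 2) (x₀ + 1) ×ˢ Icc a b) := isCompact_Icc.prod isCompact_Icc
  have hx2 : 0 < x₀ / 2 := half_pos hx₀
  obtain ⟨C, hC⟩ := hcomp.exists_bound_of_continuousOn
    (hD.mono (prod_mono (fun x hx => hx2.trans_le hx.1) fun t ht => ha.trans_le ht.1))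
  refine intervalIntegral.hasDerivAt_integral_of_dominated_loc_of_deriv_le
    (s := Icc (x₀ / 2) (x₀ + 1)) (bound := fun t => C * ‖ψ t‖) (F' := fun x t => P' x t * ψ t)
    (Icc_mem_nhds (half_lt_self hx₀) (lt_add_one x₀)) ?_ ?_ ?_ ?_ (hψ.norm.const_mul C) ?_
  · filter_upwards [Ioi_mem_nhds hx₀] with x hx
    exact (intervalIntegrable_continuousOn_mul hP1.continuousOn ha hab hψ
      hx).def'.aestronglyMeasurable
  · exact intervalIntegrable_continuousOn_mul hP1.continuousOn ha hab hψ hx₀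
  · have h3 := (intervalIntegrable_continuousOn_mul hD ha hab hψ hx₀).def'.aestronglyMeasurable
    refine h3.congr ?_
    filter_upwards [ae_restrict_mem measurableSet_uIoc] with t ht
    rw [uIoc_of_le hab] at ht
    rw [hEq x₀ t hx₀ (ha.trans ht.1)]
  · refine ae_of_all _ fun t ht x hx => ?_
    rw [uIoc_of_le hab] at ht
    rw [norm_mul, hEq x t (hx2.trans_le hx.1) (ha.trans ht.1)]
    exact mul_le_mul_of_nonneg_right (hC (x, t) ⟨hx, Ioc_subset_Icc_self ht⟩) (norm_nonneg _)
  · refine ae_of_all _ fun t ht x hx => ?_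
    rw [uIoc_of_le hab] at ht
    exact (hP' x t (hx2.trans_le hx.1) (ha.trans ht.1)).mul_const _

variable {N : ℕ} {𝒰 : Set (State N)} {f : State N → State N} {ε : ℝ} {uI uB : ℝ → State N}
  {u : ℝ → ℝ → State N} {U F : State N → ℝ}

/-- The space derivative of `u`, one-sided at `x = 0`. -/
noncomputable def spaceDeriv (u : ℝ → ℝ → State N) (x t : ℝ) : State N :=
  fderivWithin ℝ (fun p : ℝ × ℝ => u p.1 p.2) (Ici 0 ×ˢ Ioi 0) (x, t) (1, 0)

theorem uniqueDiffOn_quarter : UniqueDiffOn ℝ (Ici (0 : ℝ) ×ˢ Ioi (0 : ℝ)) :=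
  (uniqueDiffOn_Ici 0).prod isOpen_Ioi.uniqueDiffOn

namespace IsViscousSolution

theorem contDiffOn_spaceDeriv (hu : IsViscousSolution 𝒰 f ε uI uB u) :
    ContDiffOn ℝ 1 (fun p : ℝ × ℝ => spaceDeriv u p.1 p.2) (Ici 0 ×ˢ Ioi 0) :=
  (hu.contDiffOn.fderivWithin (m := 1) uniqueDiffOn_quarter (by norm_num)).clm_apply
    contDiffOn_const

theorem mapsTo (hu : IsViscousSolution 𝒰 f ε uI uB u) :
    MapsTo (fun p : ℝ × ℝ => u p.1 p.2) (Ici 0 ×ˢ Ioi 0) 𝒰 :=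
  fun p hp => hu.mem p.1 p.2 hp.1 (le_of_lt hp.2)

theorem contDiffOn_comp (hu : IsViscousSolution 𝒰 f ε uI uB u) {g : State N → ℝ}
    (hg : ContDiffOn ℝ 2 g 𝒰) :
    ContDiffOn ℝ 1 (fun p : ℝ × ℝ => g (u p.1 p.2)) (Ici 0 ×ˢ Ioi 0) :=
  (hg.comp hu.contDiffOn hu.mapsTo).of_le (by norm_num)

theorem contDiffOn_flux (hu : IsViscousSolution 𝒰 f ε uI uB u) (h𝒰 : IsOpen 𝒰)
    (hUF : IsEntropyPair 𝒰 f U F) :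
    ContDiffOn ℝ 1 (fun p : ℝ × ℝ => F (u p.1 p.2)
      - ε * fderiv ℝ U (u p.1 p.2) (spaceDeriv u p.1 p.2)) (Ici 0 ×ˢ Ioi 0) := by
  have h1 : ContDiffOn ℝ 1 (fun p : ℝ × ℝ => fderiv ℝ U (u p.1 p.2)) (Ici 0 ×ˢ Ioi 0) :=
    (hUF.contDiffOn_entropy.fderiv_of_isOpen (m := 1) h𝒰 (by norm_num)).comp
      (hu.contDiffOn.of_le (by norm_num)) hu.mapsTo
  exact (hu.contDiffOn_comp hUF.contDiffOn_flux).sub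
    (contDiffOn_const.mul (h1.clm_apply hu.contDiffOn_spaceDeriv))

theorem quarter_mem_nhds {x t : ℝ} (hx : 0 < x) (ht : 0 < t) :
    Ici (0 : ℝ) ×ˢ Ioi (0 : ℝ) ∈ 𝓝 (x, t) :=
  prod_mem_nhds (Ici_mem_nhds hx) (Ioi_mem_nhds ht)

theorem hasDerivAt_space (hu : IsViscousSolution 𝒰 f ε uI uB u) {x t : ℝ} (hx : 0 < x)
    (ht : 0 < t) : HasDerivAt (fun z => u z t) (spaceDeriv u x t) x := by
  have h1 : HasFDerivAt (fun p : ℝ × ℝ => u p.1 p.2) _ (x, t) :=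
    ((hu.contDiffOn.differentiableOn two_ne_zero (x, t)
      ⟨hx.le, ht⟩).hasFDerivWithinAt).hasFDerivAt (quarter_mem_nhds hx ht)
  have h2 : HasDerivAt (fun z : ℝ => (z, t)) ((1 : ℝ), (0 : ℝ)) x :=
    (hasDerivAt_id x).prodMk (hasDerivAt_const x t)
  exact h1.comp_hasDerivAt x h2

theorem contDiffOn_time (hu : IsViscousSolution 𝒰 f ε uI uB u) {x : ℝ} (hx : 0 ≤ x) :
    ContDiffOn ℝ 2 (fun s => u x s) (Ioi 0) :=
  hu.contDiffOn.comp (f := fun s : ℝ => (x, s)) (by fun_prop) fun s hs => ⟨hx, hs⟩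

/-- The entropy identity: compatibility turns `F(u)ₓ` into `∇U(u) f(u)ₓ`, the equation replaces
`f(u)ₓ - ε uₓₓ` by `-uₜ`, and differentiating `∇U(u)` leaves the quadratic dissipation. -/
theorem hasDerivAt_flux (hu : IsViscousSolution 𝒰 f ε uI uB u) (h𝒰 : IsOpen 𝒰)
    (hf : DifferentiableOn ℝ f 𝒰) (hUF : IsEntropyPair 𝒰 f U F) {x t : ℝ} (hx : 0 < x)
    (ht : 0 < t) :
    HasDerivAt (fun z => F (u z t) - ε * fderiv ℝ U (u z t) (spaceDeriv u z t))
      (-deriv (fun s => U (u x s)) t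
        - ε * fderiv ℝ (fderiv ℝ U) (u x t) (spaceDeriv u x t) (spaceDeriv u x t)) x := by
  have hm : u x t ∈ 𝒰 := hu.mem x t hx.le ht.le
  have hn := h𝒰.mem_nhds hm
  have hux := hu.hasDerivAt_space hx ht
  have huxx : HasDerivAt (fun z => spaceDeriv u z t) (deriv (deriv fun z => u z t) x) x := by
    have h1 : DifferentiableAt ℝ (fun p : ℝ × ℝ => spaceDeriv u p.1 p.2) (x, t) :=
      (hu.contDiffOn_spaceDeriv.differentiableOn one_ne_zero).differentiableAt
        (quarter_mem_nhds hx ht)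
    have h2 : DifferentiableAt ℝ (fun z => spaceDeriv u z t) x :=
      h1.comp (f := fun z : ℝ => (z, t)) x (by fun_prop)
    have h3 : (deriv fun z => u z t) =ᶠ[𝓝 x] fun z => spaceDeriv u z t := by
      filter_upwards [Ioi_mem_nhds hx] with z hz using (hu.hasDerivAt_space hz ht).deriv
    rw [h3.deriv_eq]
    exact h2.hasDerivAt
  have hut : HasDerivAt (fun s => u x s) (deriv (fun s => u x s) t) t :=
    (((hu.contDiffOn_time hx.le).differentiableOn two_ne_zero).differentiableAt
      (Ioi_mem_nhds ht)).hasDerivAt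
  have hU : HasFDerivAt U (fderiv ℝ U (u x t)) (u x t) :=
    ((hUF.contDiffOn_entropy.differentiableOn two_ne_zero).differentiableAt hn).hasFDerivAt
  have hF : HasFDerivAt F (fderiv ℝ F (u x t)) (u x t) :=
    ((hUF.contDiffOn_flux.differentiableOn two_ne_zero).differentiableAt hn).hasFDerivAt
  have hf' : HasFDerivAt f (fderiv ℝ f (u x t)) (u x t) := (hf.differentiableAt hn).hasFDerivAt
  have hDU : HasFDerivAt (fderiv ℝ U) (fderiv ℝ (fderiv ℝ U) (u x t)) (u x t) :=
    (((hUF.contDiffOn_entropy.fderiv_of_isOpen (m := 1) h𝒰 (by norm_num)).differentiableOn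
      one_ne_zero).differentiableAt hn).hasFDerivAt
  have h1 : HasDerivAt (fun z => F (u z t)) _ x := hF.comp_hasDerivAt x hux
  have h2 : HasDerivAt (fun z => fderiv ℝ U (u z t)) _ x := hDU.comp_hasDerivAt x hux
  have h3 : HasDerivAt (fun z => fderiv ℝ U (u z t) (spaceDeriv u z t)) _ x := h2.clm_apply huxx
  have h4 : HasDerivAt (fun s => U (u x s)) _ t := hU.comp_hasDerivAt t hut
  have h5 : HasDerivAt (fun z => f (u z t)) _ x := hf'.comp_hasDerivAt x hux
  have heq := hu.equation x t hx ht
  rw [h5.deriv] at heq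
  have heq' : fderiv ℝ U (u x t) (deriv (fun s => u x s) t)
      + fderiv ℝ U (u x t) (fderiv ℝ f (u x t) (spaceDeriv u x t))
      = ε * fderiv ℝ U (u x t) (deriv (deriv fun z => u z t) x) := by
    rw [← map_add, heq, map_smul, smul_eq_mul]
  refine (h1.sub (h3.const_mul ε)).congr_deriv ?_
  rw [h4.deriv, hUF.compatible _ hm, ContinuousLinearMap.comp_apply]
  linarith

end IsViscousSolution

/-- Time average of `g(u(x, ·))`. -/
noncomputable def solAvg (u : ℝ → ℝ → State N) (g : State N → ℝ) (ψ : ℝ → ℝ) (a b x : ℝ) : ℝ :=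
  ∫ t in a..b, g (u x t) * ψ t

/-- Time average of the viscous entropy flux `F(u) - ε ∂ₓU(u)`. -/
noncomputable def viscFlux (ε : ℝ) (u : ℝ → ℝ → State N) (U F : State N → ℝ) (ψ : ℝ → ℝ)
    (a b x : ℝ) : ℝ :=
  ∫ t in a..b, (F (u x t) - ε * fderiv ℝ U (u x t) (spaceDeriv u x t)) * ψ t

/-- The weight `ψ` is integrable on `[a, b]` and its distributional derivative there, boundary
masses included, has total mass at most `M`. -/
structure PairingBound (ψ : ℝ → ℝ) (a b M : ℝ) : Prop where
  integrable : IntervalIntegrable ψ volume a b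
  bound : ∀ g g' : ℝ → ℝ, (∀ t ∈ Icc a b, HasDerivAt g (g' t) t) → ContinuousOn g' (Icc a b) →
    ∀ B, (∀ t ∈ Icc a b, |g t| ≤ B) → |∫ t in a..b, ψ t * g' t| ≤ M * B

namespace IsViscousSolution

theorem continuousOn_solAvg (hu : IsViscousSolution 𝒰 f ε uI uB u) {g : State N → ℝ}
    (hg : ContinuousOn g 𝒰) {ψ : ℝ → ℝ} {a b : ℝ} (ha : 0 < a) (hab : a ≤ b)
    (hψ : IntervalIntegrable ψ volume a b) :
    ContinuousOn (solAvg u g ψ a b) (Ici 0) :=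
  continuousOn_integral_mul (P := fun p => g (u p.1 p.2))
    (hg.comp hu.contDiffOn.continuousOn hu.mapsTo) ha hab hψ

theorem continuousOn_viscFlux (hu : IsViscousSolution 𝒰 f ε uI uB u) (h𝒰 : IsOpen 𝒰)
    (hUF : IsEntropyPair 𝒰 f U F) {ψ : ℝ → ℝ} {a b : ℝ} (ha : 0 < a) (hab : a ≤ b)
    (hψ : IntervalIntegrable ψ volume a b) :
    ContinuousOn (viscFlux ε u U F ψ a b) (Ici 0) :=
  continuousOn_integral_mul (hu.contDiffOn_flux h𝒰 hUF).continuousOn ha hab hψ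

/-- This is the definition of the viscous flux solved for `∂ₓU(u)`. Through it the derivative of the
entropy average is controlled by fluxes, with no direct estimate on `uₓ`. -/
theorem hasDerivAt_solAvg (hu : IsViscousSolution 𝒰 f ε uI uB u) (h𝒰 : IsOpen 𝒰)
    (hε : ε ≠ 0) (hUF : IsEntropyPair 𝒰 f U F) {ψ : ℝ → ℝ} {a b : ℝ} (ha : 0 < a) (hab : a ≤ b)
    (hψ : IntervalIntegrable ψ volume a b) {x : ℝ} (hx : 0 < x) :
    HasDerivAt (solAvg u U ψ a b) (ε⁻¹ * (solAvg u F ψ a b x - viscFlux ε u U F ψ a b x)) x := by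
  obtain ⟨hi, hd⟩ := hasDerivAt_integral_mul (P := fun p => U (u p.1 p.2))
    (hu.contDiffOn_comp hUF.contDiffOn_entropy) ha hab hψ
    (P' := fun x t => fderiv ℝ U (u x t) (spaceDeriv u x t)) (fun x t hx ht => by
      have hn := h𝒰.mem_nhds (hu.mem x t hx.le ht.le)
      exact ((hUF.contDiffOn_entropy.differentiableOn two_ne_zero).differentiableAt
        hn).hasFDerivAt.comp_hasDerivAt x (hu.hasDerivAt_space hx ht)) hx
  refine hd.congr_deriv ?_
  have hF := intervalIntegrable_continuousOn_mul (P := fun p => F (u p.1 p.2)) (s := Ici 0)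
    (hUF.contDiffOn_flux.continuousOn.comp hu.contDiffOn.continuousOn hu.mapsTo) ha hab hψ
    (x := x) hx.le
  have : viscFlux ε u U F ψ a b x = solAvg u F ψ a b x
      - ε * ∫ t in a..b, fderiv ℝ U (u x t) (spaceDeriv u x t) * ψ t := by
    rw [viscFlux, solAvg, ← intervalIntegral.integral_const_mul,
      ← intervalIntegral.integral_sub hF (hi.const_mul ε)]
    exact intervalIntegral.integral_congr fun t _ => by simp only; ring
  rw [this]
  field_simp
  ring

/-- In the derivative of the flux the dissipation has a favorable sign, and the remaining pairing of
`ψ` with `∂ₜU(u)` is at most `M * B`, a bound free of `ε`. The sign condition is put on the product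
of Hessian and weight, so that it also covers entropies with zero Hessian and weights of arbitrary
sign. -/
theorem viscFlux_le (hu : IsViscousSolution 𝒰 f ε uI uB u) (h𝒰 : IsOpen 𝒰) (hε : 0 < ε)
    (hf : DifferentiableOn ℝ f 𝒰) (hUF : IsEntropyPair 𝒰 f U F) {ψ : ℝ → ℝ} {a b M : ℝ}
    (ha : 0 < a) (hab : a ≤ b) (hψ : PairingBound ψ a b M)
    (hsign : ∀ w ∈ 𝒰, ∀ z, ∀ t ∈ Icc a b, 0 ≤ fderiv ℝ (fderiv ℝ U) w z z * ψ t)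
    {B : ℝ} (hB : ∀ x t, 0 ≤ x → 0 ≤ t → |U (u x t)| ≤ B) {x y : ℝ} (hx : 0 ≤ x) (hxy : x ≤ y) :
    viscFlux ε u U F ψ a b y ≤ viscFlux ε u U F ψ a b x + M * B * (y - x) := by
  have hd : ∀ z : ℝ, 0 < z → _ := fun z hz => hasDerivAt_integral_mul
    (P := fun p => F (u p.1 p.2) - ε * fderiv ℝ U (u p.1 p.2) (spaceDeriv u p.1 p.2))
    (hu.contDiffOn_flux h𝒰 hUF) ha hab hψ.integrable
    (fun x t hx ht => hu.hasDerivAt_flux h𝒰 hf hUF hx ht) hz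
  have hd' : ∀ z : ℝ, 0 < z → HasDerivAt (viscFlux ε u U F ψ a b) _ z := fun z hz => (hd z hz).2
  have := (convex_Ici (0 : ℝ)).image_sub_le_mul_sub_of_deriv_le (C := M * B)
    (hu.continuousOn_viscFlux h𝒰 hUF ha hab hψ.integrable)
    (by rw [interior_Ici]; exact fun z hz => (hd' z hz).differentiableAt.differentiableWithinAt)
    (by
      rw [interior_Ici]
      intro z hz
      have hz0 : (0 : ℝ) < z := hz
      rw [(hd' z hz).deriv]
      have hUt : ContDiffOn ℝ 2 (fun s => U (u z s)) (Ioi 0) :=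
        hUF.contDiffOn_entropy.comp (hu.contDiffOn_time hz0.le) fun s hs =>
          hu.mem z s hz0.le (le_of_lt hs)
      have hcont : ContinuousOn (deriv fun s => U (u z s)) (Icc a b) :=
        (hUt.continuousOn_deriv_of_isOpen isOpen_Ioi (by norm_num)).mono
          fun t ht => ha.trans_le ht.1
      have hp := hψ.bound (fun s => U (u z s)) (deriv fun s => U (u z s))
        (fun t ht => ((hUt.differentiableOn two_ne_zero).differentiableAt
          (Ioi_mem_nhds (ha.trans_le ht.1))).hasDerivAt) hcont B
        (fun t ht => hB z t hz0.le (ha.le.trans ht.1))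
      have h_int : IntervalIntegrable (fun t => -(ψ t * deriv (fun s => U (u z s)) t)) volume a b :=
        (hψ.integrable.mul_continuousOn (by rwa [uIcc_of_le hab])).neg
      calc _ ≤ ∫ t in a..b, -(ψ t * deriv (fun s => U (u z s)) t) := by
            refine intervalIntegral.integral_mono_on hab (hd z hz).1 h_int fun t ht => ?_
            have h1 := hsign (u z t) (hu.mem z t hz0.le (ha.le.trans ht.1)) (spaceDeriv u z t) t ht
            have h2 := mul_nonneg hε.le h1
            linarith
        _ ≤ M * B := by
            rw [intervalIntegral.integral_neg]
            linarith [neg_abs_le (∫ t in a..b, ψ t * deriv (fun s => U (u z s)) t)])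
    x hx y (hx.trans hxy) hxy
  linarith

/-- Weak form of the definition of the viscous flux, at the scale `x = s y`. -/
theorem integral_viscFlux_mul (hu : IsViscousSolution 𝒰 f ε uI uB u) (h𝒰 : IsOpen 𝒰)
    (hε : ε ≠ 0) (hUF : IsEntropyPair 𝒰 f U F) {ψ : ℝ → ℝ} {a b : ℝ} (ha : 0 < a) (hab : a ≤ b)
    (hψ : IntervalIntegrable ψ volume a b) {s : ℝ} (hs : 0 < s) {φ : ℝ → ℝ}
    (hφ : IsTest (Ioi 0) φ) :
    ∫ y in Ioi 0, viscFlux ε u U F ψ a b (s * y) * φ y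
      = (∫ y in Ioi 0, solAvg u F ψ a b (s * y) * φ y)
        + ε / s * ∫ y in Ioi 0, solAvg u U ψ a b (s * y) * deriv φ y := by
  obtain ⟨α, β, hα, hαβ, hsupp⟩ := hφ.exists_Icc
  -- The interval `[α / 2, β + 1]` contains the support of `φ` strictly, so `φ` vanishes at both
  -- ends and the boundary terms of the integration by parts drop out.
  have hα2 : 0 < α / 2 := half_pos hα
  have hle : α / 2 ≤ β + 1 := by linarith
  have h0 : ∀ x, x ∉ Icc (α / 2) (β + 1) → φ x = 0 := fun x hx =>
    image_eq_zero_of_notMem_tsupport fun h' => hx ⟨by linarith [(hsupp h').1],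
      by linarith [(hsupp h').2]⟩
  have h0' : ∀ x, x ∉ Icc (α / 2) (β + 1) → deriv φ x = 0 := fun x hx => by
    by_contra h
    have h' := (support_deriv_subset (f := φ)) h
    exact hx ⟨by linarith [(hsupp h').1], by linarith [(hsupp h').2]⟩
  have hφα : φ (α / 2) = 0 := image_eq_zero_of_notMem_tsupport fun h' => by
    linarith [(hsupp h').1]
  have hφβ : φ (β + 1) = 0 := image_eq_zero_of_notMem_tsupport fun h' => by
    linarith [(hsupp h').2]
  have hmaps : MapsTo (fun y => s * y) (uIcc (α / 2) (β + 1)) (Ici 0) := fun y hy => by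
    rw [uIcc_of_le hle] at hy
    exact mul_nonneg hs.le (hα2.le.trans hy.1)
  have hc1 : ContinuousOn (fun y => viscFlux ε u U F ψ a b (s * y)) (uIcc (α / 2) (β + 1)) :=
    (hu.continuousOn_viscFlux h𝒰 hUF ha hab hψ).comp (by fun_prop) hmaps
  have hc2 : ContinuousOn (fun y => solAvg u F ψ a b (s * y)) (uIcc (α / 2) (β + 1)) :=
    (hu.continuousOn_solAvg hUF.contDiffOn_flux.continuousOn ha hab hψ).comp (by fun_prop) hmaps
  have hφc : Continuous φ := hφ.smooth.continuous
  have hφ' : Continuous (deriv φ) := hφ.smooth.continuous_deriv (by norm_num)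
  have hder : ∀ y ∈ uIcc (α / 2) (β + 1), HasDerivAt (fun y => solAvg u U ψ a b (s * y))
      (s * ε⁻¹ * (solAvg u F ψ a b (s * y) - viscFlux ε u U F ψ a b (s * y))) y := by
    intro y hy
    rw [uIcc_of_le hle] at hy
    have h1 := (hu.hasDerivAt_solAvg h𝒰 hε hUF ha hab hψ (x := s * y)
      (mul_pos hs (hα2.trans_le hy.1))).comp y ((hasDerivAt_id y).const_mul s)
    refine h1.congr_deriv ?_
    ring
  have hparts := intervalIntegral.integral_mul_deriv_eq_deriv_mul hder
    (fun y _ => ((hφ.smooth.differentiable (by simp)) y).hasDerivAt)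
    ((continuousOn_const.mul (hc2.sub hc1)).intervalIntegrable) (hφ'.intervalIntegrable _ _)
  rw [hφα, hφβ, mul_zero, mul_zero, sub_zero, zero_sub] at hparts
  rw [setIntegral_Ioi_eq hα2 hle (fun x hx => by rw [h0 x hx, mul_zero]),
    setIntegral_Ioi_eq hα2 hle (fun x hx => by rw [h0 x hx, mul_zero]),
    setIntegral_Ioi_eq hα2 hle (fun x hx => by rw [h0' x hx, mul_zero]), hparts]
  have hi1 : IntervalIntegrable (fun y => viscFlux ε u U F ψ a b (s * y) * φ y) volume
    (α / 2) (β + 1) := (hc1.mul hφc.continuousOn).intervalIntegrable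
  have hi2 : IntervalIntegrable (fun y => solAvg u F ψ a b (s * y) * φ y) volume
    (α / 2) (β + 1) := (hc2.mul hφc.continuousOn).intervalIntegrable
  have : ∫ y in α / 2..β + 1, s * ε⁻¹ * (solAvg u F ψ a b (s * y)
      - viscFlux ε u U F ψ a b (s * y)) * φ y
      = s * ε⁻¹ * ((∫ y in α / 2..β + 1, solAvg u F ψ a b (s * y) * φ y)
        - ∫ y in α / 2..β + 1, viscFlux ε u U F ψ a b (s * y) * φ y) := by
    rw [← intervalIntegral.integral_sub hi2 hi1, ← intervalIntegral.integral_const_mul]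
    exact intervalIntegral.integral_congr fun t _ => by ring
  rw [this]
  field_simp
  ring

end IsViscousSolution

end BoundaryLayer

/-! ### Confinement to a compact set -/

namespace BoundaryLayer

theorem MemLp_top_ae_bound {α : Type*} [MeasurableSpace α] {m : Measure α} {h : α → ℝ}
    (hh : MemLp h ⊤ m) : ∃ C : ℝ, ∀ᵐ p ∂m, ‖h p‖ ≤ C := by
  refine ⟨(eLpNorm h ⊤ m).toReal, ?_⟩
  have h1 := ae_le_eLpNormEssSup (f := h) (μ := m)
  rw [← eLpNorm_exponent_top] at h1
  filter_upwards [h1] with p hp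
  have h2 := ENNReal.toReal_mono hh.eLpNorm_ne_top hp
  simpa using h2

theorem integrable_mul_of_memLp_top {α : Type*} [MeasurableSpace α] {m : Measure α} {h φ : α → ℝ}
    (hh : MemLp h ⊤ m) (hφ : Integrable φ m) : Integrable (fun p => h p * φ p) m := by
  obtain ⟨C, hC⟩ := MemLp_top_ae_bound hh
  exact hφ.bdd_mul hh.aestronglyMeasurable hC

/-- Weakly-`⋆` convergent sequences are bounded. -/
theorem WeakStarTendsto.exists_bound {h : ℕ → ℝ × ℝ → ℝ} {h' : ℝ × ℝ → ℝ}
    (H : WeakStarTendsto h h') :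
    ∃ C : ℝ, ∀ n, ∀ φ : ℝ × ℝ → ℝ, Integrable φ volQuarter →
      |∫ p, h n p * φ p ∂volQuarter| ≤ C * ∫ p, |φ p| ∂volQuarter := by
  have h_int : ∀ n (φ : Lp ℝ 1 volQuarter), Integrable (fun p => h n p * φ p) volQuarter :=
    fun n φ => integrable_mul_of_memLp_top (H.memLp n) (L1.integrable_coeFn φ)
  choose B hB using fun n => MemLp_top_ae_bound (H.memLp n)
  let Λ : ℕ → Lp ℝ 1 volQuarter →L[ℝ] ℝ := fun n => LinearMap.mkContinuous
    { toFun := fun φ => ∫ p, h n p * φ p ∂volQuarter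
      map_add' := fun φ χ => by
        rw [← integral_add (h_int n φ) (h_int n χ)]
        refine integral_congr_ae ?_
        filter_upwards [Lp.coeFn_add φ χ] with p hp
        rw [hp, Pi.add_apply, mul_add]
      map_smul' := fun r φ => by
        rw [RingHom.id_apply, smul_eq_mul, ← integral_const_mul]
        refine integral_congr_ae ?_
        filter_upwards [Lp.coeFn_smul r φ] with p hp
        rw [hp, Pi.smul_apply, smul_eq_mul]
        ring } (B n) (fun φ => by
      rw [L1.norm_eq_integral_norm, ← integral_const_mul]
      refine norm_integral_le_of_norm_le ((L1.integrable_coeFn φ).norm.const_mul _) ?_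
      filter_upwards [hB n] with p hp
      rw [norm_mul]
      exact mul_le_mul_of_nonneg_right hp (norm_nonneg _))
  obtain ⟨C, hC⟩ := banach_steinhaus (g := Λ) fun φ => by
    obtain ⟨C, hC⟩ := ((H.tendsto φ (L1.integrable_coeFn φ)).norm).bddAbove_range
    exact ⟨C, fun n => hC ⟨n, rfl⟩⟩
  refine ⟨C, fun n φ hφ => ?_⟩
  have h1 := (Λ n).le_of_opNorm_le (hC n) (hφ.toL1 φ)
  rw [L1.norm_eq_integral_norm] at h1
  have h2 : Λ n (hφ.toL1 φ) = ∫ p, h n p * φ p ∂volQuarter :=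
    integral_congr_ae (by filter_upwards [hφ.coeFn_toL1] with p hp; rw [hp])
  have h3 : ∫ p, ‖hφ.toL1 φ p‖ ∂volQuarter = ∫ p, |φ p| ∂volQuarter :=
    integral_congr_ae (by filter_upwards [hφ.coeFn_toL1] with p hp; rw [hp, Real.norm_eq_abs])
  rwa [h2, h3] at h1

/-- If `h` exceeded `C` at a point, it would do so on a small open set of positive finite measure,
whose indicator violates the hypothesis. Continuity thus turns the weak bound into one at every
point. -/
theorem le_of_forall_integral_mul_le {h : ℝ × ℝ → ℝ} {C : ℝ}
    (hc : ContinuousOn h (Ioi 0 ×ˢ Ioi 0)) (hm : MemLp h ⊤ volQuarter)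
    (H : ∀ φ : ℝ × ℝ → ℝ, Integrable φ volQuarter →
      |∫ p, h p * φ p ∂volQuarter| ≤ C * ∫ p, |φ p| ∂volQuarter) :
    ∀ p ∈ (Ioi 0 ×ˢ Ioi 0 : Set (ℝ × ℝ)), h p ≤ C := by
  intro p hp
  by_contra! hlt
  have hQ : IsOpen (Ioi (0 : ℝ) ×ˢ Ioi (0 : ℝ)) := isOpen_Ioi.prod isOpen_Ioi
  set O := ((Ioi (0 : ℝ) ×ˢ Ioi (0 : ℝ)) ∩ h ⁻¹' Ioi C) ∩ Metric.ball p 1 with hO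
  have hOo : IsOpen O := (hc.isOpen_inter_preimage hQ isOpen_Ioi).inter Metric.isOpen_ball
  have hOp : p ∈ O := ⟨⟨hp, hlt⟩, Metric.mem_ball_self one_pos⟩
  have hOm := hOo.measurableSet
  have hOQ : O ⊆ Ioi (0 : ℝ) ×ˢ Ioi (0 : ℝ) := fun q hq => hq.1.1
  have hvol : volQuarter O = volume O := Measure.restrict_eq_self _ hOQ
  have hfin : volQuarter O ≠ ⊤ := by
    rw [hvol]
    exact ((measure_mono inter_subset_right).trans_lt measure_ball_lt_top).ne
  have hpos : 0 < volQuarter O := by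
    rw [hvol]; exact hOo.measure_pos volume ⟨p, hOp⟩
  have hφ : Integrable (O.indicator fun _ => (1 : ℝ)) volQuarter :=
    (integrable_indicator_iff hOm).2 (integrableOn_const hfin)
  have h1 := H _ hφ
  have h2 : ∫ q, |O.indicator (fun _ => (1 : ℝ)) q| ∂volQuarter
      = ∫ q in O, (1 : ℝ) ∂volQuarter := by
    rw [← integral_indicator hOm]
    refine integral_congr_ae (ae_of_all _ fun q => ?_)
    by_cases hq : q ∈ O <;> simp [hq]
  have h3 : ∫ q, h q * O.indicator (fun _ => (1 : ℝ)) q ∂volQuarter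
      = ∫ q in O, h q ∂volQuarter := by
    rw [← integral_indicator hOm]
    refine integral_congr_ae (ae_of_all _ fun q => ?_)
    by_cases hq : q ∈ O <;> simp [hq]
  have hi : IntegrableOn h O volQuarter := by
    rw [← integrable_indicator_iff hOm]
    refine (integrable_mul_of_memLp_top hm hφ).congr (ae_of_all _ fun q => ?_)
    by_cases hq : q ∈ O <;> simp [hq]
  rw [h2, h3, ← integral_const_mul] at h1
  have h4 : 0 < ∫ q in O, (h q - C * 1) ∂volQuarter := by
    rw [setIntegral_pos_iff_support_of_nonneg_ae]
    · refine hpos.trans_le (measure_mono fun q hq => ⟨?_, hq⟩)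
      have : C < h q := hq.1.2
      simp only [Function.mem_support]
      linarith
    · filter_upwards [ae_restrict_mem hOm] with q hq
      have : C < h q := hq.1.2
      simp only [Pi.zero_apply]
      linarith
    · exact hi.sub (integrableOn_const hfin)
  rw [integral_sub hi (integrableOn_const hfin)] at h4
  linarith [le_abs_self (∫ q in O, h q ∂volQuarter)]

variable {N : ℕ} {𝒰 : Set (State N)}

/-- The distance to `𝒰ᶜ` is at least `δ` exactly when every translate by a vector shorter than `δ`
stays in `𝒰`, a condition stable under convex combinations. -/
theorem convex_setOf_le_infDist_compl (hne : 𝒰 ≠ univ) (h𝒰c : Convex ℝ 𝒰) (δ : ℝ) :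
    Convex ℝ {z | δ ≤ Metric.infDist z 𝒰ᶜ} := by
  have hcne : (𝒰ᶜ).Nonempty := nonempty_compl.2 hne
  have key : ∀ z, δ ≤ Metric.infDist z 𝒰ᶜ ↔ ∀ d : State N, ‖d‖ < δ → z + d ∈ 𝒰 := by
    intro z
    rw [Metric.le_infDist hcne]
    constructor
    · intro h d hd
      by_contra hn
      have := h hn
      rw [dist_self_add_right] at this
      linarith
    · intro h y hy
      by_contra! hlt
      refine hy ?_
      have := h (y - z) (by rwa [dist_comm, dist_eq_norm] at hlt)
      rwa [add_sub_cancel] at this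
  intro z hz w hw a b ha hb hab
  rw [mem_ofPred_eq, key] at hz hw ⊢
  intro d hd
  have := h𝒰c (hz d hd) (hw d hd) ha hb hab
  rwa [smul_add, smul_add, add_add_add_comm, ← add_smul, hab, one_smul] at this

/-- Weak-star convergence is available for every continuous function on `𝒰`, including `1 / dist(·,
𝒰ᶜ)`, which blows up at the boundary. Convergent sequences being bounded, this function stays
bounded along the `w n`, which keeps them at a fixed distance from `𝒰ᶜ`. Convexity of the resulting
set serves later to get Lipschitz bounds. -/
theorem IsYoungMeasure.exists_compact_range (h𝒰 : IsOpen 𝒰) (h𝒰c : Convex ℝ 𝒰)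
    {w : ℕ → ℝ × ℝ → State N} {κ : Kernel (ℝ × ℝ) (State N)} (hκ : IsYoungMeasure 𝒰 w κ)
    (hw : ∀ n, ContinuousOn (w n) (Ici 0 ×ˢ Ici 0))
    (hmem : ∀ n, ∀ p ∈ (Ici 0 ×ˢ Ici 0 : Set (ℝ × ℝ)), w n p ∈ 𝒰)
    {C : ℝ} (hC : ∀ n, ∀ p ∈ (Ici 0 ×ˢ Ici 0 : Set (ℝ × ℝ)), ‖w n p‖ ≤ C) :
    ∃ K : Set (State N), IsCompact K ∧ Convex ℝ K ∧ K ⊆ 𝒰 ∧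
      ∀ n, ∀ p ∈ (Ici 0 ×ˢ Ici 0 : Set (ℝ × ℝ)), w n p ∈ K := by
  rcases eq_or_ne 𝒰 univ with rfl | hne
  · exact ⟨Metric.closedBall 0 C, isCompact_closedBall 0 C, convex_closedBall 0 C, subset_univ _,
      fun n p hp => by simpa using hC n p hp⟩
  have hcl : IsClosed 𝒰ᶜ := h𝒰.isClosed_compl
  have hcne : (𝒰ᶜ).Nonempty := nonempty_compl.2 hne
  have hpos : ∀ z ∈ 𝒰, 0 < Metric.infDist z 𝒰ᶜ := fun z hz =>
    (hcl.notMem_iff_infDist_pos hcne).1 (not_not.2 hz)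
  have hg : ContinuousOn (fun z => (Metric.infDist z 𝒰ᶜ)⁻¹) 𝒰 :=
    (Metric.continuous_infDist_pt _).continuousOn.inv₀ fun z hz => (hpos z hz).ne'
  have H := hκ.weakStar _ hg
  obtain ⟨D, hD⟩ := H.exists_bound
  have hQ : (Ioi (0 : ℝ) ×ˢ Ioi (0 : ℝ)) ⊆ Ici 0 ×ˢ Ici 0 :=
    prod_mono Ioi_subset_Ici_self Ioi_subset_Ici_self
  have hle : ∀ n, ∀ p ∈ (Ioi 0 ×ˢ Ioi 0 : Set (ℝ × ℝ)), (Metric.infDist (w n p) 𝒰ᶜ)⁻¹ ≤ D :=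
    fun n => le_of_forall_integral_mul_le
      (hg.comp ((hw n).mono hQ) fun p hp => hmem n p (hQ hp)) (H.memLp n) (hD n)
  have hD0 : 0 < D := by
    have h1 : ((1 : ℝ), (1 : ℝ)) ∈ (Ioi 0 ×ˢ Ioi 0 : Set (ℝ × ℝ)) := by simp
    exact (inv_pos.2 (hpos _ (hmem 0 _ (hQ h1)))).trans_le (hle 0 _ h1)
  set K₀ := Metric.closedBall (0 : State N) C ∩ {z | D⁻¹ ≤ Metric.infDist z 𝒰ᶜ} with hK₀
  have hK₀cl : IsClosed {z : State N | D⁻¹ ≤ Metric.infDist z 𝒰ᶜ} :=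
    isClosed_le continuous_const (Metric.continuous_infDist_pt _)
  have hK₀c : IsCompact K₀ := (isCompact_closedBall 0 C).inter_right hK₀cl
  have hK₀U : K₀ ⊆ 𝒰 := by
    intro z hz
    by_contra hzn
    have h1 : Metric.infDist z 𝒰ᶜ = 0 := Metric.infDist_zero_of_mem hzn
    have h2 : D⁻¹ ≤ Metric.infDist z 𝒰ᶜ := hz.2
    rw [h1] at h2
    exact absurd h2 (not_le.2 (inv_pos.2 hD0))
  refine ⟨K₀, hK₀c, (convex_closedBall 0 C).inter (convex_setOf_le_infDist_compl hne h𝒰c D⁻¹), hK₀U,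
    fun n p hp => ⟨by simpa using hC n p hp, ?_⟩⟩
  -- The bound is known on the open quarter plane only; continuity carries it to the edges, where
  -- the initial and boundary data live.
  have hpc : p ∈ closure (Ioi (0 : ℝ) ×ˢ Ioi (0 : ℝ)) := by
    rw [closure_prod_eq, closure_Ioi]; exact hp
  have := ((hw n p hp).mono hQ).mem_closure hpc
    (t := {z | D⁻¹ ≤ Metric.infDist z 𝒰ᶜ}) fun q hq => by
      have h1 := hpos _ (hmem n q (hQ hq))
      exact (inv_le_comm₀ h1 hD0).1 (hle n q hq)
  rwa [hK₀cl.closure_eq] at this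

/-- The bounded continuous function `min (dist(·, K)) 1` vanishes along the sequence, hence its
integral against the limit vanishes almost everywhere, and it is positive off `K`. -/
theorem IsYoungMeasure.ae_compl_eq_zero {w : ℕ → ℝ × ℝ → State N}
    {κ : Kernel (ℝ × ℝ) (State N)} (hκ : IsYoungMeasure 𝒰 w κ) {K : Set (State N)}
    (hK : IsClosed K)
    (hmem : ∀ n, ∀ p ∈ (Ioi 0 ×ˢ Ioi 0 : Set (ℝ × ℝ)), w n p ∈ K) :
    ∀ᵐ p ∂volQuarter, κ p Kᶜ = 0 := by
  have := hκ.markov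
  have hQm : MeasurableSet (Ioi (0 : ℝ) ×ˢ Ioi (0 : ℝ)) := measurableSet_Ioi.prod measurableSet_Ioi
  set g : State N → ℝ := fun z => min (Metric.infDist z K) 1 with hg
  have hgc : Continuous g := (Metric.continuous_infDist_pt K).min continuous_const
  have hg0 : ∀ z, 0 ≤ g z := fun z => le_min Metric.infDist_nonneg zero_le_one
  have H := hκ.weakStar g hgc.continuousOn
  have hz : (fun p => ∫ z, g z ∂(κ p)) =ᵐ[volQuarter] 0 := by
    refine ae_eq_zero_of_forall_setIntegral_eq_of_sigmaFinite (fun s hs hfin => ?_)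
      fun s hs hfin => ?_
    · rw [← integrable_indicator_iff hs]
      refine (integrable_mul_of_memLp_top H.memLp_limit
        ((integrable_indicator_iff hs).2 (integrableOn_const (C := (1 : ℝ)) hfin.ne))).congr
        (ae_of_all _ fun q => ?_)
      by_cases hq : q ∈ s <;> simp [hq]
    · have h1 := H.tendsto (s.indicator fun _ => (1 : ℝ))
        ((integrable_indicator_iff hs).2 (integrableOn_const hfin.ne))
      have h2 : ∀ n, ∫ p, g (w n p) * s.indicator (fun _ => (1 : ℝ)) p ∂volQuarter = 0 := by
        intro n
        refine integral_eq_zero_of_ae ?_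
        filter_upwards [ae_restrict_mem hQm] with p hp
        have : g (w n p) = 0 := by
          simp [hg, Metric.infDist_zero_of_mem (hmem n p hp)]
        simp [this]
      simp only [h2] at h1
      have h3 := tendsto_nhds_unique h1 tendsto_const_nhds
      rw [← integral_indicator hs, ← h3]
      refine integral_congr_ae (ae_of_all _ fun q => ?_)
      by_cases hq : q ∈ s <;> simp [hq]
  filter_upwards [hz] with p hp
  -- `Metric.infDist` to the empty set is `0` by convention, so the empty case is excluded
  -- separately: `K` contains a value of `w 0`.
  rcases K.eq_empty_or_nonempty with rfl | hne
  · exfalso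
    have h1 : ((1 : ℝ), (1 : ℝ)) ∈ (Ioi 0 ×ˢ Ioi 0 : Set (ℝ × ℝ)) := by simp
    exact hmem 0 _ h1
  have h_int : Integrable g (κ p) := by
    refine (integrable_const (1 : ℝ)).mono' hgc.aestronglyMeasurable (ae_of_all _ fun z => ?_)
    rw [Real.norm_eq_abs, abs_of_nonneg (hg0 z)]
    exact min_le_right _ _
  have h4 := (integral_eq_zero_iff_of_nonneg hg0 h_int).1 hp
  refine measure_mono_null (fun z hz => ?_) (ae_iff.1 h4)
  have : 0 < Metric.infDist z K := (hK.notMem_iff_infDist_pos hne).1 hz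
  exact (lt_min this one_pos).ne'

theorem abs_integral_le_of_compl_eq_zero {K : Set (State N)} {m : Measure (State N)}
    [IsProbabilityMeasure m] (hm : m Kᶜ = 0) {g : State N → ℝ} {B : ℝ}
    (hB : ∀ z ∈ K, |g z| ≤ B) : |∫ z, g z ∂m| ≤ B := by
  have h1 : ∀ᵐ z ∂m, ‖g z‖ ≤ B := by
    filter_upwards [measure_eq_zero_iff_ae_notMem.1 hm] with z hz using hB z (not_not.1 hz)
  simpa using norm_integral_le_of_norm_le_const h1

end BoundaryLayer

/-! ### Convergence of weighted averages over shrinking time windows -/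

namespace BoundaryLayer

theorem volQuarter_eq_prod : volQuarter = volHalf.prod volHalf := by
  rw [volQuarter, volHalf, Measure.prod_restrict]; rfl

theorem integral_quarter_mul {h : ℝ × ℝ → ℝ} (hh : MemLp h ⊤ volQuarter) {φ χ : ℝ → ℝ}
    (hφ : Integrable φ volHalf) (hχ : Integrable χ volHalf) :
    ∫ p, h p * (φ p.1 * χ p.2) ∂volQuarter
      = ∫ y in Ioi 0, (∫ t in Ioi 0, h (y, t) * χ t) * φ y := by
  have h1 : Integrable (fun p : ℝ × ℝ => φ p.1 * χ p.2) volQuarter := by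
    rw [volQuarter_eq_prod]; exact hφ.mul_prod hχ
  have h2 := integrable_mul_of_memLp_top hh h1
  rw [volQuarter_eq_prod] at h2 ⊢
  rw [integral_prod _ h2]
  refine integral_congr_ae (ae_of_all _ fun y => ?_)
  simp only
  rw [← integral_mul_const]
  exact integral_congr_ae (ae_of_all _ fun t => by simp only; ring)

theorem intervalIntegral_eq_indicator {h ψ : ℝ → ℝ} {a b : ℝ} (ha : 0 ≤ a) (hab : a ≤ b) :
    ∫ t in a..b, h t * ψ t = ∫ t in Ioi 0, h t * (Ioc a b).indicator ψ t := by
  rw [intervalIntegral.integral_of_le hab]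
  have : Ioc a b ⊆ Ioi 0 := fun t ht => ha.trans_lt ht.1
  rw [← inter_eq_self_of_subset_right this, ← setIntegral_indicator measurableSet_Ioc,
    inter_eq_self_of_subset_right this]
  refine integral_congr_ae (ae_of_all _ fun t => ?_)
  by_cases ht : t ∈ Ioc a b <;> simp [ht]

theorem integrable_of_bound_of_support {χ : ℝ → ℝ} {A T : ℝ}
    (hm : AEStronglyMeasurable χ volHalf)
    (hA : ∀ᵐ t ∂volHalf, |χ t| ≤ (Iic T).indicator (fun _ => A) t) :
    Integrable χ volHalf := by
  refine Integrable.mono' (g := (Iic T).indicator fun _ => A) ?_ hm hA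
  rw [integrable_indicator_iff measurableSet_Iic]
  refine integrableOn_const ?_
  rw [Measure.restrict_apply measurableSet_Iic, Iic_inter_Ioi]
  exact measure_Ioc_lt_top.ne

variable {N : ℕ} {𝒰 K : Set (State N)}

/-- Weak-star convergence handles a fixed test. The weights converge in `L¹` by domination, and `g
(w n)` is uniformly bounded, so replacing the limit weight by the `n`-th one changes the integral by
`o(1)`. -/
theorem IsYoungMeasure.tendsto_integral {w : ℕ → ℝ × ℝ → State N}
    {κ : Kernel (ℝ × ℝ) (State N)} (hκ : IsYoungMeasure 𝒰 w κ) {g : State N → ℝ}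
    (hg : ContinuousOn g 𝒰) {B : ℝ}
    (hB : ∀ n, ∀ p ∈ (Ioi 0 ×ˢ Ioi 0 : Set (ℝ × ℝ)), |g (w n p)| ≤ B)
    {χn : ℕ → ℝ → ℝ} {χ : ℝ → ℝ} {A T : ℝ}
    (hm : ∀ n, AEStronglyMeasurable (χn n) volHalf)
    (hA : ∀ n, ∀ᵐ t ∂volHalf, |χn n t| ≤ (Iic T).indicator (fun _ => A) t)
    (hlim : ∀ᵐ t ∂volHalf, Tendsto (fun n => χn n t) atTop (𝓝 (χ t)))
    {φ : ℝ → ℝ} (hφ : Integrable φ volHalf) :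
    Tendsto (fun n => ∫ y in Ioi 0, (∫ t in Ioi 0, g (w n (y, t)) * χn n t) * φ y) atTop
      (𝓝 (∫ y in Ioi 0, (∫ t in Ioi 0, (∫ z, g z ∂(κ (y, t))) * χ t) * φ y)) := by
  have H := hκ.weakStar g hg
  have hχm : AEStronglyMeasurable χ volHalf := aestronglyMeasurable_of_tendsto_ae _ hm hlim
  have hχA : ∀ᵐ t ∂volHalf, |χ t| ≤ (Iic T).indicator (fun _ => A) t := by
    filter_upwards [hlim, ae_all_iff.2 hA] with t ht hAt
    exact le_of_tendsto' ht.abs hAt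
  have hχi := integrable_of_bound_of_support hχm hχA
  have hχni := fun n => integrable_of_bound_of_support (hm n) (hA n)
  have hprod : ∀ {χ : ℝ → ℝ}, Integrable χ volHalf →
      Integrable (fun p : ℝ × ℝ => φ p.1 * χ p.2) volQuarter := fun hχ => by
    rw [volQuarter_eq_prod]; exact hφ.mul_prod hχ
  rw [← integral_quarter_mul H.memLp_limit hφ hχi]
  have h1 := H.tendsto _ (hprod hχi)
  have hQm : MeasurableSet (Ioi (0 : ℝ) ×ˢ Ioi (0 : ℝ)) := measurableSet_Ioi.prod measurableSet_Ioi
  have hL1 : Tendsto (fun n => ∫ t, |χn n t - χ t| ∂volHalf) atTop (𝓝 0) := by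
    have h0 : (0 : ℝ) = ∫ t, (0 : ℝ) ∂volHalf := by simp
    rw [h0]
    refine tendsto_integral_of_dominated_convergence
      (fun t => (Iic T).indicator (fun _ => A) t + |χ t|)
      (fun n => ((hm n).sub hχm).norm) ?_ ?_ ?_
    · refine Integrable.add ?_ hχi.norm
      rw [integrable_indicator_iff measurableSet_Iic]
      refine integrableOn_const ?_
      rw [Measure.restrict_apply measurableSet_Iic, Iic_inter_Ioi]
      exact measure_Ioc_lt_top.ne
    · intro n
      filter_upwards [hA n] with t ht
      rw [Real.norm_eq_abs, abs_abs]
      exact (abs_sub _ _).trans (by gcongr)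
    · filter_upwards [hlim] with t ht
      simpa using (ht.sub_const (χ t)).abs
  have h2 : Tendsto (fun n => ∫ p, g (w n p) * (φ p.1 * (χn n p.2 - χ p.2)) ∂volQuarter) atTop
      (𝓝 0) := by
    refine squeeze_zero_norm (a := fun n => B * ((∫ y, |φ y| ∂volHalf)
      * ∫ t, |χn n t - χ t| ∂volHalf)) (fun n => ?_) ?_
    · rw [← integral_prod_mul (μ := volHalf) (ν := volHalf) (fun y => |φ y|)
        (fun t => |χn n t - χ t|), ← volQuarter_eq_prod, ← integral_const_mul]
      have hi : Integrable (fun p : ℝ × ℝ => |φ p.1| * |χn n p.2 - χ p.2|) volQuarter := by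
        rw [volQuarter_eq_prod]; exact hφ.norm.mul_prod ((hχni n).sub hχi).norm
      refine norm_integral_le_of_norm_le (hi.const_mul B) ?_
      filter_upwards [ae_restrict_mem hQm] with p hp
      rw [norm_mul, norm_mul]
      exact mul_le_mul_of_nonneg_right (hB n p hp) (by positivity)
    · simpa using (hL1.const_mul (∫ y, |φ y| ∂volHalf)).const_mul B
  have h3 := h1.add h2
  rw [add_zero] at h3
  refine h3.congr fun n => ?_
  rw [← integral_quarter_mul (h := fun p => g (w n p)) (H.memLp n) hφ (hχni n),
    ← integral_add (integrable_mul_of_memLp_top (H.memLp n) (hprod hχi))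
      (integrable_mul_of_memLp_top (φ := fun p => φ p.1 * (χn n p.2 - χ p.2)) (H.memLp n)
        (hprod ((hχni n).sub hχi)))]
  exact integral_congr_ae (ae_of_all _ fun p => by simp only; ring)

/-- Weights `ψn n` on the time windows `[a n, T₂]`, converging to the weight `ψ` on
`[T₁, T₂]` with uniform bounds. -/
structure TestSeq (ψn : ℕ → ℝ → ℝ) (ψ : ℝ → ℝ) (a : ℕ → ℝ) (T₁ T₂ M : ℝ) : Prop where
  nonneg : 0 ≤ T₁
  lt : T₁ < T₂
  mem : ∀ n, a n ∈ Ioo T₁ T₂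
  tendsto : Tendsto a atTop (𝓝 T₁)
  pairing : ∀ n, PairingBound (ψn n) (a n) T₂ M
  bounded : ∃ A, ∀ n t, 0 < t → |ψn n t| ≤ A
  meas : ∀ n, AEStronglyMeasurable (ψn n) (volume.restrict (Ioc T₁ T₂))
  lim : ∀ᵐ t ∂volHalf, Tendsto (fun n => ψn n t) atTop (𝓝 (ψ t))

theorem TestSeq.pos {ψn : ℕ → ℝ → ℝ} {ψ : ℝ → ℝ} {a : ℕ → ℝ} {T₁ T₂ M : ℝ}
    (h : TestSeq ψn ψ a T₁ T₂ M) (n : ℕ) : 0 < a n := h.nonneg.trans_lt (h.mem n).1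

theorem TestSeq.neg {ψn : ℕ → ℝ → ℝ} {ψ : ℝ → ℝ} {a : ℕ → ℝ} {T₁ T₂ M : ℝ}
    (h : TestSeq ψn ψ a T₁ T₂ M) :
    TestSeq (fun n t => -ψn n t) (fun t => -ψ t) a T₁ T₂ M where
  nonneg := h.nonneg
  lt := h.lt
  mem := h.mem
  tendsto := h.tendsto
  pairing := fun n => ⟨(h.pairing n).integrable.neg, fun g g' hg hg' B hB => by
    simpa only [neg_mul, intervalIntegral.integral_neg, abs_neg] using
      (h.pairing n).bound g g' hg hg' B hB⟩
  bounded := by simpa only [abs_neg] using h.bounded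
  meas := fun n => (h.meas n).neg
  lim := by filter_upwards [h.lim] with t ht using ht.neg

/-- The time `a n` decreasing to `T₁` at which the `n`-th window starts. -/
noncomputable def windowStart (T₁ T₂ : ℝ) (n : ℕ) : ℝ := T₁ + (T₂ - T₁) / (n + 2)

theorem windowStart_mem {T₁ T₂ : ℝ} (h : T₁ < T₂) (n : ℕ) : windowStart T₁ T₂ n ∈ Ioo T₁ T₂ := by
  have h1 : 0 < T₂ - T₁ := sub_pos.2 h
  have h2 : (1 : ℝ) < n + 2 := by have : (0 : ℝ) ≤ n := n.cast_nonneg; linarith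
  have h3 := div_lt_self h1 h2
  have h4 : 0 < (T₂ - T₁) / (n + 2) := div_pos h1 (by linarith)
  constructor <;> simp only [windowStart] <;> linarith

theorem tendsto_windowStart (T₁ T₂ : ℝ) : Tendsto (windowStart T₁ T₂) atTop (𝓝 T₁) := by
  have h1 : Tendsto (fun n : ℕ => (n : ℝ) + 2) atTop atTop :=
    tendsto_atTop_add_const_right _ _ tendsto_natCast_atTop_atTop
  have h2 := (h1.const_div_atTop (T₂ - T₁)).const_add T₁
  rwa [add_zero] at h2

/-- The windows start strictly after `T₁` because solutions are `C²` only for positive times and `T₁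
= 0` is allowed. The constant `2 * A + V` is the one in `abs_integral_mul_deriv_le`; the variation
is taken on `(0, T₂ + 1)` so that the closed endpoint `T₂` is included. -/
theorem testSeq_of_variation_le {ψn : ℕ → ℝ → ℝ} {ψ : ℝ → ℝ} {T₁ T₂ A : ℝ} {V : NNReal}
    (h0 : 0 ≤ T₁) (h : T₁ < T₂) (hA : ∀ n t, 0 < t → |ψn n t| ≤ A)
    (hV : ∀ n, eVariationOn (ψn n) (Ioo 0 (T₂ + 1)) ≤ V)
    (hlim : ∀ᵐ t ∂volHalf, Tendsto (fun n => ψn n t) atTop (𝓝 (ψ t))) :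
    TestSeq ψn ψ (windowStart T₁ T₂) T₁ T₂ (2 * A + V) where
  nonneg := h0
  lt := h
  mem := windowStart_mem h
  tendsto := tendsto_windowStart T₁ T₂
  pairing := fun n => by
    have ha : 0 < windowStart T₁ T₂ n := h0.trans_lt (windowStart_mem h n).1
    have hab := (windowStart_mem h n).2.le
    have hsub : Icc (windowStart T₁ T₂ n) T₂ ⊆ Ioo 0 (T₂ + 1) := fun t ht =>
      ⟨ha.trans_le ht.1, by linarith [ht.2]⟩
    have hbv : BoundedVariationOn (ψn n) (Icc (windowStart T₁ T₂ n) T₂) :=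
      ((eVariationOn.mono _ hsub).trans_lt ((hV n).trans_lt ENNReal.coe_lt_top)).ne
    have hA' : ∀ t ∈ Icc (windowStart T₁ T₂ n) T₂, |ψn n t| ≤ A := fun t ht =>
      hA n t (ha.trans_le ht.1)
    have h_int := intervalIntegrable_mul_of_boundedVariationOn hab hA' hbv
      (continuousOn_const (c := (1 : ℝ)))
    refine ⟨by simpa using h_int, fun g g' hg hg' B hB => ?_⟩
    refine (abs_integral_mul_deriv_le hab hA' hbv hg hg' hB).trans ?_
    refine mul_le_mul_of_nonneg_right ?_ ((abs_nonneg _).trans (hB _ (right_mem_Icc.2 hab)))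
    gcongr
    exact ENNReal.toReal_le_of_le_ofReal V.2 (by
      simpa using (eVariationOn.mono _ hsub).trans (hV n))
  bounded := ⟨A, hA⟩
  meas := fun n => by
    have hbv : BoundedVariationOn (ψn n) (Ioo 0 (T₂ + 1)) :=
      ((hV n).trans_lt ENNReal.coe_lt_top).ne
    have hsub : Ioc T₁ T₂ ⊆ Ioo 0 (T₂ + 1) := fun t ht => ⟨h0.trans_lt ht.1, by linarith [ht.2]⟩
    exact (aemeasurable_of_boundedVariationOn measurableSet_Ioo
      hbv).aestronglyMeasurable.mono_set hsub
  lim := hlim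

theorem IsBV.exists_testSeq {θ : ℝ → ℝ} (hθ : IsBV θ) {T₁ T₂ : ℝ} (h0 : 0 ≤ T₁) (h : T₁ < T₂) :
    ∃ M, TestSeq (fun _ => θ) θ (windowStart T₁ T₂) T₁ T₂ M := by
  obtain ⟨A, hA⟩ := hθ.bounded
  exact ⟨_, testSeq_of_variation_le (V := (eVariationOn θ (Ioo 0 (T₂ + 1))).toNNReal) h0 h
    (fun _ t ht => hA t ht) (fun _ => (ENNReal.coe_toNNReal (hθ.variation _)).ge)
    (ae_of_all _ fun _ => tendsto_const_nhds)⟩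

/-- Convergence of the weighted time averages to those of the Young measure. -/
theorem TestSeq.tendsto_solAvg {ψn : ℕ → ℝ → ℝ} {ψ : ℝ → ℝ} {a : ℕ → ℝ} {T₁ T₂ M : ℝ}
    (h : TestSeq ψn ψ a T₁ T₂ M) {u : ℕ → ℝ → ℝ → State N} {s : ℕ → ℝ} (hs : ∀ n, 0 < s n)
    {κ : Kernel (ℝ × ℝ) (State N)} (hκ : IsYoungMeasure 𝒰 (fun n p => u n (s n * p.1) p.2) κ)
    {g : State N → ℝ} (hg : ContinuousOn g 𝒰) {B : ℝ}
    (hB : ∀ n x t, 0 ≤ x → 0 ≤ t → |g (u n x t)| ≤ B) {φ : ℝ → ℝ} (hφ : Integrable φ volHalf) :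
    Tendsto (fun n => ∫ y in Ioi 0, solAvg (u n) g (ψn n) (a n) T₂ (s n * y) * φ y) atTop
      (𝓝 (∫ y in Ioi 0, timeAvg κ g ψ T₁ T₂ y * φ y)) := by
  obtain ⟨A, hA⟩ := h.bounded
  have hA0 : 0 ≤ A := (abs_nonneg _).trans (hA 0 1 one_pos)
  have h1 := hκ.tendsto_integral hg (B := B)
    (fun n p hp => hB n _ _ (mul_nonneg (hs n).le (le_of_lt hp.1)) (le_of_lt hp.2))
    (χn := fun n => (Ioc (a n) T₂).indicator (ψn n)) (χ := (Ioc T₁ T₂).indicator ψ)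
    (A := A) (T := T₂) (fun n => by
      rw [aestronglyMeasurable_indicator_iff measurableSet_Ioc,
        Measure.restrict_restrict measurableSet_Ioc,
        inter_eq_self_of_subset_left (t := Ioi 0) fun t ht => (h.pos n).trans ht.1]
      exact (h.meas n).mono_set (Ioc_subset_Ioc_left (h.mem n).1.le))
    (fun n => by
      filter_upwards [ae_restrict_mem measurableSet_Ioi] with t ht
      by_cases h1 : t ∈ Ioc (a n) T₂
      · rw [indicator_of_mem h1, indicator_of_mem (show t ∈ Iic T₂ from h1.2)]
        exact hA n t ht
      · rw [indicator_of_notMem h1, abs_zero]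
        exact indicator_nonneg (fun _ _ => hA0) _)
    (by
      filter_upwards [h.lim] with t ht
      by_cases h1 : t ∈ Ioc T₁ T₂
      · rw [indicator_of_mem h1]
        refine ht.congr' ?_
        filter_upwards [h.tendsto.eventually (gt_mem_nhds h1.1)] with n hn
        rw [indicator_of_mem (show t ∈ Ioc (a n) T₂ from ⟨hn, h1.2⟩)]
      · rw [indicator_of_notMem h1]
        refine tendsto_const_nhds.congr fun n => ?_
        rw [indicator_of_notMem fun h2 => h1 ⟨(h.mem n).1.trans h2.1, h2.2⟩])
    hφ
  have e1 : ∀ y, timeAvg κ g ψ T₁ T₂ y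
      = ∫ t in Ioi 0, (∫ z, g z ∂(κ (y, t))) * (Ioc T₁ T₂).indicator ψ t := fun y =>
    intervalIntegral_eq_indicator h.nonneg h.lt.le
  have e2 : ∀ n x, solAvg (u n) g (ψn n) (a n) T₂ x
      = ∫ t in Ioi 0, g (u n x t) * (Ioc (a n) T₂).indicator (ψn n) t := fun n x =>
    intervalIntegral_eq_indicator (h.pos n).le (h.mem n).2.le
  simp only [e1, e2]
  exact h1

/-- The data of the vanishing viscosity method, with values in one compact convex set `K`. -/
structure ViscousFamily (𝒰 K : Set (State N)) (f : State N → State N) (ε : ℕ → ℝ)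
    (uIε uBε : ℕ → ℝ → State N) (u : ℕ → ℝ → ℝ → State N) : Prop where
  isOpen : IsOpen 𝒰
  compact : IsCompact K
  convex : Convex ℝ K
  subset : K ⊆ 𝒰
  smooth : ContDiffOn ℝ ∞ f 𝒰
  eps_pos : ∀ n, 0 < ε n
  eps_tendsto : Tendsto ε atTop (𝓝 0)
  sol : ∀ n, IsViscousSolution 𝒰 f (ε n) (uIε n) (uBε n) (u n)
  mem : ∀ n x t, 0 ≤ x → 0 ≤ t → u n x t ∈ K

variable {f : State N → State N} {ε : ℕ → ℝ} {uIε uBε : ℕ → ℝ → State N}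
  {u : ℕ → ℝ → ℝ → State N} {U F : State N → ℝ}

theorem ViscousFamily.exists_bound (hV : ViscousFamily 𝒰 K f ε uIε uBε u) {g : State N → ℝ}
    (hg : ContinuousOn g 𝒰) : ∃ B, 0 ≤ B ∧ ∀ z ∈ K, |g z| ≤ B := by
  obtain ⟨B, hB⟩ := hV.compact.exists_bound_of_continuousOn (hg.mono hV.subset)
  have h1 : u 0 1 1 ∈ K := hV.mem 0 1 1 zero_le_one zero_le_one
  exact ⟨B, (norm_nonneg _).trans (hB _ h1), hB⟩

/-- The viscous fluxes, rescaled by `s n`, converge. -/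
theorem ViscousFamily.exists_flux_limit (hV : ViscousFamily 𝒰 K f ε uIε uBε u)
    (hUF : IsEntropyPair 𝒰 f U F) {ψn : ℕ → ℝ → ℝ} {ψ : ℝ → ℝ} {a : ℕ → ℝ} {T₁ T₂ M : ℝ}
    (h : TestSeq ψn ψ a T₁ T₂ M)
    (hsign : ∀ n, ∀ w ∈ 𝒰, ∀ z, ∀ t, 0 < t → 0 ≤ fderiv ℝ (fderiv ℝ U) w z z * ψn n t)
    {B : ℝ} (hB : ∀ z ∈ K, |U z| ≤ B) {s : ℕ → ℝ} (hs : ∀ n, 0 < s n) {s₀ r : ℝ}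
    (hs₀ : Tendsto s atTop (𝓝 s₀)) (hr : Tendsto (fun n => ε n / s n) atTop (𝓝 r))
    {κ : Kernel (ℝ × ℝ) (State N)} (hκ : IsYoungMeasure 𝒰 (fun n p => u n (s n * p.1) p.2) κ) :
    ∃ G : ℝ → ℝ, (∀ x y, 0 < x → x ≤ y → G y ≤ G x + M * B * s₀ * (y - x)) ∧
      (∀ t, 0 < t → ContinuousWithinAt G (Ici t) t) ∧
      (∃ S : Set ℝ, S.Countable ∧ ∀ y, 0 < y → y ∉ S →
        Tendsto (fun n => viscFlux (ε n) (u n) U F (ψn n) (a n) T₂ (s n * y)) atTop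
          (𝓝 (G y))) ∧
      ∀ φ, IsTest (Ioi 0) φ → (∫ y in Ioi 0, timeAvg κ F ψ T₁ T₂ y * φ y)
        + r * (∫ y in Ioi 0, timeAvg κ U ψ T₁ T₂ y * deriv φ y) = ∫ y in Ioi 0, G y * φ y := by
  have hUc := hUF.contDiffOn_entropy.continuousOn
  have hFc := hUF.contDiffOn_flux.continuousOn
  obtain ⟨B', -, hB'⟩ := hV.exists_bound hFc
  -- Rescaling space by `s n` multiplies the slope `M * B` by `s n`.
  refine exists_limit_of_almost_antitone (c := fun n => M * B * s n) (hs₀.const_mul _)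
    (fun n => ?_) (fun n x y hx hxy => ?_) _ (fun φ hφ => ?_)
  · exact ((hV.sol n).continuousOn_viscFlux hV.isOpen hUF (h.pos n) (h.mem n).2.le
      (h.pairing n).integrable).comp (by fun_prop) fun y hy => mul_nonneg (hs n).le (le_of_lt hy)
  · have h1 := (hV.sol n).viscFlux_le hV.isOpen (hV.eps_pos n)
      (hV.smooth.differentiableOn (by simp)) hUF (h.pos n) (h.mem n).2.le (h.pairing n)
      (fun w hw z t ht => hsign n w hw z t ((h.pos n).trans_le ht.1))
      (fun x t hx ht => hB _ (hV.mem n x t hx ht)) (mul_nonneg (hs n).le hx.le)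
      (mul_le_mul_of_nonneg_left hxy (hs n).le)
    linarith
  · have hφi : Integrable φ volHalf :=
      (hφ.smooth.continuous.integrable_of_hasCompactSupport hφ.compact).integrableOn
    have hφi' : Integrable (deriv φ) volHalf :=
      ((hφ.smooth.continuous_deriv (by norm_num)).integrable_of_hasCompactSupport
        hφ.compact.deriv).integrableOn
    have h1 := h.tendsto_solAvg hs hκ hFc (fun n x t hx ht => hB' _ (hV.mem n x t hx ht)) hφi
    have h2 := h.tendsto_solAvg hs hκ hUc (fun n x t hx ht => hB _ (hV.mem n x t hx ht)) hφi'
    refine (h1.add (hr.mul h2)).congr fun n => ?_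
    rw [(hV.sol n).integral_viscFlux_mul hV.isOpen (hV.eps_pos n).ne' hUF (h.pos n)
      (h.mem n).2.le (h.pairing n).integrable (hs n) hφ]

end BoundaryLayer

/-! ### Compactness of Young measures and candidate traces -/

namespace BoundaryLayer

variable {N : ℕ} {𝒰 K : Set (State N)}

theorem exists_boundedContinuous_eqOn (hK : IsCompact K) {g : State N → ℝ}
    (hg : ContinuousOn g K) : ∃ g' : State N →ᵇ ℝ, EqOn g' g K := by
  have := isCompact_iff_compactSpace.1 hK
  obtain ⟨g', -, hg'⟩ := BoundedContinuousFunction.exists_norm_eq_domRestrict_eq_of_closed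
    (BoundedContinuousFunction.mkOfCompact ⟨K.domRestrict g, hg.domRestrict⟩) hK.isClosed
  refine ⟨g', fun z hz => ?_⟩
  exact DFunLike.congr_fun hg' ⟨z, hz⟩

theorem integral_congr_of_eqOn {m : Measure (State N)} (hm : m Kᶜ = 0) {g g' : State N → ℝ}
    (h : EqOn g g' K) : ∫ z, g z ∂m = ∫ z, g' z ∂m := by
  refine integral_congr_ae ?_
  filter_upwards [measure_eq_zero_iff_ae_notMem.1 hm] with z hz using h (not_not.1 hz)

/-- Tightness of a product family reduces to its marginals: the first is a single measure, the
second is carried by the compact set `K`. -/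
theorem isTight_fst_snd (m : Measure ℝ) [IsProbabilityMeasure m] (hK : IsCompact K) :
    IsTightMeasureSet {M : Measure (ℝ × State N) | M.fst = m ∧ M.snd Kᶜ = 0} := by
  refine IsTightMeasureSet.prodMk
    ((isTightMeasureSet_singleton (μ := m)).subset ?_) ?_
  · rintro _ ⟨M, hM, rfl⟩
    exact hM.1
  · rw [isTightMeasureSet_iff_exists_isCompact_measure_compl_le]
    intro e _
    refine ⟨K, hK, ?_⟩
    rintro _ ⟨M, hM, rfl⟩
    rw [hM.2]
    exact zero_le

theorem boundedContinuous_abs_integral_le {m : Measure (State N)} [IsProbabilityMeasure m]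
    (g : State N →ᵇ ℝ) : |∫ z, g z ∂m| ≤ ‖g‖ :=
  abs_integral_le_of_compl_eq_zero (K := univ) (by simp) fun z _ => g.norm_coe_le_norm z

theorem boundedContinuous_integrable_mul {m : Measure ℝ} {κ : Kernel ℝ (State N)}
    [IsMarkovKernel κ] (g : State N →ᵇ ℝ) {h : ℝ → ℝ} (hh : Integrable h m) :
    Integrable (fun t => (∫ z, g z ∂(κ t)) * h t) m := by
  refine hh.bdd_mul (c := ‖g‖) ?_ (ae_of_all _ fun t => boundedContinuous_abs_integral_le g)
  exact (g.continuous.measurable.stronglyMeasurable.integral_kernel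
    (κ := κ)).aestronglyMeasurable

/-- Compactness of families of probability measures on a compact set (Young measures). -/
theorem exists_kernel_limit {ι : Type*} (𝓕 : Ultrafilter ι) (m : Measure ℝ)
    [IsProbabilityMeasure m] (κs : ι → Kernel ℝ (State N)) [∀ i, IsMarkovKernel (κs i)]
    (hK : IsCompact K) (hne : K.Nonempty) (hsupp : ∀ᶠ i in 𝓕, ∀ᵐ t ∂m, κs i t Kᶜ = 0) :
    ∃ κ₀ : Kernel ℝ (State N), IsMarkovKernel κ₀ ∧ (∀ t, κ₀ t Kᶜ = 0) ∧
      ∀ (g : State N →ᵇ ℝ) (h : ℝ → ℝ), Integrable h m →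
        Tendsto (fun i => ∫ t, (∫ z, g z ∂(κs i t)) * h t ∂m) 𝓕
          (𝓝 (∫ t, (∫ z, g z ∂(κ₀ t)) * h t ∂m)) := by
  have hKm : MeasurableSet Kᶜ := hK.measurableSet.compl
  -- The kernels are encoded as joint laws with first marginal `m`. Prokhorov's theorem gives a
  -- limit law, and disintegrating it gives back a kernel.
  let Ms : ι → ProbabilityMeasure (ℝ × State N) := fun i => ⟨m ⊗ₘ κs i, inferInstance⟩
  set S : Set (ProbabilityMeasure (ℝ × State N)) :=
    {M | (M : Measure (ℝ × State N)).fst = m ∧ (M : Measure (ℝ × State N)).snd Kᶜ = 0} with hS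
  have hScomp : IsCompact (closure S) := isCompact_closure_of_isTightMeasureSet
    ((isTight_fst_snd m hK).subset (by rintro _ ⟨M, hM, rfl⟩; exact hM))
  have hMS : ∀ᶠ i in 𝓕, Ms i ∈ S := by
    filter_upwards [hsupp] with i hi
    refine ⟨Measure.fst_compProd m (κs i), ?_⟩
    change (m ⊗ₘ κs i).snd Kᶜ = 0
    rw [Measure.snd_apply hKm, Measure.compProd_apply (measurable_snd hKm)]
    exact (lintegral_congr_ae (by filter_upwards [hi] with t ht using ht)).trans lintegral_zero
  obtain ⟨M, -, hM⟩ := hScomp.ultrafilter_le_nhds (𝓕.map Ms) (by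
    rw [le_principal_iff]
    exact (hMS.mono fun i hi => subset_closure hi))
  have hlim : Tendsto Ms 𝓕 (𝓝 M) := hM
  have hfst : (M : Measure (ℝ × State N)).fst = m := by
    have h1 := ProbabilityMeasure.tendsto_map_of_tendsto_of_continuous Ms M hlim continuous_fst
    have h2 : ∀ᶠ i in 𝓕, (Ms i).map continuous_fst.measurable.aemeasurable
        = (⟨m, inferInstance⟩ : ProbabilityMeasure ℝ) := by
      filter_upwards [hMS] with i hi
      exact Subtype.ext hi.1
    have h3 := tendsto_nhds_unique (h1.congr' h2) tendsto_const_nhds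
    exact congrArg Subtype.val h3
  -- The complement of `K` is open, so the portmanteau inequality bounds its limit mass by a lower
  -- limit of zeros.
  have hsnd : (M : Measure (ℝ × State N)) (Prod.snd ⁻¹' Kᶜ) = 0 := by
    have h1 := ProbabilityMeasure.le_liminf_measure_open_of_tendsto hlim
      (hK.isClosed.isOpen_compl.preimage (continuous_snd (X := ℝ)))
    have h2 : ∀ᶠ i in 𝓕, (Ms i : Measure (ℝ × State N)) (Prod.snd ⁻¹' Kᶜ) = 0 := by
      filter_upwards [hMS] with i hi
      rw [← Measure.snd_apply hKm]
      exact hi.2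
    have h3 : Tendsto (fun i => (Ms i : Measure (ℝ × State N)) (Prod.snd ⁻¹' Kᶜ)) 𝓕 (𝓝 0) :=
      tendsto_const_nhds.congr' (h2.mono fun i hi => hi.symm)
    rw [h3.liminf_eq] at h1
    exact le_antisymm h1 (zero_le)
  obtain ⟨k, hk⟩ := hne
  set κ₁ := (M : Measure (ℝ × State N)).condKernel with hκ₁
  have hdis : m ⊗ₘ κ₁ = M := by
    have := (M : Measure (ℝ × State N)).disintegrate κ₁
    rwa [hfst] at this
  have hE : MeasurableSet {t | κ₁ t Kᶜ = 0} :=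
    (κ₁.measurable_coe hKm) (measurableSet_singleton 0)
  have hae : ∀ᵐ t ∂m, κ₁ t Kᶜ = 0 := by
    rw [← hdis, Measure.compProd_apply (measurable_snd hKm),
      lintegral_eq_zero_iff (Kernel.measurable_kernel_prodMk_left (measurable_snd hKm))] at hsnd
    exact hsnd
  classical
  -- The conditional kernel is carried by `K` for almost every `t` only; on the exceptional set it
  -- is replaced by a Dirac mass in `K`.
  let κ₀ : Kernel ℝ (State N) := Kernel.piecewise hE κ₁ (Kernel.const ℝ (Measure.dirac k))
  have hκ₀ : IsMarkovKernel κ₀ := inferInstanceAs (IsMarkovKernel (Kernel.piecewise _ _ _))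
  have hκ₀eq : ∀ᵐ t ∂m, κ₀ t = κ₁ t := by
    filter_upwards [hae] with t ht
    exact if_pos ht
  refine ⟨κ₀, hκ₀, fun t => ?_, fun g h hh => ?_⟩
  · by_cases ht : κ₁ t Kᶜ = 0
    · have : κ₀ t = κ₁ t := if_pos ht
      rw [this, ht]
    · have : κ₀ t = Measure.dirac k := by
        rw [Kernel.piecewise_apply, if_neg (by exact ht), Kernel.const_apply]
      rw [this, Measure.dirac_apply' _ hKm]
      simp [hk]
  have e0 : ∀ h : ℝ → ℝ, ∫ t, (∫ z, g z ∂(κ₀ t)) * h t ∂m = ∫ t, (∫ z, g z ∂(κ₁ t)) * h t ∂m :=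
    fun h => integral_congr_ae (by filter_upwards [hκ₀eq] with t ht; rw [ht])
  have hcomp : ∀ (η : Kernel ℝ (State N)) [IsMarkovKernel η] (h : ℝ →ᵇ ℝ),
      ∫ p, h p.1 * g p.2 ∂(m ⊗ₘ η) = ∫ t, (∫ z, g z ∂(η t)) * h t ∂m := by
    intro η _ h
    have hi : Integrable (fun p : ℝ × State N => h p.1 * g p.2) (m ⊗ₘ η) := by
      have hc : Continuous fun p : ℝ × State N => h p.1 * g p.2 := by fun_prop
      refine (integrable_const (‖h‖ * ‖g‖)).mono' hc.aestronglyMeasurable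
        (ae_of_all _ fun p => ?_)
      rw [norm_mul]
      exact mul_le_mul (h.norm_coe_le_norm _) (g.norm_coe_le_norm _) (norm_nonneg _)
        (norm_nonneg _)
    rw [Measure.integral_compProd hi]
    refine integral_congr_ae (ae_of_all _ fun t => ?_)
    simp only
    rw [integral_const_mul, mul_comm]
  have hbc : ∀ h : ℝ →ᵇ ℝ, Tendsto (fun i => ∫ t, (∫ z, g z ∂(κs i t)) * h t ∂m) 𝓕
      (𝓝 (∫ t, (∫ z, g z ∂(κ₁ t)) * h t ∂m)) := by
    intro h
    let H : (ℝ × State N) →ᵇ ℝ :=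
      (h.compContinuous ⟨Prod.fst, continuous_fst⟩) * (g.compContinuous ⟨Prod.snd, continuous_snd⟩)
    have h1 := (ProbabilityMeasure.tendsto_iff_forall_integral_tendsto.1 hlim) H
    rw [← hdis] at h1
    have h2 : ∀ (η : Kernel ℝ (State N)) [IsMarkovKernel η],
      ∫ p, H p ∂(m ⊗ₘ η) = ∫ t, (∫ z, g z ∂(η t)) * h t ∂m := fun η _ => hcomp η h
    rw [h2 κ₁] at h1
    exact h1.congr fun i => h2 (κs i)
  rw [e0, Metric.tendsto_nhds]
  intro e he
  have hg1 : 0 < ‖g‖ + 1 := by positivity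
  -- Weak convergence of laws only tests bounded continuous weights, so `h` is approximated in `L¹`.
  -- The factor `‖g‖ + 1` avoids a division by zero.
  obtain ⟨h', hh', hh'i⟩ := hh.exists_boundedContinuous_integral_sub_le
    (ε := e / (4 * (‖g‖ + 1))) (by positivity)
  have happ : ∀ (η : Kernel ℝ (State N)) [IsMarkovKernel η],
      |(∫ t, (∫ z, g z ∂(η t)) * h t ∂m) - ∫ t, (∫ z, g z ∂(η t)) * h' t ∂m| ≤ e / 4 := by
    intro η _
    rw [← integral_sub (boundedContinuous_integrable_mul g hh)
      (boundedContinuous_integrable_mul g hh'i)]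
    have h1 : |∫ t, ((∫ z, g z ∂(η t)) * h t - (∫ z, g z ∂(η t)) * h' t) ∂m|
        ≤ ∫ t, (‖g‖ + 1) * ‖h t - h' t‖ ∂m := by
      have hi : Integrable (fun t => (‖g‖ + 1) * ‖h t - h' t‖) m := (hh.sub hh'i).norm.const_mul _
      rw [← Real.norm_eq_abs]
      refine norm_integral_le_of_norm_le hi (ae_of_all _ fun t => ?_)
      rw [← mul_sub, norm_mul]
      refine mul_le_mul_of_nonneg_right ?_ (norm_nonneg _)
      exact (boundedContinuous_abs_integral_le g).trans (by linarith)
    rw [integral_const_mul] at h1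
    refine h1.trans ((mul_le_mul_of_nonneg_left hh' hg1.le).trans (le_of_eq ?_))
    field_simp
  filter_upwards [(Metric.tendsto_nhds.1 (hbc h')) (e / 4) (by linarith)] with i hi
  have h1 := happ (κs i)
  have h2 := happ κ₁
  rw [Real.dist_eq, abs_lt] at *
  rw [abs_le] at h1 h2
  constructor <;> linarith [h1.1, h1.2, h2.1, h2.2, hi.1, hi.2]

/-- The exponential probability measure on `(0, ∞)`. -/
noncomputable def expHalf : Measure ℝ := volHalf.withDensity fun t => ENNReal.ofReal (Real.exp (-t))

instance : IsProbabilityMeasure expHalf := by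
  refine ⟨?_⟩
  rw [expHalf, withDensity_apply _ MeasurableSet.univ, Measure.restrict_univ,
    ← ofReal_integral_eq_lintegral_ofReal, integral_exp_neg_Ioi_zero, ENNReal.ofReal_one]
  · exact integrableOn_exp_neg_Ioi 0
  · exact ae_of_all _ fun t => (Real.exp_pos _).le

theorem measurable_expDensity : Measurable fun t : ℝ => ENNReal.ofReal (Real.exp (-t)) := by
  fun_prop

/-- The compactness result requires a probability measure in time; the factor `exp t` put into the
weight cancels the exponential density and restores Lebesgue averages. -/
theorem integral_expHalf {H θ : ℝ → ℝ} {T₁ T₂ : ℝ} (h0 : 0 ≤ T₁) (h : T₁ ≤ T₂) :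
    ∫ t, H t * (Ioc T₁ T₂).indicator (fun t => Real.exp t * θ t) t ∂expHalf
      = ∫ t in T₁..T₂, H t * θ t := by
  rw [expHalf, integral_withDensity_eq_integral_toReal_smul measurable_expDensity
    (ae_of_all _ fun _ => ENNReal.ofReal_lt_top), intervalIntegral_eq_indicator h0 h]
  refine integral_congr_ae (ae_of_all _ fun t => ?_)
  simp only [smul_eq_mul, ENNReal.toReal_ofReal (Real.exp_pos _).le]
  by_cases ht : t ∈ Ioc T₁ T₂
  · simp only [indicator_of_mem ht]
    rw [show Real.exp (-t) * (H t * (Real.exp t * θ t))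
      = (Real.exp (-t) * Real.exp t) * (H t * θ t) by ring, ← Real.exp_add]
    simp
  · simp [ht]

theorem integrable_expHalf {θ : ℝ → ℝ} {T₁ T₂ : ℝ}
    (hθ : IntegrableOn θ (Ioc T₁ T₂)) :
    Integrable ((Ioc T₁ T₂).indicator fun t => Real.exp t * θ t) expHalf := by
  rw [expHalf, integrable_withDensity_iff_integrable_smul' measurable_expDensity
    (ae_of_all _ fun _ => ENNReal.ofReal_lt_top)]
  have h1 : Integrable ((Ioc T₁ T₂).indicator θ) volHalf := by
    rw [integrable_indicator_iff measurableSet_Ioc, IntegrableOn,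
      Measure.restrict_restrict measurableSet_Ioc]
    exact hθ.mono_set inter_subset_left
  refine h1.congr (ae_of_all _ fun t => ?_)
  simp only [smul_eq_mul, ENNReal.toReal_ofReal (Real.exp_pos _).le]
  by_cases ht : t ∈ Ioc T₁ T₂
  · simp only [indicator_of_mem ht]
    rw [← mul_assoc, ← Real.exp_add]
    simp
  · simp [ht]

theorem eventually_traceFilter {p : ℝ → Prop} (h : ∀ᵐ x ∂volHalf, p x) :
    ∀ᶠ x in 𝓝[>] (0 : ℝ) ⊓ ae volume, p x := by
  rw [ae_restrict_iff' measurableSet_Ioi] at h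
  have h1 : ∀ᶠ x in 𝓝[>] (0 : ℝ) ⊓ ae volume, x ∈ Ioi (0 : ℝ) :=
    (inf_le_left : 𝓝[>] (0 : ℝ) ⊓ ae volume ≤ _) self_mem_nhdsWithin
  have h2 : ∀ᶠ x in 𝓝[>] (0 : ℝ) ⊓ ae volume, x ∈ Ioi (0 : ℝ) → p x :=
    (inf_le_right : 𝓝[>] (0 : ℝ) ⊓ ae volume ≤ _) h
  filter_upwards [h1, h2] with x hx hp using hp hx

/-- A conull set meets every interval `(0, δ)`. Nontriviality of this filter gives uniqueness of
traces, ultrafilters below it, and good points arbitrarily close to `0`. -/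
instance traceFilter_neBot : (𝓝[>] (0 : ℝ) ⊓ ae volume).NeBot := by
  rw [inf_neBot_iff]
  intro s hs t ht
  obtain ⟨δ, hδ, hsub⟩ := mem_nhdsGT_iff_exists_Ioo_subset.1 hs
  have hδ0 : (0 : ℝ) < δ := hδ
  by_contra hne
  rw [not_nonempty_iff_eq_empty] at hne
  have h1 : volume (Ioo 0 δ) = 0 := by
    refine measure_mono_null (t := tᶜ) (fun x hx hxt => ?_) (mem_ae_iff.1 ht)
    have : x ∈ s ∩ t := ⟨hsub hx, hxt⟩
    rw [hne] at this
    exact this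
  rw [Real.volume_Ioo, ENNReal.ofReal_eq_zero] at h1
  linarith

/-- A candidate for the trace at `z = 0`, along an ultrafilter. -/
theorem exists_trace_along {κ : Kernel (ℝ × ℝ) (State N)} [IsMarkovKernel κ] (hK : IsCompact K)
    (hne : K.Nonempty) (hsupp : ∀ᵐ p ∂volQuarter, κ p Kᶜ = 0) :
    ∃ κ₀ : Kernel ℝ (State N), IsMarkovKernel κ₀ ∧ (∀ t, κ₀ t Kᶜ = 0) ∧
      ∃ 𝓕 : Ultrafilter ℝ, ↑𝓕 ≤ 𝓝[>] (0 : ℝ) ⊓ ae volume ∧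
        ∀ g : State N → ℝ, ContinuousOn g K → ∀ (θ : ℝ → ℝ) (T₁ T₂ : ℝ), 0 ≤ T₁ → T₁ < T₂ →
          IntegrableOn θ (Ioc T₁ T₂) → Tendsto (timeAvg κ g θ T₁ T₂) 𝓕
            (𝓝 (∫ t in T₁..T₂, (∫ w, g w ∂(κ₀ t)) * θ t)) := by
  let 𝓕 := Ultrafilter.of (𝓝[>] (0 : ℝ) ⊓ ae volume)
  have h𝓕 : ↑𝓕 ≤ 𝓝[>] (0 : ℝ) ⊓ ae volume := Ultrafilter.of_le _
  have hm : ∀ x : ℝ, Measurable fun t : ℝ => (x, t) := fun x => by fun_prop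
  rw [volQuarter_eq_prod] at hsupp
  have hgood : ∀ᶠ x in (𝓕 : Filter ℝ), ∀ᵐ t ∂volHalf, κ (x, t) Kᶜ = 0 :=
    h𝓕 (eventually_traceFilter (Measure.ae_ae_of_ae_prod hsupp))
  obtain ⟨κ₀, hκ₀, hκ₀K, hlim⟩ := exists_kernel_limit 𝓕 expHalf
    (fun x => κ.comap (fun t => (x, t)) (hm x)) hK hne (by
      filter_upwards [hgood] with x hx
      exact (withDensity_absolutelyContinuous volHalf _).ae_le hx)
  refine ⟨κ₀, hκ₀, hκ₀K, 𝓕, h𝓕, fun g hg θ T₁ T₂ h0 h hθ => ?_⟩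
  obtain ⟨g', hg'⟩ := exists_boundedContinuous_eqOn hK hg
  have h1 := hlim g' _ (integrable_expHalf hθ)
  simp only [integral_expHalf h0 h.le, Kernel.comap_apply] at h1
  have e1 : ∫ t in T₁..T₂, (∫ w, g w ∂(κ₀ t)) * θ t
      = ∫ t in T₁..T₂, (∫ w, g' w ∂(κ₀ t)) * θ t :=
    intervalIntegral.integral_congr fun t _ => by
      simp only [integral_congr_of_eqOn (hκ₀K t) hg']
  rw [e1]
  refine h1.congr' ?_
  filter_upwards [hgood] with x hx
  rw [ae_restrict_iff' measurableSet_Ioi] at hx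
  refine intervalIntegral.integral_congr_ae ?_
  filter_upwards [hx] with t ht htm
  rw [uIoc_of_le h.le] at htm
  rw [integral_congr_of_eqOn (ht (h0.trans_lt htm.1)) hg']

end BoundaryLayer

/-! ### Bounded variation, right continuous representatives and slices -/

namespace BoundaryLayer

theorem eVariationOn_sub_le (f g : ℝ → ℝ) (s : Set ℝ) :
    eVariationOn (fun x => f x - g x) s ≤ eVariationOn f s + eVariationOn g s := by
  refine iSup_le ?_
  rintro ⟨n, ⟨u, hu, us⟩⟩
  refine le_trans (Finset.sum_le_sum (g := fun i => edist (f (u (i + 1))) (f (u i))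
    + edist (g (u (i + 1))) (g (u i))) fun i _ => ?_) ?_
  · simp only [edist_eq_enorm_sub]
    rw [sub_sub_sub_comm]
    exact enorm_sub_le
  · rw [Finset.sum_add_distrib]
    exact add_le_add (eVariationOn.sum_le hu us) (eVariationOn.sum_le hu us)

theorem IsBV.sub {v w : ℝ → ℝ} (hv : IsBV v) (hw : IsBV w) : IsBV fun t => v t - w t where
  bounded := by
    obtain ⟨C, hC⟩ := hv.bounded
    obtain ⟨D, hD⟩ := hw.bounded
    exact ⟨C + D, fun t ht => (norm_sub_le _ _).trans (add_le_add (hC t ht) (hD t ht))⟩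
  variation := fun T => ((eVariationOn_sub_le v w _).trans_lt
    (ENNReal.add_lt_top.2 ⟨(hv.variation T).lt_top, (hw.variation T).lt_top⟩)).ne
  right_continuous := fun t ht => (hv.right_continuous t ht).sub (hw.right_continuous t ht)

theorem isBV_const (C : ℝ) : IsBV fun _ : ℝ => C where
  bounded := ⟨‖C‖, fun _ _ => le_rfl⟩
  variation := fun T => by
    rw [BoundedVariationOn, eVariationOn.constant_on]
    · exact ENNReal.zero_ne_top
    · rintro _ ⟨x, -, rfl⟩ _ ⟨y, -, rfl⟩; rfl
  right_continuous := fun t _ => continuousWithinAt_const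

theorem IsBV.add_const {v : ℝ → ℝ} (hv : IsBV v) (C : ℝ) : IsBV fun t => v t + C := by
  simpa using hv.sub (isBV_const (-C))

theorem IsBV.integrableOn {θ : ℝ → ℝ} (hθ : IsBV θ) {T₁ T₂ : ℝ} (h0 : 0 ≤ T₁) :
    IntegrableOn θ (Ioc T₁ T₂) := by
  obtain ⟨A, hA⟩ := hθ.bounded
  have hsub : Ioc T₁ T₂ ⊆ Ioo 0 (T₂ + 1) := fun t ht => ⟨h0.trans_lt ht.1, by linarith [ht.2]⟩
  refine Integrable.mono' (g := fun _ => A) (integrableOn_const measure_Ioc_lt_top.ne)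
    ((aemeasurable_of_boundedVariationOn measurableSet_Ioo
      (hθ.variation (T₂ + 1))).aestronglyMeasurable.mono_set hsub) ?_
  filter_upwards [ae_restrict_mem measurableSet_Ioc] with t ht using hA t (h0.trans_lt ht.1)

/-- `G - c y` is antitone on `(0, ∞)` and `G` is right continuous there. -/
structure AlmostAntitone (G : ℝ → ℝ) (c : ℝ) : Prop where
  le : ∀ x y, 0 < x → x ≤ y → G y ≤ G x + c * (y - x)
  right_continuous : ∀ t, 0 < t → ContinuousWithinAt G (Ici t) t

theorem AlmostAntitone.antitoneOn {G : ℝ → ℝ} {c : ℝ} (h : AlmostAntitone G c) :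
    AntitoneOn (fun y => G y - c * y) (Ioi 0) := fun x hx y _ hxy => by
  have := h.le x y hx hxy
  simp only
  linarith

theorem AlmostAntitone.locallyIntegrableOn {G : ℝ → ℝ} {c : ℝ} (h : AlmostAntitone G c) :
    LocallyIntegrableOn G (Ioi 0) := by
  rw [locallyIntegrableOn_iff isOpen_Ioi.isLocallyClosed]
  intro k hk hkc
  have h1 : IntegrableOn (fun y => G y - c * y) k :=
    (h.antitoneOn.mono hk).integrableOn_isCompact hkc
  have h2 : IntegrableOn (fun y : ℝ => c * y) k :=
    (Continuous.continuousOn (by fun_prop)).integrableOn_compact hkc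
  refine (h1.add h2).congr (ae_of_all _ fun y => ?_)
  simp

/-- On `(0, T)` the function is the difference of `c y` and the monotone function `c y - G`, both
bounded there. -/
theorem AlmostAntitone.isBV {G : ℝ → ℝ} {c : ℝ} (h : AlmostAntitone G c) {C : ℝ}
    (hC : ∀ y, 0 < y → |G y| ≤ C) : IsBV G where
  bounded := ⟨C, hC⟩
  variation := fun T => by
    have hmul : ∀ y ∈ Ioo 0 T, |c * y| ≤ |c| * |T| := fun y hy => by
      rw [abs_mul]
      exact mul_le_mul_of_nonneg_left
        (abs_le_abs_of_nonneg hy.1.le hy.2.le) (abs_nonneg c)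
    have h1 : BoundedVariationOn (fun y => c * y - G y) (Ioo 0 T) :=
      MonotoneOn.boundedVariationOn (C := |c| * |T| + C)
        (fun x hx y hy hxy => by
          have := h.antitoneOn hx.1 hy.1 hxy
          simp only at this ⊢
          linarith)
        fun y hy => (abs_sub _ _).trans (add_le_add (hmul y hy) (hC y hy.1))
    have h2 : BoundedVariationOn (fun y : ℝ => c * y) (Ioo 0 T) := by
      -- The sign of `c` is not known; for `c ≤ 0` the linear part is written as `0 - (-c y)`.
      rcases le_total 0 c with hc | hc
      · exact MonotoneOn.boundedVariationOn
          (fun x _ y _ hxy => mul_le_mul_of_nonneg_left hxy hc) hmul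
      · have h3 : BoundedVariationOn (fun y : ℝ => -c * y) (Ioo 0 T) :=
          MonotoneOn.boundedVariationOn (C := |c| * |T|)
            (fun x _ y _ hxy => mul_le_mul_of_nonneg_left hxy (neg_nonneg.2 hc))
            fun y hy => by rw [neg_mul, abs_neg]; exact hmul y hy
        have h4 := (eVariationOn_sub_le (fun _ => (0 : ℝ)) (fun y => -c * y) (Ioo 0 T)).trans_lt
          (ENNReal.add_lt_top.2 ⟨((isBV_const 0).variation T).lt_top, h3.lt_top⟩)
        simpa [BoundedVariationOn] using h4.ne
    have h5 := (eVariationOn_sub_le (fun y => c * y) (fun y => c * y - G y) (Ioo 0 T)).trans_lt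
          (ENNReal.add_lt_top.2 ⟨h2.lt_top, h1.lt_top⟩)
    simpa [BoundedVariationOn] using h5.ne
  right_continuous := h.right_continuous

/-- A conull set accumulates at every point from the right. Combined with right continuity, this
upgrades almost everywhere relations to all points. -/
theorem exists_gt_of_ae {p : ℝ → Prop} (h : ∀ᵐ x ∂volHalf, p x) {t : ℝ} (ht : 0 < t) :
    ∃ᶠ x in 𝓝[≥] t, p x := by
  rw [ae_restrict_iff' measurableSet_Ioi] at h
  intro hn
  have hn' : ∀ᶠ x in 𝓝[>] t, ¬ p x := nhdsWithin_mono t Ioi_subset_Ici_self hn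
  obtain ⟨δ, hδ, hsub⟩ := mem_nhdsGT_iff_exists_Ioo_subset.1 hn'
  have hδ' : t < δ := hδ
  have h1 : volume (Ioo t δ) = 0 := by
    refine measure_mono_null (fun x hx => ?_) (ae_iff.1 h)
    exact fun h2 => hsub hx (h2 (ht.trans hx.1))
  rw [Real.volume_Ioo, ENNReal.ofReal_eq_zero] at h1
  linarith

theorem eq_of_ae_eq_of_right_continuous {G G' : ℝ → ℝ}
    (hG : ∀ t, 0 < t → ContinuousWithinAt G (Ici t) t)
    (hG' : ∀ t, 0 < t → ContinuousWithinAt G' (Ici t) t) (h : G =ᵐ[volHalf] G') {t : ℝ}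
    (ht : 0 < t) : G t = G' t := by
  have h1 : Tendsto (fun x => G x - G' x) (𝓝[≥] t) (𝓝 (G t - G' t)) := (hG t ht).sub (hG' t ht)
  have h2 : G t - G' t ∈ ({0} : Set ℝ) := isClosed_singleton.mem_of_frequently_of_tendsto
    ((exists_gt_of_ae h ht).mono fun x hx => by simp [hx]) h1
  simpa [sub_eq_zero] using h2

theorem le_of_ae_le_of_right_continuous {G : ℝ → ℝ} {C : ℝ}
    (hG : ∀ t, 0 < t → ContinuousWithinAt G (Ici t) t) (h : ∀ᵐ x ∂volHalf, G x ≤ C) {t : ℝ}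
    (ht : 0 < t) : G t ≤ C :=
  isClosed_Iic.mem_of_frequently_of_tendsto (exists_gt_of_ae h ht) (hG t ht)

theorem ge_of_ae_ge_of_right_continuous {G : ℝ → ℝ} {C : ℝ}
    (hG : ∀ t, 0 < t → ContinuousWithinAt G (Ici t) t) (h : ∀ᵐ x ∂volHalf, C ≤ G x) {t : ℝ}
    (ht : 0 < t) : C ≤ G t :=
  isClosed_Ici.mem_of_frequently_of_tendsto (exists_gt_of_ae h ht) (hG t ht)

/-- Enlarging `c` to `|c|` makes `|c| y - G` both monotone and bounded below, so it has a right
limit at `0`, whatever the sign of `c`. -/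
theorem AlmostAntitone.exists_tendsto {G : ℝ → ℝ} {c : ℝ} (h : AlmostAntitone G c) {C : ℝ}
    (hC : ∀ y, 0 < y → |G y| ≤ C) : ∃ ℓ, Tendsto G (𝓝[>] 0) (𝓝 ℓ) := by
  have hc0 : 0 ≤ |c| := abs_nonneg c
  have hanti : AntitoneOn (fun y => G y - |c| * y) (Ioi 0) := fun x hx y hy hxy => by
    have h1 := h.le x y hx hxy
    have h2 := mul_le_mul_of_nonneg_right (le_abs_self c) (sub_nonneg.2 hxy)
    simp only
    linarith
  have hm : MonotoneOn (fun y => |c| * y - G y) (Ioi 0) := fun x hx y hy hxy => by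
    have := hanti hx hy hxy
    simp only at this ⊢
    linarith
  have h1 := hm.tendsto_nhdsGT ⟨-C, by
    rintro _ ⟨y, hy, rfl⟩
    have h2 := mul_nonneg hc0 (le_of_lt (show (0 : ℝ) < y from hy))
    have h3 := (abs_le.1 (hC y hy)).2
    simp only
    linarith⟩
  have h2 : Tendsto (fun y : ℝ => |c| * y) (𝓝[>] 0) (𝓝 (|c| * 0)) :=
    tendsto_nhdsWithin_of_tendsto_nhds (by fun_prop : Continuous fun y : ℝ => |c| * y).continuousAt
  exact ⟨_, (h2.sub h1).congr fun y => by ring⟩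

variable {N : ℕ} {𝒰 K : Set (State N)}

section Averages

variable {w : ℕ → ℝ × ℝ → State N} {κ : Kernel (ℝ × ℝ) (State N)} {g : State N → ℝ}

/-- By Fubini almost every slice `t ↦ ⟨κ_{z,t}, g⟩` is measurable and essentially bounded. The
exceptional set of `z` does not depend on the weight or on the time interval. -/
theorem IsYoungMeasure.exists_slice_bound (hκ : IsYoungMeasure 𝒰 w κ) (hg : ContinuousOn g 𝒰) :
    ∃ C, 0 ≤ C ∧ ∀ᵐ z ∂volHalf, ∀ (θ : ℝ → ℝ) (T₁ T₂ : ℝ), 0 ≤ T₁ → T₁ ≤ T₂ →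
      IntegrableOn θ (Ioc T₁ T₂) →
      IntervalIntegrable (fun t => (∫ v, g v ∂(κ (z, t))) * θ t) volume T₁ T₂ ∧
      |timeAvg κ g θ T₁ T₂ z| ≤ C * ∫ t in T₁..T₂, |θ t| := by
  have H := (hκ.weakStar g hg).memLp_limit
  obtain ⟨C, hC⟩ := MemLp_top_ae_bound H
  have hm := H.aestronglyMeasurable
  rw [volQuarter_eq_prod] at hC hm
  refine ⟨|C|, abs_nonneg C, ?_⟩
  filter_upwards [hm.prodMk_left, Measure.ae_ae_of_ae_prod hC] with z hz1 hz2 θ T₁ T₂ h0 h hθ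
  have hsub : Ioc T₁ T₂ ⊆ Ioi 0 := fun t ht => h0.trans_lt ht.1
  have hb : ∀ᵐ t ∂(volume.restrict (Ioc T₁ T₂)), ‖∫ v, g v ∂(κ (z, t))‖ ≤ |C| := by
    filter_upwards [ae_restrict_of_ae_restrict_of_subset hsub hz2] with t ht
    exact ht.trans (le_abs_self C)
  have hi : IntegrableOn (fun t => (∫ v, g v ∂(κ (z, t))) * θ t) (Ioc T₁ T₂) :=
    Integrable.bdd_mul (c := |C|) hθ (hz1.mono_set hsub) hb
  refine ⟨(intervalIntegrable_iff_integrableOn_Ioc_of_le h).2 hi, ?_⟩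
  rw [timeAvg, intervalIntegral.integral_of_le h, intervalIntegral.integral_of_le h,
    ← integral_const_mul, ← Real.norm_eq_abs]
  have hi' : IntegrableOn (fun t => |C| * |θ t|) (Ioc T₁ T₂) := hθ.norm.const_mul _
  refine norm_integral_le_of_norm_le hi' ?_
  filter_upwards [hb] with t ht
  rw [norm_mul]
  exact mul_le_mul_of_nonneg_right ht (norm_nonneg _)

theorem IsYoungMeasure.aestronglyMeasurable_timeAvg (hκ : IsYoungMeasure 𝒰 w κ)
    (hg : ContinuousOn g 𝒰) {θ : ℝ → ℝ} {T₁ T₂ : ℝ} (h0 : 0 ≤ T₁) (h : T₁ ≤ T₂)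
    (hθ : IntegrableOn θ (Ioc T₁ T₂)) : AEStronglyMeasurable (timeAvg κ g θ T₁ T₂) volHalf := by
  have hm := (hκ.weakStar g hg).memLp_limit.aestronglyMeasurable
  rw [volQuarter_eq_prod] at hm
  have hsub : Ioc T₁ T₂ ⊆ Ioi 0 := fun t ht => h0.trans_lt ht.1
  have hχ : AEStronglyMeasurable ((Ioc T₁ T₂).indicator θ) volHalf := by
    rw [aestronglyMeasurable_indicator_iff measurableSet_Ioc,
      Measure.restrict_restrict measurableSet_Ioc, inter_eq_self_of_subset_left hsub]
    exact hθ.aestronglyMeasurable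
  have h1 := (hm.mul (hχ.comp_snd (μ := volHalf))).integral_prod_right'
  refine h1.congr (ae_of_all _ fun y => ?_)
  exact (intervalIntegral_eq_indicator (h := fun t => ∫ v, g v ∂(κ (y, t))) h0 h).symm

theorem IsYoungMeasure.locallyIntegrableOn_timeAvg (hκ : IsYoungMeasure 𝒰 w κ)
    (hg : ContinuousOn g 𝒰) {θ : ℝ → ℝ} {T₁ T₂ : ℝ} (h0 : 0 ≤ T₁) (h : T₁ ≤ T₂)
    (hθ : IntegrableOn θ (Ioc T₁ T₂)) : LocallyIntegrableOn (timeAvg κ g θ T₁ T₂) (Ioi 0) := by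
  obtain ⟨C, -, hC⟩ := hκ.exists_slice_bound hg
  rw [locallyIntegrableOn_iff isOpen_Ioi.isLocallyClosed]
  intro k hk hkc
  refine Integrable.mono' (g := fun _ => C * ∫ t in T₁..T₂, |θ t|)
    (integrableOn_const hkc.measure_lt_top.ne)
    ((hκ.aestronglyMeasurable_timeAvg hg h0 h hθ).mono_set hk) ?_
  filter_upwards [ae_restrict_of_ae_restrict_of_subset hk hC] with z hz
  exact (hz θ T₁ T₂ h0 h hθ).2

theorem IsYoungMeasure.integrableOn_timeAvg_mul (hκ : IsYoungMeasure 𝒰 w κ)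
    (hg : ContinuousOn g 𝒰) {θ : ℝ → ℝ} {T₁ T₂ : ℝ} (h0 : 0 ≤ T₁) (h : T₁ ≤ T₂)
    (hθ : IntegrableOn θ (Ioc T₁ T₂)) {φ : ℝ → ℝ} (hφ : Integrable φ volHalf) :
    Integrable (fun y => timeAvg κ g θ T₁ T₂ y * φ y) volHalf := by
  obtain ⟨C, -, hC⟩ := hκ.exists_slice_bound hg
  refine hφ.bdd_mul (c := C * ∫ t in T₁..T₂, |θ t|)
    (hκ.aestronglyMeasurable_timeAvg hg h0 h hθ) ?_
  filter_upwards [hC] with z hz using (hz θ T₁ T₂ h0 h hθ).2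

theorem IsYoungMeasure.timeAvg_sub_ae (hκ : IsYoungMeasure 𝒰 w κ) (hg : ContinuousOn g 𝒰)
    {θ θ' : ℝ → ℝ} {T₁ T₂ : ℝ} (h0 : 0 ≤ T₁) (h : T₁ ≤ T₂) (hθ : IntegrableOn θ (Ioc T₁ T₂))
    (hθ' : IntegrableOn θ' (Ioc T₁ T₂)) :
    timeAvg κ g (fun t => θ t - θ' t) T₁ T₂
      =ᵐ[volHalf] fun z => timeAvg κ g θ T₁ T₂ z - timeAvg κ g θ' T₁ T₂ z := by
  obtain ⟨C, -, hC⟩ := hκ.exists_slice_bound hg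
  filter_upwards [hC] with z hz
  rw [timeAvg, timeAvg, timeAvg, ← intervalIntegral.integral_sub (hz θ T₁ T₂ h0 h hθ).1
    (hz θ' T₁ T₂ h0 h hθ').1]
  exact intervalIntegral.integral_congr fun t _ => by ring

end Averages

theorem IsTest.integrableOn_mul {p φ : ℝ → ℝ} (hφ : IsTest (Ioi 0) φ)
    (hp : LocallyIntegrableOn p (Ioi 0)) : IntegrableOn (fun y => p y * φ y) (Ioi 0) := by
  obtain ⟨a, b, ha, hab, hs⟩ := hφ.exists_Icc
  have h1 : IntegrableOn (fun x => p x * φ x) (Icc a b) :=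
    (hp.integrableOn_compact_subset (fun x hx => ha.trans_le hx.1) isCompact_Icc).mul_continuousOn
      hφ.smooth.continuous.continuousOn isCompact_Icc
  refine IntegrableOn.of_forall_sdiff_eq_zero h1 measurableSet_Ioi fun x hx => ?_
  rw [image_eq_zero_of_notMem_tsupport fun h' => hx.2 (hs h'), mul_zero]

theorem locallyIntegrableOn_of_Ioc {p : ℝ → ℝ} (hp : ∀ T, 0 < T → IntegrableOn p (Ioc 0 T)) :
    LocallyIntegrableOn p (Ioi 0) := by
  rw [locallyIntegrableOn_iff isOpen_Ioi.isLocallyClosed]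
  intro k hk hkc
  obtain ⟨T, hT⟩ := hkc.bddAbove
  exact (hp (max T 1) (by positivity)).mono_set fun x hx => ⟨hk hx, (hT hx).trans (le_max_left _ _)⟩

theorem ae_eq_of_forall_test {p q : ℝ → ℝ} (hp : LocallyIntegrableOn p (Ioi 0))
    (hq : LocallyIntegrableOn q (Ioi 0))
    (h : ∀ φ, IsTest (Ioi 0) φ → ∫ y in Ioi 0, p y * φ y = ∫ y in Ioi 0, q y * φ y) :
    p =ᵐ[volHalf] q := by
  have h1 := isOpen_Ioi.ae_eq_zero_of_integral_contDiff_smul_eq_zero (hp.sub hq)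
    fun φ h1 h2 h3 => by
      have hφ : IsTest (Ioi 0) φ := ⟨h1, h2, h3⟩
      have h4 : ∫ y, φ y • (p y - q y) = ∫ y in Ioi 0, φ y • (p y - q y) :=
        (setIntegral_eq_integral_of_forall_compl_eq_zero fun x hx => by
          rw [hφ.eq_zero hx, zero_smul]).symm
      have h5 : ∫ y in Ioi 0, φ y • (p y - q y)
          = (∫ y in Ioi 0, p y * φ y) - ∫ y in Ioi 0, q y * φ y := by
        rw [← integral_sub (hφ.integrableOn_mul hp) (hφ.integrableOn_mul hq)]
        exact integral_congr_ae (ae_of_all _ fun y => by simp only [smul_eq_mul]; ring)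
      simp only [Pi.sub_apply]
      rw [h4, h5, h φ hφ, sub_self]
  rw [EventuallyEq, ae_restrict_iff' measurableSet_Ioi]
  filter_upwards [h1] with y hy hy0
  simpa [sub_eq_zero] using hy hy0

/-- The right continuous representative of the layer flux is unique. -/
theorem IsLayerFlux.eq {μ : Kernel (ℝ × ℝ) (State N)} {U F : State N → ℝ} {θ : ℝ → ℝ}
    {T₁ T₂ : ℝ} {G G' : ℝ → ℝ} (hG : IsLayerFlux μ U F θ T₁ T₂ G)
    (hG' : IsLayerFlux μ U F θ T₁ T₂ G') (h : IsBV G) (h' : IsBV G') {y : ℝ} (hy : 0 < y) :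
    G y = G' y := by
  have hloc : ∀ {G : ℝ → ℝ}, IsBV G → LocallyIntegrableOn G (Ioi 0) := fun hG =>
    locallyIntegrableOn_of_Ioc fun _ _ => hG.integrableOn le_rfl
  refine eq_of_ae_eq_of_right_continuous h.right_continuous h'.right_continuous
    (ae_eq_of_forall_test (hloc h) (hloc h') fun φ hφ => ?_) hy
  rw [← hG φ hφ.smooth hφ.compact hφ.supp, hG' φ hφ.smooth hφ.compact hφ.supp]

end BoundaryLayer

/-! ### Limits of the viscous flux in the interior and in the layer -/

namespace BoundaryLayer

variable {N : ℕ} {𝒰 K : Set (State N)}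

theorem TestSeq.integrableOn {ψn : ℕ → ℝ → ℝ} {ψ : ℝ → ℝ} {a : ℕ → ℝ} {T₁ T₂ M : ℝ}
    (h : TestSeq ψn ψ a T₁ T₂ M) : IntegrableOn ψ (Ioc T₁ T₂) := by
  obtain ⟨A, hA⟩ := h.bounded
  have hsub : Ioc T₁ T₂ ⊆ Ioi 0 := fun t ht => h.nonneg.trans_lt ht.1
  have hlim := ae_restrict_of_ae_restrict_of_subset hsub h.lim
  refine Integrable.mono' (g := fun _ => A) (integrableOn_const measure_Ioc_lt_top.ne)
    (aestronglyMeasurable_of_tendsto_ae _ h.meas hlim) ?_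
  filter_upwards [hlim, ae_restrict_mem measurableSet_Ioc] with t ht htm
  exact le_of_tendsto' ht.norm fun n => hA n t (hsub htm)

theorem ae_notMem_of_countable {S : Set ℝ} (hS : S.Countable) : ∀ᵐ y ∂volHalf, y ∉ S :=
  ae_restrict_of_ae (measure_eq_zero_iff_ae_notMem.1 (hS.measure_zero volume))

section Flux

variable {f : State N → State N} {ε : ℕ → ℝ} {uIε uBε : ℕ → ℝ → State N}
  {u : ℕ → ℝ → ℝ → State N} {U F : State N → ℝ} {ν μ : Kernel (ℝ × ℝ) (State N)}

namespace ViscousFamily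

/-- At the scale `s = 1` the coefficient `ε / s` of the viscous term tends to `0`, so only `⟨ν, F⟩`
remains in the limit. The slope `M * B` persists, and monotonicity is only approximate. -/
theorem exists_interior_flux (hV : ViscousFamily 𝒰 K f ε uIε uBε u)
    (hν : IsYoungMeasure 𝒰 (fun n p => u n p.1 p.2) ν)
    (hUF : IsEntropyPair 𝒰 f U F) {ψn : ℕ → ℝ → ℝ} {ψ : ℝ → ℝ} {a : ℕ → ℝ} {T₁ T₂ M : ℝ}
    (h : TestSeq ψn ψ a T₁ T₂ M)
    (hsign : ∀ n, ∀ w ∈ 𝒰, ∀ z, ∀ t, 0 < t → 0 ≤ fderiv ℝ (fderiv ℝ U) w z z * ψn n t)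
    {B : ℝ} (hB : ∀ z ∈ K, |U z| ≤ B) :
    ∃ g : ℝ → ℝ, AlmostAntitone g (M * B) ∧
      (∀ᵐ x ∂volHalf, Tendsto (fun n => viscFlux (ε n) (u n) U F (ψn n) (a n) T₂ x) atTop
        (𝓝 (g x))) ∧
      timeAvg ν F ψ T₁ T₂ =ᵐ[volHalf] g ∧ ∃ C, ∀ x, 0 < x → |g x| ≤ C := by
  obtain ⟨g, hg1, hg2, ⟨S, hS, hg3⟩, hg4⟩ := hV.exists_flux_limit hUF h hsign hB (s := fun _ => 1)
    (fun _ => one_pos) tendsto_const_nhds (r := 0) (by simpa using hV.eps_tendsto) (κ := ν)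
    (by simpa only [one_mul] using hν)
  have hg : AlmostAntitone g (M * B) := ⟨by simpa using hg1, hg2⟩
  have hψ := h.integrableOn
  have hFc := hUF.contDiffOn_flux.continuousOn
  have hae : timeAvg ν F ψ T₁ T₂ =ᵐ[volHalf] g :=
    ae_eq_of_forall_test (hν.locallyIntegrableOn_timeAvg hFc h.nonneg h.lt.le hψ)
      hg.locallyIntegrableOn fun φ hφ => by simpa using hg4 φ hφ
  obtain ⟨C, -, hC⟩ := hν.exists_slice_bound hFc
  refine ⟨g, hg, ?_, hae, C * ∫ t in T₁..T₂, |ψ t|, fun x hx => ?_⟩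
  · filter_upwards [ae_notMem_of_countable hS, ae_restrict_mem measurableSet_Ioi] with x hxS hx
    simpa only [one_mul] using hg3 x hx hxS
  · have hb : ∀ᵐ x ∂volHalf, |g x| ≤ C * ∫ t in T₁..T₂, |ψ t| := by
      filter_upwards [hae, hC] with x hx1 hx2
      rw [← hx1]
      exact (hx2 ψ T₁ T₂ h.nonneg h.lt.le hψ).2
    rw [abs_le]
    exact ⟨ge_of_ae_ge_of_right_continuous hg2 (hb.mono fun x hx => (abs_le.1 hx).1) hx,
      le_of_ae_le_of_right_continuous hg2 (hb.mono fun x hx => (abs_le.1 hx).2) hx⟩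

/-- At the scale `s = ε` the ratio `ε / s` equals `1`, which keeps the derivative of `⟨μ, U⟩`, while
the slope `M * B * ε` tends to `0`. Hence the limit is exactly antitone. -/
theorem exists_layer_flux (hV : ViscousFamily 𝒰 K f ε uIε uBε u)
    (hμ : IsYoungMeasure 𝒰 (fun n p => u n (ε n * p.1) p.2) μ)
    (hUF : IsEntropyPair 𝒰 f U F) {ψn : ℕ → ℝ → ℝ} {ψ : ℝ → ℝ} {a : ℕ → ℝ} {T₁ T₂ M : ℝ}
    (h : TestSeq ψn ψ a T₁ T₂ M)
    (hsign : ∀ n, ∀ w ∈ 𝒰, ∀ z, ∀ t, 0 < t → 0 ≤ fderiv ℝ (fderiv ℝ U) w z z * ψn n t)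
    {B : ℝ} (hB : ∀ z ∈ K, |U z| ≤ B) :
    ∃ G : ℝ → ℝ, AlmostAntitone G 0 ∧
      (∀ᵐ y ∂volHalf, Tendsto (fun n => viscFlux (ε n) (u n) U F (ψn n) (a n) T₂ (ε n * y)) atTop
        (𝓝 (G y))) ∧ IsLayerFlux μ U F ψ T₁ T₂ G := by
  obtain ⟨G, hG1, hG2, ⟨S, hS, hG3⟩, hG4⟩ := hV.exists_flux_limit hUF h hsign hB (s := ε)
    hV.eps_pos hV.eps_tendsto (r := 1)
    (tendsto_const_nhds.congr fun n => (div_self (hV.eps_pos n).ne').symm) hμ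
  refine ⟨G, ⟨by simpa using hG1, hG2⟩, ?_, fun φ h1 h2 h3 => ?_⟩
  · filter_upwards [ae_notMem_of_countable hS, ae_restrict_mem measurableSet_Ioi] with x hxS hx
    exact hG3 x hx hxS
  · have hφ : IsTest (Ioi 0) φ := ⟨h1, h2, h3⟩
    rw [← hG4 φ hφ, one_mul]
    have hφi : Integrable φ volHalf :=
      (hφ.smooth.continuous.integrable_of_hasCompactSupport hφ.compact).integrableOn
    have hφi' : Integrable (deriv φ) volHalf :=
      ((hφ.smooth.continuous_deriv (by norm_num)).integrable_of_hasCompactSupport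
        hφ.compact.deriv).integrableOn
    exact integral_add
      (hμ.integrableOn_timeAvg_mul hUF.contDiffOn_flux.continuousOn h.nonneg h.lt.le
        h.integrableOn hφi)
      (hμ.integrableOn_timeAvg_mul hUF.contDiffOn_entropy.continuousOn h.nonneg h.lt.le
        h.integrableOn hφi')

end ViscousFamily

end Flux

/-! ### Traces of the interior flux and of the momentum fluxes -/

section Traces

variable {f : State N → State N} {ε : ℕ → ℝ} {uIε uBε : ℕ → ℝ → State N}
  {u : ℕ → ℝ → ℝ → State N} {U F : State N → ℝ} {ν μ : Kernel (ℝ × ℝ) (State N)}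

theorem IsConvexEntropyPair.hessian_mul_nonneg (hUF : IsConvexEntropyPair 𝒰 f U F) {θ : ℝ → ℝ}
    (hθ : ∀ t, 0 < t → 0 ≤ θ t) : ∀ _ : ℕ, ∀ w ∈ 𝒰, ∀ z, ∀ t, 0 < t →
      0 ≤ fderiv ℝ (fderiv ℝ U) w z z * θ t :=
  fun _ w hw z t ht => mul_nonneg (hUF.hessian_nonneg w hw z) (hθ t ht)

/-- Every `BV` weight is a difference of nonnegative ones. -/
theorem IsBV.exists_eq_sub {θ : ℝ → ℝ} (hθ : IsBV θ) : ∃ p q : ℝ → ℝ, IsBV p ∧ IsBV q ∧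
    (∀ t, 0 < t → 0 ≤ p t) ∧ (∀ t, 0 < t → 0 ≤ q t) ∧ θ = fun t => p t - q t := by
  obtain ⟨C, hC⟩ := hθ.bounded
  refine ⟨fun t => θ t + C, fun _ => C, hθ.add_const C, isBV_const C, fun t ht => ?_,
    fun t ht => (norm_nonneg _).trans (hC t ht), by simp⟩
  linarith [(abs_le.1 (hC t ht)).1]

theorem ViscousFamily.exists_interior_isBV (hV : ViscousFamily 𝒰 K f ε uIε uBε u)
    (hν : IsYoungMeasure 𝒰 (fun n p => u n p.1 p.2) ν) (hUF : IsConvexEntropyPair 𝒰 f U F)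
    {θ : ℝ → ℝ} (hθ : IsBV θ) {T₁ T₂ : ℝ} (h0 : 0 ≤ T₁) (h : T₁ < T₂) :
    ∃ g : ℝ → ℝ, IsBV g ∧ timeAvg ν F θ T₁ T₂ =ᵐ[volHalf] g ∧ ∃ ℓ, Tendsto g (𝓝[>] 0) (𝓝 ℓ) := by
  have key : ∀ θ : ℝ → ℝ, IsBV θ → (∀ t, 0 < t → 0 ≤ θ t) → ∃ g : ℝ → ℝ, IsBV g ∧
      timeAvg ν F θ T₁ T₂ =ᵐ[volHalf] g ∧ ∃ ℓ, Tendsto g (𝓝[>] 0) (𝓝 ℓ) := by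
    intro θ hθ hpos
    obtain ⟨M, hM⟩ := hθ.exists_testSeq h0 h
    obtain ⟨B, -, hB⟩ := hV.exists_bound hUF.contDiffOn_entropy.continuousOn
    obtain ⟨g, hg, -, hae, C, hC⟩ := hV.exists_interior_flux hν hUF.toIsEntropyPair hM
      (hUF.hessian_mul_nonneg hpos) hB
    exact ⟨g, hg.isBV hC, hae, hg.exists_tendsto hC⟩
  obtain ⟨p, q, hp, hq, hp0, hq0, rfl⟩ := hθ.exists_eq_sub
  obtain ⟨g₁, hg₁, hae₁, ℓ₁, hℓ₁⟩ := key p hp hp0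
  obtain ⟨g₂, hg₂, hae₂, ℓ₂, hℓ₂⟩ := key q hq hq0
  refine ⟨fun x => g₁ x - g₂ x, hg₁.sub hg₂, ?_, ℓ₁ - ℓ₂, hℓ₁.sub hℓ₂⟩
  filter_upwards [hν.timeAvg_sub_ae hUF.contDiffOn_flux.continuousOn h0 h.le (hp.integrableOn h0)
    (hq.integrableOn h0), hae₁, hae₂] with x hx hx1 hx2
  rw [hx, hx1, hx2]

theorem ViscousFamily.nonempty (hV : ViscousFamily 𝒰 K f ε uIε uBε u) : K.Nonempty :=
  ⟨u 0 1 1, hV.mem 0 1 1 zero_le_one zero_le_one⟩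

/-- Compactness produces a kernel that is a trace merely along an ultrafilter. Bounded variation
shows that the full limit exists for every entropy flux, and the two limits must coincide. -/
theorem ViscousFamily.exists_fluxTrace (hV : ViscousFamily 𝒰 K f ε uIε uBε u)
    (hν : IsYoungMeasure 𝒰 (fun n p => u n p.1 p.2) ν) :
    ∃ ν₀ : Kernel ℝ (State N), IsFluxTrace 𝒰 f ν ν₀ := by
  have := hν.markov
  have hsupp := hν.ae_compl_eq_zero hV.compact.isClosed
    fun n p hp => hV.mem n p.1 p.2 (le_of_lt hp.1) (le_of_lt hp.2)
  obtain ⟨κ₀, hκ₀, hκ₀K, 𝓕, h𝓕, hlim⟩ := exists_trace_along (κ := ν) hV.compact hV.nonempty hsupp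
  refine ⟨κ₀, ⟨hκ₀, K, hV.compact, hV.subset, fun t _ => hκ₀K t⟩, ?_⟩
  intro U F hUF θ hθ T₁ T₂ h0 h
  obtain ⟨g, -, hae, ℓ, hℓ⟩ := hV.exists_interior_isBV hν hUF hθ h0 h
  have h1 : Tendsto (timeAvg ν F θ T₁ T₂) (𝓝[>] (0 : ℝ) ⊓ ae volume) (𝓝 ℓ) :=
    (hℓ.mono_left inf_le_left).congr' ((eventually_traceFilter hae).mono fun x hx => hx.symm)
  have h2 := hlim F (hUF.contDiffOn_flux.continuousOn.mono hV.subset) θ T₁ T₂ h0 h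
    (hθ.integrableOn h0)
  rw [HasTraceOn, tendsto_nhds_unique h2 (h1.mono_left h𝓕)]
  exact h1

/-- The coordinates form entropy pairs. -/
theorem isConvexEntropyPair_coord (h𝒰 : IsOpen 𝒰) (hf : ContDiffOn ℝ ∞ f 𝒰) (j : Fin N) :
    IsConvexEntropyPair 𝒰 f (fun w => w j) (fun w => f w j) := by
  have hc : ∀ w : State N, HasFDerivAt (𝕜 := ℝ) (fun w : State N => w j)
      (EuclideanSpace.proj j : State N →L[ℝ] ℝ) w := fun w =>
    (EuclideanSpace.proj (𝕜 := ℝ) j).hasFDerivAt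
  have hd : fderiv ℝ (fun w : State N => w j) = fun _ =>
      (EuclideanSpace.proj j : State N →L[ℝ] ℝ) :=
    funext fun w => (hc w).fderiv
  refine ⟨⟨(EuclideanSpace.proj (𝕜 := ℝ) j).contDiff.contDiffOn,
    (EuclideanSpace.proj (𝕜 := ℝ) j).contDiff.comp_contDiffOn (hf.of_le ENat.LEInfty.out),
    fun w hw => ?_⟩, fun w hw z => ?_⟩
  · have h1 : HasFDerivAt f (fderiv ℝ f w) w :=
      ((hf.differentiableOn (by simp)).differentiableAt (h𝒰.mem_nhds hw)).hasFDerivAt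
    rw [hd]
    exact ((hc (f w)).comp w h1).fderiv
  · rw [hd]
    simp

/-- With zero Hessian the sign condition of `viscFlux_le` holds for weights of both signs, which is
what makes momentum fluxes Lipschitz. -/
theorem hessian_coord (j : Fin N) (w z : State N) :
    fderiv ℝ (fderiv ℝ (fun w : State N => w j)) w z z = 0 := by
  have hd : fderiv ℝ (fun w : State N => w j) = fun _ =>
      (EuclideanSpace.proj j : State N →L[ℝ] ℝ) :=
    funext fun w => (EuclideanSpace.proj (𝕜 := ℝ) j).hasFDerivAt.fderiv
  rw [hd]
  simp

theorem viscFlux_neg (ε : ℝ) (u : ℝ → ℝ → State N) (U F : State N → ℝ) (ψ : ℝ → ℝ) (a b x : ℝ) :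
    viscFlux ε u U F (fun t => -ψ t) a b x = -viscFlux ε u U F ψ a b x := by
  simp only [viscFlux, mul_neg, intervalIntegral.integral_neg]

/-- The momentum fluxes at the boundary converge to the trace of `ν`. -/
theorem ViscousFamily.tendsto_boundary_coord (hV : ViscousFamily 𝒰 K f ε uIε uBε u)
    (hν : IsYoungMeasure 𝒰 (fun n p => u n p.1 p.2) ν) {ν₀ : Kernel ℝ (State N)}
    (hν₀ : IsFluxTrace 𝒰 f ν ν₀) (j : Fin N) {ψn : ℕ → ℝ → ℝ} {ψ : ℝ → ℝ} {a : ℕ → ℝ}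
    {T₁ T₂ M : ℝ} (h : TestSeq ψn ψ a T₁ T₂ M) (hψ : IsBV ψ) :
    Tendsto (fun n => viscFlux (ε n) (u n) (fun w => w j) (fun w => f w j) (ψn n) (a n) T₂ 0) atTop
      (𝓝 (∫ t in T₁..T₂, (∫ w, f w j ∂(ν₀ t)) * ψ t)) := by
  have hP := isConvexEntropyPair_coord hV.isOpen hV.smooth j
  obtain ⟨B, -, hB⟩ := hV.exists_bound hP.contDiffOn_entropy.continuousOn
  have hs : ∀ (ψn : ℕ → ℝ → ℝ), ∀ n, ∀ w ∈ 𝒰, ∀ z, ∀ t, 0 < t →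
      0 ≤ fderiv ℝ (fderiv ℝ fun w : State N => w j) w z z * ψn n t := fun ψn n w _ z t _ => by
    rw [hessian_coord, zero_mul]
  obtain ⟨g, -, hptw, hae, -⟩ := hV.exists_interior_flux hν hP.toIsEntropyPair h (hs ψn) hB
  have htr := hν₀.trace _ _ hP ψ hψ T₁ T₂ h.nonneg h.lt
  set ℓ := ∫ t in T₁..T₂, (∫ w, f w j ∂(ν₀ t)) * ψ t with hℓ
  -- Using the one-sided estimate for `ψn` and for `-ψn` gives a Lipschitz bound at the wall,
  -- uniform in `n`, so that `n → ∞` and `x → 0` can be exchanged.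
  have hLip : ∀ n x, 0 < x →
      |viscFlux (ε n) (u n) (fun w => w j) (fun w => f w j) (ψn n) (a n) T₂ x
        - viscFlux (ε n) (u n) (fun w => w j) (fun w => f w j) (ψn n) (a n) T₂ 0| ≤ M * B * x := by
    intro n x hx
    have hfd := hV.smooth.differentiableOn (n := ∞) (by simp)
    have h1 := (hV.sol n).viscFlux_le hV.isOpen (hV.eps_pos n) hfd hP.toIsEntropyPair (h.pos n)
      (h.mem n).2.le (h.pairing n)
      (fun w hw z t ht => hs ψn n w hw z t ((h.pos n).trans_le ht.1))
      (fun x t hx ht => hB _ (hV.mem n x t hx ht)) le_rfl hx.le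
    have h2 := (hV.sol n).viscFlux_le hV.isOpen (hV.eps_pos n) hfd hP.toIsEntropyPair (h.pos n)
      (h.mem n).2.le (h.neg.pairing n)
      (fun w hw z t ht => hs (fun n t => -ψn n t) n w hw z t ((h.pos n).trans_le ht.1))
      (fun x t hx ht => hB _ (hV.mem n x t hx ht)) le_rfl hx.le
    rw [viscFlux_neg, viscFlux_neg] at h2
    rw [abs_le]
    constructor <;> linarith
  rw [Metric.tendsto_nhds]
  intro e he
  have e1 : ∀ᶠ x in 𝓝[>] (0 : ℝ) ⊓ ae volume, |timeAvg ν (fun w => f w j) ψ T₁ T₂ x - ℓ| < e / 3 :=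
    (Metric.tendsto_nhds.1 htr) (e / 3) (by linarith)
  have e2 : ∀ᶠ x in 𝓝[>] (0 : ℝ) ⊓ ae volume, M * B * x < e / 3 := by
    have hc : Tendsto (fun x : ℝ => M * B * x) (𝓝 0) (𝓝 (M * B * 0)) :=
      (by fun_prop : Continuous fun x : ℝ => M * B * x).continuousAt
    rw [mul_zero] at hc
    have h1 := hc.eventually (gt_mem_nhds (show (0 : ℝ) < e / 3 by linarith))
    exact (inf_le_left.trans nhdsWithin_le_nhds : 𝓝[>] (0 : ℝ) ⊓ ae volume ≤ 𝓝 0) h1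
  have e3 := eventually_traceFilter (ae_restrict_mem (μ := (volume : Measure ℝ))
    (measurableSet_Ioi (a := (0 : ℝ))))
  -- One small `x` is fixed where the average of `ν` is close to its trace, the Lipschitz error is
  -- small and the fluxes converge; each contributes `e / 3`.
  obtain ⟨x, ⟨⟨⟨hx1, hx2⟩, hx3⟩, hx4⟩, hx5⟩ := ((((e1.and e2).and e3).and
    (eventually_traceFilter hptw)).and (eventually_traceFilter hae)).exists
  filter_upwards [(Metric.tendsto_nhds.1 hx4) (e / 3) (by linarith)] with n hn
  have h1 := hLip n x hx3
  rw [hx5] at hx1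
  rw [Real.dist_eq] at hn ⊢
  rw [abs_lt] at *
  rw [abs_le] at h1
  constructor <;> linarith [h1.1, h1.2, hx1.1, hx1.2, hn.1, hn.2]

end Traces

end BoundaryLayer

/-! ### The viscous flux at the boundary -/

namespace BoundaryLayer

variable {N : ℕ} {𝒰 K : Set (State N)} {f : State N → State N} {ε : ℕ → ℝ}
  {uIε uBε : ℕ → ℝ → State N} {uB : ℝ → State N}
  {u : ℕ → ℝ → ℝ → State N} {U F : State N → ℝ} {ν μ : Kernel (ℝ × ℝ) (State N)}

/-- The boundary data and their limit. -/
structure BoundaryData (uBε : ℕ → ℝ → State N) (uB : ℝ → State N) : Prop where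
  isBV : IsBV uB
  variation : ∀ T : ℝ, ∃ C : NNReal, ∀ n, eVariationOn (uBε n) (Ioo 0 T) ≤ C
  lim : ∀ᵐ t ∂volHalf, Tendsto (fun n => uBε n t) atTop (𝓝 (uB t))

namespace ViscousFamily

theorem boundary_mem (hV : ViscousFamily 𝒰 K f ε uIε uBε u) (n : ℕ) {t : ℝ} (ht : 0 < t) :
    uBε n t ∈ K := by
  rw [← (hV.sol n).boundary t ht]
  exact hV.mem n 0 t le_rfl ht.le

/-- Almost every value is a limit of points of the closed set `K`, and right continuity extends this
to every `t > 0`. -/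
theorem boundary_limit_mem (hV : ViscousFamily 𝒰 K f ε uIε uBε u) (hD : BoundaryData uBε uB)
    {t : ℝ} (ht : 0 < t) : uB t ∈ K := by
  have h1 : ∀ᵐ t ∂volHalf, uB t ∈ K := by
    filter_upwards [hD.lim, ae_restrict_mem measurableSet_Ioi] with t hlim ht
    exact hV.compact.isClosed.mem_of_tendsto hlim (Eventually.of_forall fun n =>
      hV.boundary_mem n ht)
  exact hV.compact.isClosed.mem_of_frequently_of_tendsto (exists_gt_of_ae h1 ht)
    (hD.isBV.right_continuous t ht)

theorem continuousOn_boundary (hV : ViscousFamily 𝒰 K f ε uIε uBε u) {R : State N → ℝ}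
    (hR : ContinuousOn R 𝒰) (n : ℕ) : ContinuousOn (fun t => R (uBε n t)) (Ioi 0) := by
  have h1 : ContinuousOn (fun t => R (u n 0 t)) (Ioi 0) :=
    hR.comp ((hV.sol n).contDiffOn_time le_rfl).continuousOn fun t ht =>
      (hV.sol n).mem 0 t le_rfl (le_of_lt ht)
  exact h1.congr fun t ht => by simp only [(hV.sol n).boundary t ht]

theorem tendsto_comp_boundary (hV : ViscousFamily 𝒰 K f ε uIε uBε u) (hD : BoundaryData uBε uB)
    {R : State N → ℝ} (hR : ContinuousOn R 𝒰) :
    ∀ᵐ t ∂volHalf, Tendsto (fun n => R (uBε n t)) atTop (𝓝 (R (uB t))) := by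
  filter_upwards [hD.lim, ae_restrict_mem measurableSet_Ioi] with t hlim ht
  have hm := hV.subset (hV.boundary_limit_mem hD ht)
  exact (hR.continuousAt (hV.isOpen.mem_nhds hm)).tendsto.comp hlim

theorem aestronglyMeasurable_boundary (hV : ViscousFamily 𝒰 K f ε uIε uBε u)
    (hD : BoundaryData uBε uB) {R : State N → ℝ} (hR : ContinuousOn R 𝒰) :
    AEStronglyMeasurable (fun t => R (uB t)) volHalf :=
  aestronglyMeasurable_of_tendsto_ae _ (fun n =>
    (hV.continuousOn_boundary hR n).aestronglyMeasurable measurableSet_Ioi)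
    (hV.tendsto_comp_boundary hD hR)

theorem intervalIntegrable_boundary (hV : ViscousFamily 𝒰 K f ε uIε uBε u)
    (hD : BoundaryData uBε uB) {R : State N → ℝ} (hR : ContinuousOn R 𝒰) {θ : ℝ → ℝ}
    {T₁ T₂ : ℝ} (h0 : 0 ≤ T₁) (h : T₁ ≤ T₂) (hθ : IntegrableOn θ (Ioc T₁ T₂)) :
    IntervalIntegrable (fun t => R (uB t) * θ t) volume T₁ T₂ := by
  obtain ⟨B, -, hB⟩ := hV.exists_bound hR
  have hsub : Ioc T₁ T₂ ⊆ Ioi 0 := fun t ht => h0.trans_lt ht.1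
  rw [intervalIntegrable_iff_integrableOn_Ioc_of_le h]
  refine Integrable.bdd_mul (c := B) hθ ((hV.aestronglyMeasurable_boundary hD hR).mono_set hsub) ?_
  filter_upwards [ae_restrict_mem measurableSet_Ioc] with t ht
  exact hB _ (hV.boundary_limit_mem hD (hsub ht))

theorem tendsto_integral_boundary (hV : ViscousFamily 𝒰 K f ε uIε uBε u)
    (hD : BoundaryData uBε uB) {R : State N → ℝ} (hR : ContinuousOn R 𝒰) {θ : ℝ → ℝ}
    {a : ℕ → ℝ} {T₁ T₂ M : ℝ} (h : TestSeq (fun _ => θ) θ a T₁ T₂ M) :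
    Tendsto (fun n => ∫ t in a n..T₂, R (uBε n t) * θ t) atTop
      (𝓝 (∫ t in T₁..T₂, R (uB t) * θ t)) := by
  obtain ⟨B, hB0, hB⟩ := hV.exists_bound hR
  rw [intervalIntegral_eq_indicator h.nonneg h.lt.le]
  simp only [fun n => intervalIntegral_eq_indicator (h := fun t => R (uBε n t)) (ψ := θ)
    (h.pos n).le (h.mem n).2.le]
  have hsub : ∀ n, Ioc (a n) T₂ ⊆ Ioc T₁ T₂ := fun n => Ioc_subset_Ioc_left (h.mem n).1.le
  have hsub0 : Ioc T₁ T₂ ⊆ Ioi 0 := fun t ht => h.nonneg.trans_lt ht.1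
  have hi : Integrable ((Ioc T₁ T₂).indicator θ) volHalf := by
    rw [integrable_indicator_iff measurableSet_Ioc, IntegrableOn,
      Measure.restrict_restrict measurableSet_Ioc]
    exact h.integrableOn.mono_set inter_subset_left
  refine tendsto_integral_of_dominated_convergence
    (fun t => B * |(Ioc T₁ T₂).indicator θ t|) (fun n => ?_) (hi.norm.const_mul B) (fun n => ?_) ?_
  · refine ((hV.continuousOn_boundary hR n).aestronglyMeasurable measurableSet_Ioi).mul ?_
    rw [aestronglyMeasurable_indicator_iff measurableSet_Ioc,
      Measure.restrict_restrict measurableSet_Ioc,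
      inter_eq_self_of_subset_left ((hsub n).trans hsub0)]
    exact (h.meas n).mono_set (hsub n)
  · filter_upwards [ae_restrict_mem measurableSet_Ioi] with t ht
    rw [norm_mul]
    refine mul_le_mul (hB _ (hV.boundary_mem n ht)) ?_ (norm_nonneg _) hB0
    by_cases h1 : t ∈ Ioc (a n) T₂
    · rw [indicator_of_mem h1, indicator_of_mem (hsub n h1), Real.norm_eq_abs]
    · rw [indicator_of_notMem h1, norm_zero]
      exact abs_nonneg _
  · filter_upwards [hV.tendsto_comp_boundary hD hR] with t ht
    refine ht.mul ?_
    by_cases h1 : t ∈ Ioc T₁ T₂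
    · rw [indicator_of_mem h1]
      refine tendsto_const_nhds.congr' ?_
      filter_upwards [h.tendsto.eventually (gt_mem_nhds h1.1)] with n hn
      rw [indicator_of_mem (show t ∈ Ioc (a n) T₂ from ⟨hn, h1.2⟩)]
    · rw [indicator_of_notMem h1]
      refine tendsto_const_nhds.congr fun n => ?_
      rw [indicator_of_notMem fun h2 => h1 (hsub n h2)]

/-- The derivative is bounded on the compact set `K`, and convexity of `K` allows the mean value
inequality. -/
theorem exists_lipschitzOnWith (hV : ViscousFamily 𝒰 K f ε uIε uBε u) {q : State N → ℝ}
    (hq : ContDiffOn ℝ 1 q 𝒰) : ∃ C : NNReal, LipschitzOnWith C q K := by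
  obtain ⟨C, hC⟩ := hV.compact.exists_bound_of_continuousOn
    ((hq.continuousOn_fderiv_of_isOpen hV.isOpen le_rfl).mono hV.subset)
  refine ⟨C.toNNReal, hV.convex.lipschitzOnWith_of_nnnorm_fderiv_le (𝕜 := ℝ) (fun x hx =>
    (hq.differentiableOn one_ne_zero).differentiableAt (hV.isOpen.mem_nhds (hV.subset hx)))
    fun x hx => ?_⟩
  rw [← NNReal.coe_le_coe, coe_nnnorm]
  exact (hC x hx).trans (Real.le_coe_toNNReal C)

theorem isBV_boundary_mul (hV : ViscousFamily 𝒰 K f ε uIε uBε u) (hD : BoundaryData uBε uB)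
    {q : State N → ℝ} (hq : ContDiffOn ℝ 1 q 𝒰) {θ : ℝ → ℝ} (hθ : IsBV θ) :
    IsBV fun t => q (uB t) * θ t := by
  obtain ⟨Q, hQ0, hQ⟩ := hV.exists_bound hq.continuousOn
  obtain ⟨C, hC⟩ := hV.exists_lipschitzOnWith hq
  obtain ⟨A, hA⟩ := hθ.bounded
  refine ⟨⟨Q * A, fun t ht => ?_⟩, fun T => ?_, fun t ht => ?_⟩
  · rw [norm_mul]
    exact mul_le_mul (hQ _ (hV.boundary_limit_mem hD ht)) (hA t ht) (norm_nonneg _) hQ0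
  · exact (hC.comp_boundedVariationOn (fun t ht => hV.boundary_limit_mem hD ht.1)
      (hD.isBV.variation T)).mul (hθ.variation T)
  · have h1 : ContinuousAt q (uB t) := hq.continuousOn.continuousAt
      (hV.isOpen.mem_nhds (hV.subset (hV.boundary_limit_mem hD ht)))
    exact (h1.comp_continuousWithinAt (hD.isBV.right_continuous t ht)).mul
      (hθ.right_continuous t ht)

/-- The variation of `q(u_B^ε) θ` is at most `sup |q| Var θ + sup |θ| Lip(q) Var u_B^ε`, hence
bounded uniformly in `n`. With `q = ∂ⱼU` these are the weights of the momentum fluxes at the wall.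
-/
theorem exists_testSeq_boundary (hV : ViscousFamily 𝒰 K f ε uIε uBε u) (hD : BoundaryData uBε uB)
    {q : State N → ℝ} (hq : ContDiffOn ℝ 1 q 𝒰) {θ : ℝ → ℝ} (hθ : IsBV θ) {T₁ T₂ : ℝ}
    (h0 : 0 ≤ T₁) (h : T₁ < T₂) :
    ∃ M, TestSeq (fun n t => q (uBε n t) * θ t) (fun t => q (uB t) * θ t) (windowStart T₁ T₂)
      T₁ T₂ M := by
  obtain ⟨Q, hQ0, hQ⟩ := hV.exists_bound hq.continuousOn
  obtain ⟨C, hC⟩ := hV.exists_lipschitzOnWith hq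
  obtain ⟨A, hA⟩ := hθ.bounded
  obtain ⟨D, hDv⟩ := hD.variation (T₂ + 1)
  refine ⟨_, testSeq_of_variation_le (A := Q * A)
    (V := Q.toNNReal * (eVariationOn θ (Ioo 0 (T₂ + 1))).toNNReal + A.toNNReal * (C * D)) h0 h
    (fun n t ht => ?_) (fun n => ?_) ?_⟩
  · rw [abs_mul]
    exact mul_le_mul (hQ _ (hV.boundary_mem n ht)) (hA t ht) (abs_nonneg _) hQ0
  · have h1 := eVariation_mul_le (f := q ∘ uBε n) (g := θ) (s := Ioo 0 (T₂ + 1))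
      (C := (Q.toNNReal : ENNReal)) (D := (A.toNNReal : ENNReal))
      (fun t ht => by
        rw [← ofReal_norm]
        exact ENNReal.ofReal_le_ofReal (hQ _ (hV.boundary_mem n ht.1)))
      (fun t ht => by
        rw [← ofReal_norm]
        exact ENNReal.ofReal_le_ofReal (hA t ht.1))
    refine h1.trans ?_
    push_cast
    rw [ENNReal.coe_toNNReal (hθ.variation _)]
    gcongr
    exact (hC.comp_eVariationOn_le fun t ht => hV.boundary_mem n ht.1).trans
      (by gcongr; exact hDv n)
  · filter_upwards [hV.tendsto_comp_boundary hD hq.continuousOn] with t ht using ht.mul_const _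

end ViscousFamily

theorem sum_coord_apply (ℓ : State N →L[ℝ] ℝ) (v : State N) :
    ∑ j, v j * ℓ (EuclideanSpace.single j 1) = ℓ v := by
  conv_rhs => rw [← (EuclideanSpace.basisFun (Fin N) ℝ).sum_repr v]
  rw [map_sum]
  refine Finset.sum_congr rfl fun j _ => ?_
  simp

theorem fderiv_coord (j : Fin N) (w z : State N) :
    fderiv ℝ (fun w : State N => w j) w z = z j := by
  have h : HasFDerivAt (𝕜 := ℝ) (fun w : State N => w j)
      (EuclideanSpace.proj j : State N →L[ℝ] ℝ) w := (EuclideanSpace.proj (𝕜 := ℝ) j).hasFDerivAt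
  rw [h.fderiv]
  rfl

theorem contDiffOn_fderiv_apply (h𝒰 : IsOpen 𝒰) (hU : ContDiffOn ℝ 2 U 𝒰) (e : State N) :
    ContDiffOn ℝ 1 (fun w => fderiv ℝ U w e) 𝒰 :=
  (hU.fderiv_of_isOpen (m := 1) h𝒰 (by norm_num)).clm_apply contDiffOn_const

theorem continuousOn_boundaryFlux (h𝒰 : IsOpen 𝒰) (hf : ContDiffOn ℝ ∞ f 𝒰)
    (hUF : IsEntropyPair 𝒰 f U F) : ContinuousOn (fun w => F w - fderiv ℝ U w (f w)) 𝒰 :=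
  hUF.contDiffOn_flux.continuousOn.sub
    ((hUF.contDiffOn_entropy.continuousOn_fderiv_of_isOpen h𝒰 (by norm_num)).clm_apply
      hf.continuousOn)

/-- The viscous flux at the boundary in terms of the momentum fluxes. -/
theorem ViscousFamily.viscFlux_zero (hV : ViscousFamily 𝒰 K f ε uIε uBε u)
    (hUF : IsEntropyPair 𝒰 f U F) (n : ℕ) {θ : ℝ → ℝ} {a b : ℝ} (ha : 0 < a) (hab : a ≤ b)
    (hθ : IntervalIntegrable θ volume a b) :
    viscFlux (ε n) (u n) U F θ a b 0
      = (∫ t in a..b, (F (uBε n t) - fderiv ℝ U (uBε n t) (f (uBε n t))) * θ t)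
        + ∑ j, viscFlux (ε n) (u n) (fun w => w j) (fun w => f w j)
          (fun t => fderiv ℝ U (uBε n t) (EuclideanSpace.single j 1) * θ t) a b 0 := by
  have hsub : Icc a b ⊆ Ioi 0 := fun t ht => ha.trans_le ht.1
  have hq : ∀ j, IntervalIntegrable
      (fun t => fderiv ℝ U (uBε n t) (EuclideanSpace.single j 1) * θ t) volume a b := fun j =>
    hθ.continuousOn_mul (by
      rw [uIcc_of_le hab]
      exact (hV.continuousOn_boundary (contDiffOn_fderiv_apply hV.isOpen hUF.contDiffOn_entropy
        (EuclideanSpace.single j 1)).continuousOn n).mono hsub)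
  have hi0 : IntervalIntegrable
      (fun t => (F (uBε n t) - fderiv ℝ U (uBε n t) (f (uBε n t))) * θ t) volume a b :=
    hθ.continuousOn_mul (by
      rw [uIcc_of_le hab]
      exact (hV.continuousOn_boundary
        (continuousOn_boundaryFlux hV.isOpen hV.smooth hUF) n).mono hsub)
  have hi : ∀ j ∈ Finset.univ, IntervalIntegrable (fun t => (f (u n 0 t) j
      - ε n * fderiv ℝ (fun w : State N => w j) (u n 0 t) (spaceDeriv (u n) 0 t))
      * (fderiv ℝ U (uBε n t) (EuclideanSpace.single j 1) * θ t)) volume a b := fun j _ =>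
    intervalIntegrable_continuousOn_mul (((hV.sol n).contDiffOn_flux hV.isOpen
      (isConvexEntropyPair_coord hV.isOpen hV.smooth j).toIsEntropyPair).continuousOn) ha hab
      (hq j) (x := 0) (mem_Ici.2 le_rfl)
  simp only [viscFlux]
  rw [← intervalIntegral.integral_finsetSum hi,
    ← intervalIntegral.integral_add hi0 (IntervalIntegrable.sum _ hi |>.congr (by
      intro t _; simp))]
  refine intervalIntegral.integral_congr fun t ht => ?_
  rw [uIcc_of_le hab] at ht
  have hb := (hV.sol n).boundary t (hsub ht)
  simp only [fderiv_coord, hb]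
  have h1 := sum_coord_apply (fderiv ℝ U (uBε n t)) (f (uBε n t) - ε n • spaceDeriv (u n) 0 t)
  rw [map_sub, map_smul, smul_eq_mul] at h1
  have h2 : ∑ j, (f (uBε n t) j - ε n * spaceDeriv (u n) 0 t j)
      * (fderiv ℝ U (uBε n t) (EuclideanSpace.single j 1) * θ t)
      = (fderiv ℝ U (uBε n t) (f (uBε n t))
        - ε n * fderiv ℝ U (uBε n t) (spaceDeriv (u n) 0 t)) * θ t := by
    rw [← h1, Finset.sum_mul]
    exact Finset.sum_congr rfl fun j _ => by
      simp only [PiLp.sub_apply, PiLp.smul_apply, smul_eq_mul]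
      ring
  rw [h2]
  ring

section BoundaryMeasure

variable {κ₀ : Kernel ℝ (State N)}

/-- On the common compact support `g` agrees with a bounded continuous function on the whole space,
for which measurability of the kernel integral and a uniform bound are immediate. -/
theorem IsBoundaryYoungMeasure.exists_slice (hκ : IsBoundaryYoungMeasure 𝒰 κ₀)
    {g : State N → ℝ} (hg : ContinuousOn g 𝒰) :
    AEStronglyMeasurable (fun t => ∫ w, g w ∂(κ₀ t)) volHalf ∧
      ∃ C, ∀ t, 0 < t → |∫ w, g w ∂(κ₀ t)| ≤ C := by
  obtain ⟨K, hK, hKU, hsupp⟩ := hκ.support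
  have := hκ.markov
  obtain ⟨g', hg'⟩ := exists_boundedContinuous_eqOn hK (hg.mono hKU)
  have heq : ∀ t, 0 < t → ∫ w, g' w ∂(κ₀ t) = ∫ w, g w ∂(κ₀ t) := fun t ht =>
    integral_congr_of_eqOn (hsupp t ht) hg'
  refine ⟨((g'.continuous.measurable.stronglyMeasurable.integral_kernel
    (κ := κ₀)).aestronglyMeasurable).congr ?_, ‖g'‖, fun t ht => ?_⟩
  · filter_upwards [ae_restrict_mem measurableSet_Ioi] with t ht using heq t ht
  · rw [← heq t ht]
    exact boundedContinuous_abs_integral_le g'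

theorem IsBoundaryYoungMeasure.intervalIntegrable (hκ : IsBoundaryYoungMeasure 𝒰 κ₀)
    {g : State N → ℝ} (hg : ContinuousOn g 𝒰) {θ : ℝ → ℝ} {T₁ T₂ : ℝ} (h0 : 0 ≤ T₁)
    (h : T₁ ≤ T₂) (hθ : IntegrableOn θ (Ioc T₁ T₂)) :
    IntervalIntegrable (fun t => (∫ w, g w ∂(κ₀ t)) * θ t) volume T₁ T₂ := by
  obtain ⟨hm, C, hC⟩ := hκ.exists_slice hg
  have hsub : Ioc T₁ T₂ ⊆ Ioi 0 := fun t ht => h0.trans_lt ht.1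
  rw [intervalIntegrable_iff_integrableOn_Ioc_of_le h]
  refine Integrable.bdd_mul (c := C) hθ (hm.mono_set hsub) ?_
  filter_upwards [ae_restrict_mem measurableSet_Ioc] with t ht using hC t (hsub ht)

theorem IsBoundaryYoungMeasure.integrable {E : Type*} [NormedAddCommGroup E]
    (hκ : IsBoundaryYoungMeasure 𝒰 κ₀) {g : State N → E} (hg : ContinuousOn g 𝒰)
    {t : ℝ} (ht : 0 < t) : Integrable g (κ₀ t) := by
  obtain ⟨K, hK, hKU, hsupp⟩ := hκ.support
  have := hκ.markov
  have h1 : IntegrableOn g K (κ₀ t) := (hg.mono hKU).integrableOn_compact hK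
  rwa [IntegrableOn, Measure.restrict_eq_self_of_ae_mem] at h1
  filter_upwards [measure_eq_zero_iff_ae_notMem.1 (hsupp t ht)] with z hz using not_not.1 hz

end BoundaryMeasure

/-- Limit of the viscous flux at the boundary. -/
theorem ViscousFamily.tendsto_boundary_flux (hV : ViscousFamily 𝒰 K f ε uIε uBε u)
    (hD : BoundaryData uBε uB) (hν : IsYoungMeasure 𝒰 (fun n p => u n p.1 p.2) ν)
    {ν₀ : Kernel ℝ (State N)} (hν₀ : IsFluxTrace 𝒰 f ν ν₀)
    (hUF : IsEntropyPair 𝒰 f U F) {θ : ℝ → ℝ} (hθ : IsBV θ) {T₁ T₂ : ℝ} (h0 : 0 ≤ T₁)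
    (h : T₁ < T₂) :
    Tendsto (fun n => viscFlux (ε n) (u n) U F θ (windowStart T₁ T₂ n) T₂ 0) atTop
      (𝓝 (∫ t in T₁..T₂,
        (F (uB t) + fderiv ℝ U (uB t) ((∫ w, f w ∂(ν₀ t)) - f (uB t))) * θ t)) := by
  obtain ⟨M, hM⟩ := hθ.exists_testSeq h0 h
  have hq := fun j : Fin N => contDiffOn_fderiv_apply hV.isOpen hUF.contDiffOn_entropy
    (EuclideanSpace.single j 1)
  have hfc : ∀ j, ContinuousOn (fun w => f w j) 𝒰 := fun j =>
    (isConvexEntropyPair_coord hV.isOpen hV.smooth j).contDiffOn_flux.continuousOn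
  have hR := continuousOn_boundaryFlux hV.isOpen hV.smooth hUF
  have h1 := hV.tendsto_integral_boundary hD hR hM
  -- The limit weight `∂ⱼU(u_B) θ` has bounded variation but no definite sign; the trace of `ν` may
  -- still be tested with it.
  have h2 : ∀ j ∈ Finset.univ, Tendsto (fun n => viscFlux (ε n) (u n) (fun w => w j)
      (fun w => f w j) (fun t => fderiv ℝ U (uBε n t) (EuclideanSpace.single j 1) * θ t)
      (windowStart T₁ T₂ n) T₂ 0) atTop (𝓝 (∫ t in T₁..T₂, (∫ w, f w j ∂(ν₀ t))
        * (fderiv ℝ U (uB t) (EuclideanSpace.single j 1) * θ t))) := fun j _ => by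
    obtain ⟨M', hM'⟩ := hV.exists_testSeq_boundary hD (hq j) hθ h0 h
    exact hV.tendsto_boundary_coord hν hν₀ j hM' (hV.isBV_boundary_mul hD (hq j) hθ)
  have h3 := h1.add (tendsto_finsetSum _ h2)
  have hi : ∀ j ∈ Finset.univ, IntervalIntegrable (fun t => (∫ w, f w j ∂(ν₀ t))
      * (fderiv ℝ U (uB t) (EuclideanSpace.single j 1) * θ t)) volume T₁ T₂ := fun j _ =>
    hν₀.toIsBoundaryYoungMeasure.intervalIntegrable (hfc j) h0 h.le
      ((hV.isBV_boundary_mul hD (hq j) hθ).integrableOn h0)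
  have hlim : (∫ t in T₁..T₂, (F (uB t) - fderiv ℝ U (uB t) (f (uB t))) * θ t)
      + ∑ j, ∫ t in T₁..T₂, (∫ w, f w j ∂(ν₀ t))
        * (fderiv ℝ U (uB t) (EuclideanSpace.single j 1) * θ t)
      = ∫ t in T₁..T₂,
        (F (uB t) + fderiv ℝ U (uB t) ((∫ w, f w ∂(ν₀ t)) - f (uB t))) * θ t := by
    rw [← intervalIntegral.integral_finsetSum hi, ← intervalIntegral.integral_add
      (hV.intervalIntegrable_boundary hD hR h0 h.le (hθ.integrableOn h0))
      (IntervalIntegrable.sum _ hi |>.congr (by intro t _; simp))]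
    refine intervalIntegral.integral_congr_ae (ae_of_all _ fun t ht => ?_)
    rw [uIoc_of_le h.le] at ht
    have ht0 : 0 < t := h0.trans_lt ht.1
    have hfi : Integrable f (ν₀ t) :=
      hν₀.toIsBoundaryYoungMeasure.integrable hV.smooth.continuousOn ht0
    have hj : ∀ j, ∫ w, f w j ∂(ν₀ t) = (∫ w, f w ∂(ν₀ t)) j := fun j =>
      (EuclideanSpace.proj (𝕜 := ℝ) j).integral_comp_comm hfi
    simp only [hj]
    have h4 := sum_coord_apply (fderiv ℝ U (uB t)) (∫ w, f w ∂(ν₀ t))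
    have h5 : ∑ j, (∫ w, f w ∂(ν₀ t)) j * (fderiv ℝ U (uB t) (EuclideanSpace.single j 1) * θ t)
        = fderiv ℝ U (uB t) (∫ w, f w ∂(ν₀ t)) * θ t := by
      rw [← h4, Finset.sum_mul]
      exact Finset.sum_congr rfl fun j _ => by ring
    rw [h5, map_sub]
    ring
  rw [hlim] at h3
  refine h3.congr fun n => ?_
  rw [hV.viscFlux_zero hUF n (hM.pos n) (hM.mem n).2.le (hM.pairing n).integrable]

/-- The layer flux lies between the boundary flux and the trace of the interior flux. -/
theorem ViscousFamily.exists_layer_bounds (hV : ViscousFamily 𝒰 K f ε uIε uBε u)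
    (hD : BoundaryData uBε uB) (hν : IsYoungMeasure 𝒰 (fun n p => u n p.1 p.2) ν)
    (hμ : IsYoungMeasure 𝒰 (fun n p => u n (ε n * p.1) p.2) μ)
    {ν₀ : Kernel ℝ (State N)} (hν₀ : IsFluxTrace 𝒰 f ν ν₀)
    (hUF : IsConvexEntropyPair 𝒰 f U F) {θ : ℝ → ℝ} (hθ : IsBV θ) (hpos : ∀ t, 0 < t → 0 ≤ θ t)
    {T₁ T₂ : ℝ} (h0 : 0 ≤ T₁) (h : T₁ < T₂) :
    ∃ G : ℝ → ℝ, AlmostAntitone G 0 ∧ IsLayerFlux μ U F θ T₁ T₂ G ∧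
      (∀ y, 0 < y → G y ≤ ∫ t in T₁..T₂,
        (F (uB t) + fderiv ℝ U (uB t) ((∫ w, f w ∂(ν₀ t)) - f (uB t))) * θ t) ∧
      ∀ y, 0 < y → ∫ t in T₁..T₂, (∫ w, F w ∂(ν₀ t)) * θ t ≤ G y := by
  obtain ⟨M, hM⟩ := hθ.exists_testSeq h0 h
  obtain ⟨B, -, hB⟩ := hV.exists_bound hUF.contDiffOn_entropy.continuousOn
  have hs := hUF.hessian_mul_nonneg hpos
  obtain ⟨G, hG, hGp, hGL⟩ := hV.exists_layer_flux hμ hUF.toIsEntropyPair hM hs hB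
  obtain ⟨g, -, hgp, hgae, -⟩ := hV.exists_interior_flux hν hUF.toIsEntropyPair hM hs hB
  have hle : ∀ n x y, 0 ≤ x → x ≤ y →
      viscFlux (ε n) (u n) U F θ (windowStart T₁ T₂ n) T₂ y
        ≤ viscFlux (ε n) (u n) U F θ (windowStart T₁ T₂ n) T₂ x + M * B * (y - x) :=
    fun n x y hx hxy => (hV.sol n).viscFlux_le hV.isOpen (hV.eps_pos n)
      (hV.smooth.differentiableOn (by simp)) hUF.toIsEntropyPair (hM.pos n) (hM.mem n).2.le
      (hM.pairing n) (fun w hw z t ht => hs n w hw z t ((hM.pos n).trans_le ht.1))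
      (fun x t hx ht => hB _ (hV.mem n x t hx ht)) hx hxy
  refine ⟨G, hG, hGL, fun y hy => ?_, fun y hy => ?_⟩
  -- Upper bound: the flux at `ε y` is compared with the flux at the wall, at a cost `M * B * ε * y`
  -- that vanishes.
  · refine le_of_ae_le_of_right_continuous hG.right_continuous ?_ hy
    filter_upwards [hGp, ae_restrict_mem measurableSet_Ioi] with y hlim hy
    have h1 := hV.tendsto_boundary_flux hD hν hν₀ hUF.toIsEntropyPair hθ h0 h
    have h2 : Tendsto (fun n => M * B * (ε n * y - 0)) atTop (𝓝 (M * B * (0 * y - 0))) :=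
      ((hV.eps_tendsto.mul_const y).sub_const 0).const_mul _
    have h3 := h1.add h2
    rw [zero_mul, sub_zero, mul_zero, add_zero] at h3
    exact le_of_tendsto_of_tendsto' hlim h3 fun n =>
      hle n 0 (ε n * y) le_rfl (mul_nonneg (hV.eps_pos n).le (le_of_lt hy))
  -- Lower bound: for fixed `x > 0` one has `ε y < x` eventually, so the flux at `x` is at most the
  -- layer flux plus `M * B * x` in the limit `n → ∞`; then `x → 0`.
  · refine ge_of_ae_ge_of_right_continuous hG.right_continuous ?_ hy
    filter_upwards [hGp, ae_restrict_mem measurableSet_Ioi] with y hlim hy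
    have htr := hν₀.trace U F hUF θ hθ T₁ T₂ h0 h
    have hlin : Tendsto (fun x : ℝ => G y + M * B * x) (𝓝[>] (0 : ℝ) ⊓ ae volume)
        (𝓝 (G y + M * B * 0)) :=
      ((by fun_prop : Continuous fun x : ℝ => G y + M * B * x).tendsto 0).mono_left
        (inf_le_left.trans nhdsWithin_le_nhds)
    rw [mul_zero, add_zero] at hlin
    refine le_of_tendsto_of_tendsto htr hlin ?_
    refine eventually_traceFilter ?_
    filter_upwards [hgp, hgae, ae_restrict_mem measurableSet_Ioi] with x hx1 hx2 hx
    rw [hx2]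
    have h2 : Tendsto (fun n => ε n * y) atTop (𝓝 (0 * y)) := hV.eps_tendsto.mul_const y
    have h3 : Tendsto (fun n => M * B * (x - ε n * y)) atTop (𝓝 (M * B * (x - 0 * y))) :=
      (h2.const_sub x).const_mul _
    have h4 := hlim.add h3
    rw [zero_mul, sub_zero] at h4
    rw [zero_mul] at h2
    refine le_of_tendsto_of_tendsto hx1 h4 ?_
    filter_upwards [h2.eventually (gt_mem_nhds (show (0 : ℝ) < x from hx))] with n hn
    exact hle n (ε n * y) x (mul_nonneg (hV.eps_pos n).le (le_of_lt hy)) hn.le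

end BoundaryLayer

/-! ### The layer takes the boundary datum -/

namespace BoundaryLayer

variable {N : ℕ} {𝒰 K : Set (State N)} {f : State N → State N} {ε : ℕ → ℝ}
  {uIε uBε : ℕ → ℝ → State N} {uB : ℝ → State N} {u : ℕ → ℝ → ℝ → State N}
  {U F : State N → ℝ} {ν μ : Kernel (ℝ × ℝ) (State N)}

theorem ViscousFamily.abs_solAvg_le (hV : ViscousFamily 𝒰 K f ε uIε uBε u) {g : State N → ℝ}
    {B A : ℝ} (hB0 : 0 ≤ B) (hB : ∀ z ∈ K, |g z| ≤ B) {θ : ℝ → ℝ} (hA : ∀ t, 0 < t → |θ t| ≤ A)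
    (n : ℕ) {a T₁ T₂ : ℝ} (h0 : 0 ≤ T₁) (ha : a ∈ Ioo T₁ T₂) {x : ℝ} (hx : 0 ≤ x) :
    |solAvg (u n) g θ a T₂ x| ≤ B * A * (T₂ - T₁) := by
  have hA0 : 0 ≤ A := (abs_nonneg _).trans (hA 1 one_pos)
  have h1 : ‖∫ t in a..T₂, g (u n x t) * θ t‖ ≤ B * A * |T₂ - a| := by
    refine intervalIntegral.norm_integral_le_of_norm_le_const fun t ht => ?_
    rw [uIoc_of_le ha.2.le] at ht
    have ht0 : 0 < t := h0.trans_lt (ha.1.trans ht.1)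
    rw [norm_mul]
    exact mul_le_mul (hB _ (hV.mem n x t hx ht0.le)) (hA t ht0) (norm_nonneg _) hB0
  refine h1.trans ?_
  rw [abs_of_pos (sub_pos.2 ha.2)]
  gcongr
  exact ha.1.le

/-- The rescaled entropy averages are Lipschitz at the boundary, uniformly in `n`. -/
theorem ViscousFamily.exists_solAvg_sub_le (hV : ViscousFamily 𝒰 K f ε uIε uBε u)
    (hD : BoundaryData uBε uB) (hν : IsYoungMeasure 𝒰 (fun n p => u n p.1 p.2) ν)
    (hUF : IsConvexEntropyPair 𝒰 f U F) {θ : ℝ → ℝ} (hθ : IsBV θ) (hpos : ∀ t, 0 < t → 0 ≤ θ t)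
    {T₁ T₂ : ℝ} (h0 : 0 ≤ T₁) (h : T₁ < T₂) :
    ∃ D, ∀ n, ∀ y ∈ Ioo (0 : ℝ) 1, |solAvg (u n) U θ (windowStart T₁ T₂ n) T₂ (ε n * y)
      - solAvg (u n) U θ (windowStart T₁ T₂ n) T₂ 0| ≤ D * y := by
  obtain ⟨M, hM⟩ := hθ.exists_testSeq h0 h
  obtain ⟨A, hA⟩ := hθ.bounded
  obtain ⟨B, hB0, hB⟩ := hV.exists_bound hUF.contDiffOn_entropy.continuousOn
  obtain ⟨B', hB0', hB'⟩ := hV.exists_bound hUF.contDiffOn_flux.continuousOn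
  -- The trace is auxiliary here: it serves to know that the fluxes at the wall converge, hence are
  -- bounded.
  obtain ⟨ν₀, hν₀⟩ := hV.exists_fluxTrace hν
  obtain ⟨P, hP⟩ := (hV.tendsto_boundary_flux hD hν hν₀ hUF.toIsEntropyPair hθ h0 h).bddAbove_range
  obtain ⟨E, hE⟩ := hV.eps_tendsto.bddAbove_range
  have hP : ∀ n, viscFlux (ε n) (u n) U F θ (windowStart T₁ T₂ n) T₂ 0 ≤ P := fun n =>
    hP (mem_range_self n)
  have hE : ∀ n, ε n ≤ E := fun n => hE (mem_range_self n)
  have hs := hUF.hessian_mul_nonneg hpos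
  have hle : ∀ n x y, 0 ≤ x → x ≤ y →
      viscFlux (ε n) (u n) U F θ (windowStart T₁ T₂ n) T₂ (ε n * y)
        ≤ viscFlux (ε n) (u n) U F θ (windowStart T₁ T₂ n) T₂ (ε n * x)
          + |M * B| * E * (y - x) := by
    intro n x y hx hxy
    refine ((hV.sol n).viscFlux_le hV.isOpen (hV.eps_pos n)
      (hV.smooth.differentiableOn (by simp)) hUF.toIsEntropyPair (hM.pos n) (hM.mem n).2.le
      (hM.pairing n) (fun w hw z t ht => hs n w hw z t ((hM.pos n).trans_le ht.1))
      (fun x t hx ht => hB _ (hV.mem n x t hx ht)) (mul_nonneg (hV.eps_pos n).le hx)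
      (mul_le_mul_of_nonneg_left hxy (hV.eps_pos n).le)).trans ?_
    rw [← mul_sub, ← mul_assoc]
    have h1 : 0 ≤ y - x := sub_nonneg.2 hxy
    have h2 := (hV.eps_pos n).le
    gcongr
    · exact le_abs_self _
    · exact hE n
  have hder : ∀ n y, 0 < y → HasDerivAt
      (fun y => solAvg (u n) U θ (windowStart T₁ T₂ n) T₂ (ε n * y))
      (solAvg (u n) F θ (windowStart T₁ T₂ n) T₂ (ε n * y)
        - viscFlux (ε n) (u n) U F θ (windowStart T₁ T₂ n) T₂ (ε n * y)) y := by
    intro n y hy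
    have hε := (hV.eps_pos n).ne'
    have h1 := ((hV.sol n).hasDerivAt_solAvg hV.isOpen hε hUF.toIsEntropyPair (hM.pos n)
      (hM.mem n).2.le (hM.pairing n).integrable (mul_pos (hV.eps_pos n) hy)).comp y
      ((hasDerivAt_id y).const_mul (ε n))
    refine h1.congr_deriv ?_
    simp only [mul_one]
    field_simp
  have hcont : ∀ n, ContinuousOn
      (fun y => solAvg (u n) U θ (windowStart T₁ T₂ n) T₂ (ε n * y)) (Ici 0) := fun n =>
    ((hV.sol n).continuousOn_solAvg hUF.contDiffOn_entropy.continuousOn (hM.pos n)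
      (hM.mem n).2.le (hM.pairing n).integrable).comp (by fun_prop) fun y hy =>
        mul_nonneg (hV.eps_pos n).le hy
  have hbU := fun n x (hx : (0 : ℝ) ≤ x) => hV.abs_solAvg_le hB0 hB hA n h0 (hM.mem n)
    (mul_nonneg (hV.eps_pos n).le hx)
  have hbF := fun n x (hx : (0 : ℝ) ≤ x) => hV.abs_solAvg_le hB0' hB' hA n h0 (hM.mem n)
    (mul_nonneg (hV.eps_pos n).le hx)
  set CU := B * A * (T₂ - T₁) with hCU
  set CF := B' * A * (T₂ - T₁) with hCF
  have hME : 0 ≤ |M * B| * E := mul_nonneg (abs_nonneg _) ((hV.eps_pos 0).le.trans (hE 0))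
  refine ⟨2 * CF + 2 * CU + 2 * (|M * B| * E) + |P|, fun n y hy => ?_⟩
  obtain ⟨c, hc, hceq⟩ := exists_hasDerivAt_eq_slope
    (fun y => solAvg (u n) U θ (windowStart T₁ T₂ n) T₂ (ε n * y)) _ hy.1
    ((hcont n).mono fun z hz => hz.1) fun z hz => hder n z hz.1
  -- The slope at `c` is the `F`-average minus the flux. The flux is bounded above through its value
  -- at the wall. For a lower bound, the mean value theorem on `(1, 2)` gives a point `d` where the
  -- slope is at most `2 * CU` in absolute value, so the flux at `d` is bounded below, and almost
  -- monotonicity carries this back to `c < d`.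
  obtain ⟨d, hd, hdeq⟩ := exists_hasDerivAt_eq_slope
    (fun y => solAvg (u n) U θ (windowStart T₁ T₂ n) T₂ (ε n * y)) _ (one_lt_two (α := ℝ))
    ((hcont n).mono fun z hz => zero_le_one.trans hz.1)
    fun z hz => hder n z (one_pos.trans hz.1)
  have hd0 : 0 < d := one_pos.trans hd.1
  rw [eq_div_iff (by linarith [hy.1])] at hceq
  simp only [mul_zero, sub_zero] at hceq
  rw [← hceq, abs_mul, abs_of_pos hy.1]
  refine mul_le_mul_of_nonneg_right ?_ hy.1.le
  have e1 := hle n 0 c le_rfl hc.1.le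
  rw [mul_zero, sub_zero] at e1
  have e2 := hle n c d hc.1.le (by linarith [hc.2, hy.2, hd.1])
  have e3 := mul_le_mul_of_nonneg_left (show d - c ≤ 2 by linarith [hd.2, hc.1]) hME
  have e4 := mul_le_mul_of_nonneg_left (show c ≤ 2 by linarith [hc.2, hy.2]) hME
  have e5 := abs_le.1 (hbU n 1 zero_le_one)
  have e6 := abs_le.1 (hbU n 2 zero_le_two)
  have e7 := abs_le.1 (hbF n c hc.1.le)
  have e8 := abs_le.1 (hbF n d hd0.le)
  have e9 := hP n
  have e10 := le_abs_self P
  have e11 := abs_nonneg P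
  norm_num at hdeq
  rw [mul_one] at e5
  rw [abs_le]
  constructor <;> linarith

/-- Pointwise upper bounds survive weak limits: they are integrated over arbitrary measurable
subsets of `(0, 1)`, whose indicators are admissible tests. -/
theorem ae_le_of_tendsto_integral {k : ℕ → ℝ → ℝ} {κ : ℝ → ℝ} {c : ℕ → ℝ} {c₀ D : ℝ}
    (hk : ∀ n, ContinuousOn (k n) (Icc 0 1)) (hκ : IntegrableOn κ (Ioo 0 1))
    (hc : Tendsto c atTop (𝓝 c₀))
    (hlim : ∀ φ, Integrable φ volHalf → Tendsto (fun n => ∫ y in Ioi 0, k n y * φ y) atTop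
      (𝓝 (∫ y in Ioi 0, κ y * φ y)))
    (hle : ∀ n, ∀ y ∈ Ioo (0 : ℝ) 1, k n y ≤ c n + D * y) :
    ∀ᵐ y ∂volume.restrict (Ioo (0 : ℝ) 1), κ y ≤ c₀ + D * y := by
  have hlin : ∀ b : ℝ, IntegrableOn (fun y : ℝ => b + D * y) (Ioo 0 1) := fun b =>
    ((by fun_prop : Continuous fun y : ℝ => b + D * y).continuousOn.integrableOn_compact
      isCompact_Icc).mono_set Ioo_subset_Icc_self
  refine ae_le_of_forall_setIntegral_le hκ (hlin c₀) fun s hs _ => ?_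
  rw [Measure.restrict_restrict hs]
  set S := s ∩ Ioo (0 : ℝ) 1 with hS
  have hSm : MeasurableSet S := hs.inter measurableSet_Ioo
  have hS0 : S ⊆ Ioo 0 1 := inter_subset_right
  have hSI : S ⊆ Ioi 0 := fun y hy => (hS0 hy).1
  have hfin : volume S ≠ ⊤ := ((measure_mono hS0).trans_lt measure_Ioo_lt_top).ne
  have hconv : ∀ p : ℝ → ℝ, ∫ y in Ioi 0, p y * S.indicator (fun _ => (1 : ℝ)) y
      = ∫ y in S, p y := fun p => by
    rw [← inter_eq_self_of_subset_left hSI, ← Measure.restrict_restrict hSm,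
      ← integral_indicator hSm, inter_eq_self_of_subset_left hSI]
    refine integral_congr_ae (ae_of_all _ fun y => ?_)
    by_cases hy : y ∈ S <;> simp [hy]
  have h1 := hlim (S.indicator fun _ => (1 : ℝ)) (by
    rw [integrable_indicator_iff hSm, IntegrableOn, Measure.restrict_restrict hSm,
      inter_eq_self_of_subset_left hSI]
    exact integrableOn_const hfin)
  simp only [hconv] at h1
  have hsplit : ∀ b : ℝ, ∫ y in S, (b + D * y) = volume.real S * b + ∫ y in S, D * y := fun b => by
    have i1 : Integrable (fun _ : ℝ => b) (volume.restrict S) := integrableOn_const hfin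
    have i2 : IntegrableOn (fun y : ℝ => D * y) S := by
      simpa only [zero_add] using (hlin 0).mono_set hS0
    rw [integral_add i1 i2, setIntegral_const, smul_eq_mul]
  have h2 : Tendsto (fun n => ∫ y in S, (c n + D * y)) atTop (𝓝 (∫ y in S, (c₀ + D * y))) := by
    simp only [hsplit]
    exact (hc.const_mul _).add_const _
  exact le_of_tendsto_of_tendsto' h1 h2 fun n => setIntegral_mono_on
    (((hk n).integrableOn_compact isCompact_Icc).mono_set (hS0.trans Ioo_subset_Icc_self))
    ((hlin (c n)).mono_set hS0) hSm fun y hy => hle n y (hS0 hy)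

/-- The two inequalities in `|avg(y) - avg(0)| ≤ D y` pass to the weak limit separately, and the
averages at `y = 0` converge to that of `U(u_B)` because the solutions take their boundary data
there. -/
theorem ViscousFamily.tendsto_entropy_of_nonneg (hV : ViscousFamily 𝒰 K f ε uIε uBε u)
    (hD : BoundaryData uBε uB) (hν : IsYoungMeasure 𝒰 (fun n p => u n p.1 p.2) ν)
    (hμ : IsYoungMeasure 𝒰 (fun n p => u n (ε n * p.1) p.2) μ)
    (hUF : IsConvexEntropyPair 𝒰 f U F) {θ : ℝ → ℝ} (hθ : IsBV θ) (hpos : ∀ t, 0 < t → 0 ≤ θ t)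
    {T₁ T₂ : ℝ} (h0 : 0 ≤ T₁) (h : T₁ < T₂) :
    Tendsto (timeAvg μ U θ T₁ T₂) (𝓝[>] 0 ⊓ ae volume)
      (𝓝 (∫ t in T₁..T₂, U (uB t) * θ t)) := by
  have hUc := hUF.contDiffOn_entropy.continuousOn
  obtain ⟨D, hDn⟩ := hV.exists_solAvg_sub_le hD hν hUF hθ hpos h0 h
  obtain ⟨M, hM⟩ := hθ.exists_testSeq h0 h
  obtain ⟨B, -, hB⟩ := hV.exists_bound hUc
  have hc : Tendsto (fun n => solAvg (u n) U θ (windowStart T₁ T₂ n) T₂ 0) atTop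
      (𝓝 (∫ t in T₁..T₂, U (uB t) * θ t)) := by
    refine (hV.tendsto_integral_boundary hD hUc hM).congr fun n => ?_
    refine intervalIntegral.integral_congr fun t ht => ?_
    rw [uIcc_of_le (hM.mem n).2.le] at ht
    simp only [(hV.sol n).boundary t ((hM.pos n).trans_le ht.1)]
  have hcont : ∀ n, ContinuousOn
      (fun y => solAvg (u n) U θ (windowStart T₁ T₂ n) T₂ (ε n * y)) (Icc 0 1) := fun n =>
    ((hV.sol n).continuousOn_solAvg hUc (hM.pos n) (hM.mem n).2.le
      (hM.pairing n).integrable).comp (by fun_prop) fun y hy =>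
        mul_nonneg (hV.eps_pos n).le hy.1
  have hlim := fun φ (hφ : Integrable φ volHalf) => hM.tendsto_solAvg hV.eps_pos hμ hUc
    (fun n x t hx ht => hB _ (hV.mem n x t hx ht)) hφ
  have h_int : IntegrableOn (timeAvg μ U θ T₁ T₂) (Ioo 0 1) := by
    obtain ⟨C, -, hC⟩ := hμ.exists_slice_bound hUc
    have hsub : Ioo (0 : ℝ) 1 ⊆ Ioi 0 := fun y hy => hy.1
    refine Integrable.mono' (g := fun _ => C * ∫ t in T₁..T₂, |θ t|)
      (integrableOn_const measure_Ioo_lt_top.ne)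
      ((hμ.aestronglyMeasurable_timeAvg hUc h0 h.le hM.integrableOn).mono_set hsub) ?_
    filter_upwards [ae_restrict_of_ae_restrict_of_subset hsub hC] with z hz
    exact (hz θ T₁ T₂ h0 h.le hM.integrableOn).2
  have h1 := ae_le_of_tendsto_integral (D := D) hcont h_int hc hlim fun n y hy => by
    linarith [(abs_le.1 (hDn n y hy)).2]
  have h2 := ae_le_of_tendsto_integral (D := D) (fun n => (hcont n).neg) h_int.neg hc.neg
    (fun φ hφ => by simpa only [Pi.neg_apply, neg_mul, integral_neg] using (hlim φ hφ).neg)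
    fun n y hy => by
      rw [Pi.neg_apply]
      linarith [(abs_le.1 (hDn n y hy)).1]
  rw [ae_restrict_iff' measurableSet_Ioo] at h1 h2
  have h3 : Tendsto (fun y : ℝ => D * y) (𝓝[>] 0 ⊓ ae volume) (𝓝 0) := by
    have := ((by fun_prop : Continuous fun y : ℝ => D * y).tendsto 0).mono_left
      (inf_le_left.trans nhdsWithin_le_nhds : 𝓝[>] (0 : ℝ) ⊓ ae volume ≤ 𝓝 0)
    rwa [mul_zero] at this
  rw [← tendsto_sub_nhds_zero_iff]
  refine squeeze_zero_norm' ?_ h3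
  filter_upwards [(inf_le_left : 𝓝[>] (0 : ℝ) ⊓ ae volume ≤ _)
    (Ioo_mem_nhdsGT (one_pos (α := ℝ))), (inf_le_right : 𝓝[>] (0 : ℝ) ⊓ ae volume ≤ _) h1,
    (inf_le_right : 𝓝[>] (0 : ℝ) ⊓ ae volume ≤ _) h2] with y hy hy1 hy2
  have := hy1 hy
  have := hy2 hy
  rw [Real.norm_eq_abs, abs_le]
  simp only [Pi.neg_apply] at *
  constructor <;> linarith

/-- The entropy averages in the layer take the boundary datum. -/
theorem ViscousFamily.tendsto_entropy (hV : ViscousFamily 𝒰 K f ε uIε uBε u)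
    (hD : BoundaryData uBε uB) (hν : IsYoungMeasure 𝒰 (fun n p => u n p.1 p.2) ν)
    (hμ : IsYoungMeasure 𝒰 (fun n p => u n (ε n * p.1) p.2) μ)
    (hUF : IsConvexEntropyPair 𝒰 f U F) {θ : ℝ → ℝ} (hθ : IsBV θ)
    {T₁ T₂ : ℝ} (h0 : 0 ≤ T₁) (h : T₁ < T₂) :
    Tendsto (timeAvg μ U θ T₁ T₂) (𝓝[>] 0 ⊓ ae volume)
      (𝓝 (∫ t in T₁..T₂, U (uB t) * θ t)) := by
  have hUc := hUF.contDiffOn_entropy.continuousOn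
  obtain ⟨p, q, hp, hq, hp0, hq0, rfl⟩ := hθ.exists_eq_sub
  have h1 := (hV.tendsto_entropy_of_nonneg hD hν hμ hUF hp hp0 h0 h).sub
    (hV.tendsto_entropy_of_nonneg hD hν hμ hUF hq hq0 h0 h)
  rw [← intervalIntegral.integral_sub
    (hV.intervalIntegrable_boundary hD hUc h0 h.le (hp.integrableOn h0))
    (hV.intervalIntegrable_boundary hD hUc h0 h.le (hq.integrableOn h0))] at h1
  simp only [← mul_sub] at h1
  refine h1.congr' ?_
  filter_upwards [eventually_traceFilter (hμ.timeAvg_sub_ae hUc h0 h.le (hp.integrableOn h0)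
    (hq.integrableOn h0))] with y hy using hy.symm

end BoundaryLayer

/-! ### Layer flux for signed weights, and uniqueness of the entropy trace -/

namespace BoundaryLayer

variable {N : ℕ} {𝒰 K : Set (State N)} {f : State N → State N} {ε : ℕ → ℝ}
  {uIε uBε : ℕ → ℝ → State N} {uB : ℝ → State N} {u : ℕ → ℝ → ℝ → State N}
  {U F : State N → ℝ} {ν μ : Kernel (ℝ × ℝ) (State N)}

theorem IsLayerFlux.sub {w : ℕ → ℝ × ℝ → State N} (hμ : IsYoungMeasure 𝒰 w μ)
    (hU : ContinuousOn U 𝒰) (hF : ContinuousOn F 𝒰) {p q G H : ℝ → ℝ} {T₁ T₂ : ℝ} (h0 : 0 ≤ T₁)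
    (h : T₁ < T₂) (hp : IsBV p) (hq : IsBV q) (hG : LocallyIntegrableOn G (Ioi 0))
    (hH : LocallyIntegrableOn H (Ioi 0))
    (hpG : IsLayerFlux μ U F p T₁ T₂ G) (hqH : IsLayerFlux μ U F q T₁ T₂ H) :
    IsLayerFlux μ U F (fun t => p t - q t) T₁ T₂ fun y => G y - H y := by
  intro φ h1 h2 h3
  have hφ : IsTest (Ioi 0) φ := ⟨h1, h2, h3⟩
  have hφi : Integrable φ volHalf :=
    (h1.continuous.integrable_of_hasCompactSupport h2).integrableOn
  have hφi' : Integrable (deriv φ) volHalf :=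
    ((h1.continuous_deriv (by norm_num)).integrable_of_hasCompactSupport h2.deriv).integrableOn
  have hi : ∀ {θ : ℝ → ℝ}, IsBV θ → Integrable
      (fun y => timeAvg μ F θ T₁ T₂ y * φ y + timeAvg μ U θ T₁ T₂ y * deriv φ y) volHalf :=
    fun hθ => (hμ.integrableOn_timeAvg_mul hF h0 h.le (hθ.integrableOn h0) hφi).add
      (hμ.integrableOn_timeAvg_mul hU h0 h.le (hθ.integrableOn h0) hφi')
  simp only [sub_mul]
  rw [integral_sub (hφ.integrableOn_mul hG) (hφ.integrableOn_mul hH), ← hpG φ h1 h2 h3,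
    ← hqH φ h1 h2 h3, ← integral_sub (hi hp) (hi hq)]
  refine integral_congr_ae ?_
  filter_upwards [hμ.timeAvg_sub_ae hF h0 h.le (hp.integrableOn h0) (hq.integrableOn h0),
    hμ.timeAvg_sub_ae hU h0 h.le (hp.integrableOn h0) (hq.integrableOn h0)] with y hy1 hy2
  rw [hy1, hy2]
  ring

/-- For nonnegative weights the wall flux and the interior trace bound the antitone `G` from both
sides, which gives boundedness. A general weight is a difference of two nonnegative ones. -/
theorem ViscousFamily.exists_layer_isBV (hV : ViscousFamily 𝒰 K f ε uIε uBε u)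
    (hD : BoundaryData uBε uB) (hν : IsYoungMeasure 𝒰 (fun n p => u n p.1 p.2) ν)
    (hμ : IsYoungMeasure 𝒰 (fun n p => u n (ε n * p.1) p.2) μ)
    (hUF : IsConvexEntropyPair 𝒰 f U F) {θ : ℝ → ℝ} (hθ : IsBV θ)
    {T₁ T₂ : ℝ} (h0 : 0 ≤ T₁) (h : T₁ < T₂) :
    ∃ G : ℝ → ℝ, IsBV G ∧ IsLayerFlux μ U F θ T₁ T₂ G := by
  obtain ⟨ν₀, hν₀⟩ := hV.exists_fluxTrace hν
  have key : ∀ θ : ℝ → ℝ, IsBV θ → (∀ t, 0 < t → 0 ≤ θ t) → ∃ G : ℝ → ℝ, IsBV G ∧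
      LocallyIntegrableOn G (Ioi 0) ∧ IsLayerFlux μ U F θ T₁ T₂ G := by
    intro θ hθ hpos
    obtain ⟨G, hG, hGL, hup, hlow⟩ := hV.exists_layer_bounds hD hν hμ hν₀ hUF hθ hpos h0 h
    exact ⟨G, hG.isBV fun y hy => abs_le_max_abs_abs (hlow y hy) (hup y hy),
      hG.locallyIntegrableOn, hGL⟩
  obtain ⟨p, q, hp, hq, hp0, hq0, rfl⟩ := hθ.exists_eq_sub
  obtain ⟨G, hG, hGi, hGL⟩ := key p hp hp0
  obtain ⟨H, hH, hHi, hHL⟩ := key q hq hq0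
  exact ⟨_, hG.sub hH, hGL.sub hμ hUF.contDiffOn_entropy.continuousOn
    hUF.contDiffOn_flux.continuousOn h0 h hp hq hGi hHi hHL⟩

/-- The bounds on the layer flux, for every right continuous representative. -/
theorem ViscousFamily.layer_bounds (hV : ViscousFamily 𝒰 K f ε uIε uBε u)
    (hD : BoundaryData uBε uB) (hν : IsYoungMeasure 𝒰 (fun n p => u n p.1 p.2) ν)
    (hμ : IsYoungMeasure 𝒰 (fun n p => u n (ε n * p.1) p.2) μ)
    {ν₀ : Kernel ℝ (State N)} (hν₀ : IsFluxTrace 𝒰 f ν ν₀)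
    (hUF : IsConvexEntropyPair 𝒰 f U F) {θ : ℝ → ℝ} (hθ : IsBV θ) (hpos : ∀ t, 0 < t → 0 ≤ θ t)
    {T₁ T₂ : ℝ} (h0 : 0 ≤ T₁) (h : T₁ < T₂) {G : ℝ → ℝ} (hG : IsBV G)
    (hGL : IsLayerFlux μ U F θ T₁ T₂ G) :
    AntitoneOn G (Ioi 0) ∧
      (∀ y, 0 < y → G y ≤ ∫ t in T₁..T₂,
        (F (uB t) + fderiv ℝ U (uB t) ((∫ w, f w ∂(ν₀ t)) - f (uB t))) * θ t) ∧
      ∀ y, 0 < y → ∫ t in T₁..T₂, (∫ w, F w ∂(ν₀ t)) * θ t ≤ G y := by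
  obtain ⟨H, hH, hHL, hup, hlow⟩ := hV.exists_layer_bounds hD hν hμ hν₀ hUF hθ hpos h0 h
  have heq : ∀ y, 0 < y → G y = H y := fun y hy =>
    hGL.eq hHL hG (hH.isBV fun y hy => abs_le_max_abs_abs (hlow y hy) (hup y hy)) hy
  refine ⟨fun x hx y hy hxy => ?_, fun y hy => heq y hy ▸ hup y hy, fun y hy =>
    heq y hy ▸ hlow y hy⟩
  rw [heq x hx, heq y hy]
  simpa using hH.le x y hx hxy

theorem exists_tendsto_atTop_of_antitoneOn {G : ℝ → ℝ} (hG : AntitoneOn G (Ioi 0)) {c : ℝ}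
    (hc : ∀ y, 0 < y → c ≤ G y) : ∃ L, Tendsto G atTop (𝓝 L) ∧ c ≤ L := by
  have hanti : Antitone fun y => G (max y 1) := fun x y hxy =>
    hG (by simp : (0 : ℝ) < max x 1) (by simp : (0 : ℝ) < max y 1) (max_le_max_right 1 hxy)
  have h1 := tendsto_atTop_ciInf hanti ⟨c, by
    rintro _ ⟨y, rfl⟩
    exact hc _ (by simp)⟩
  refine ⟨_, h1.congr' ?_, le_ciInf fun y => hc _ (by simp)⟩
  filter_upwards [eventually_ge_atTop 1] with y hy
  rw [max_eq_left hy]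

/-- The boundary datum agrees almost everywhere with a measurable function with values in `K`. -/
theorem ViscousFamily.exists_measurable_boundary (hV : ViscousFamily 𝒰 K f ε uIε uBε u)
    (hD : BoundaryData uBε uB) :
    ∃ v : ℝ → State N, Measurable v ∧ (∀ t, v t ∈ K) ∧ v =ᵐ[volHalf] uB := by
  classical
  have hn : ∀ n, AEMeasurable (uBε n) volHalf := fun n =>
    ((((hV.sol n).contDiffOn_time le_rfl).continuousOn).congr fun t ht =>
      ((hV.sol n).boundary t ht).symm).aemeasurable measurableSet_Ioi
  have hm : AEMeasurable uB volHalf := aemeasurable_of_tendsto_metrizable_ae atTop hn hD.lim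
  obtain ⟨k, hk⟩ := hV.nonempty
  refine ⟨fun t => if hm.mk uB t ∈ K then hm.mk uB t else k, ?_, fun t => ?_, ?_⟩
  · exact Measurable.ite (hm.measurable_mk hV.compact.measurableSet) hm.measurable_mk
      measurable_const
  · by_cases h : hm.mk uB t ∈ K <;> simp [h, hk]
  · filter_upwards [hm.ae_eq_mk, ae_restrict_mem measurableSet_Ioi] with t ht ht0
    rw [← ht, if_pos (hV.boundary_limit_mem hD ht0)]

/-- The limits of the entropy averages are already known, so the Dirac mass at the boundary datum is
a trace; a measurable representative with values in `K` makes it a kernel carried by `K`. -/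
theorem ViscousFamily.exists_entropyTrace (hV : ViscousFamily 𝒰 K f ε uIε uBε u)
    (hD : BoundaryData uBε uB) (hν : IsYoungMeasure 𝒰 (fun n p => u n p.1 p.2) ν)
    (hμ : IsYoungMeasure 𝒰 (fun n p => u n (ε n * p.1) p.2) μ) :
    ∃ μ₀ : Kernel ℝ (State N), IsEntropyTrace 𝒰 f μ μ₀ := by
  obtain ⟨v, hv, hvK, hae⟩ := hV.exists_measurable_boundary hD
  refine ⟨Kernel.deterministic v hv, ⟨inferInstance, K, hV.compact, hV.subset, fun t _ => ?_⟩, ?_⟩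
  · rw [Kernel.deterministic_apply, Measure.dirac_apply' _ hV.compact.measurableSet.compl]
    simp [hvK t]
  · intro U F hUF θ hθ T₁ T₂ h0 h
    have h1 := hV.tendsto_entropy hD hν hμ hUF hθ h0 h
    have h2 : ∫ t in T₁..T₂, (∫ w, U w ∂(Kernel.deterministic v hv t)) * θ t
        = ∫ t in T₁..T₂, U (uB t) * θ t := by
      refine intervalIntegral.integral_congr_ae ?_
      rw [EventuallyEq, ae_restrict_iff' measurableSet_Ioi] at hae
      filter_upwards [hae] with t ht htm
      rw [uIoc_of_le h.le] at htm
      rw [Kernel.deterministic_apply, integral_dirac, ht (h0.trans_lt htm.1)]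
    rw [HasTraceOn, h2]
    exact h1

theorem IsTest.isBV {s : Set ℝ} {φ : ℝ → ℝ} (hφ : IsTest s φ) : IsBV φ where
  bounded := by
    obtain ⟨C, hC⟩ := hφ.compact.exists_bound_of_continuous hφ.smooth.continuous
    exact ⟨C, fun t _ => hC t⟩
  variation := fun T => by
    obtain ⟨C, hC⟩ := (hφ.smooth.of_le (m := 1) (by simp)).lipschitzWith_of_hasCompactSupport
      hφ.compact one_ne_zero
    have h1 := hC.locallyBoundedVariationOn univ 0 T trivial trivial
    exact h1.mono fun t ht => ⟨trivial, ht.1.le, ht.2.le⟩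
  right_continuous := fun t _ => hφ.smooth.continuous.continuousWithinAt

/-- A trace of `μ` integrates every convex entropy to its value at the boundary datum. -/
theorem ViscousFamily.integral_entropyTrace (hV : ViscousFamily 𝒰 K f ε uIε uBε u)
    (hD : BoundaryData uBε uB) (hν : IsYoungMeasure 𝒰 (fun n p => u n p.1 p.2) ν)
    (hμ : IsYoungMeasure 𝒰 (fun n p => u n (ε n * p.1) p.2) μ)
    {μ₀ : Kernel ℝ (State N)} (hμ₀ : IsEntropyTrace 𝒰 f μ μ₀)
    (hUF : IsConvexEntropyPair 𝒰 f U F) :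
    (fun t => ∫ w, U w ∂(μ₀ t)) =ᵐ[volHalf] fun t => U (uB t) := by
  have hUc := hUF.contDiffOn_entropy.continuousOn
  refine ae_eq_of_forall_test (locallyIntegrableOn_of_Ioc fun T hT => ?_)
    (locallyIntegrableOn_of_Ioc fun T hT => ?_) fun φ hφ => ?_
  · rw [← intervalIntegrable_iff_integrableOn_Ioc_of_le hT.le]
    simpa using hμ₀.toIsBoundaryYoungMeasure.intervalIntegrable hUc le_rfl hT.le
      ((isBV_const 1).integrableOn le_rfl)
  · rw [← intervalIntegrable_iff_integrableOn_Ioc_of_le hT.le]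
    simpa using hV.intervalIntegrable_boundary hD hUc le_rfl hT.le
      ((isBV_const 1).integrableOn le_rfl)
  · obtain ⟨a, b, ha, hab, hs⟩ := hφ.exists_Icc
    have hz : ∀ x, x ∉ Icc a b → φ x = 0 := fun x hx =>
      image_eq_zero_of_notMem_tsupport fun h' => hx (hs h')
    rw [setIntegral_Ioi_eq ha hab.le fun x hx => by rw [hz x hx, mul_zero],
      setIntegral_Ioi_eq ha hab.le fun x hx => by rw [hz x hx, mul_zero]]
    exact tendsto_nhds_unique (hμ₀.trace U F hUF φ hφ.isBV a b ha.le hab)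
      (hV.tendsto_entropy hD hν hμ hUF hφ.isBV ha.le hab)

theorem IsStrictlyConvexEntropyPair.toIsConvexEntropyPair
    (h : IsStrictlyConvexEntropyPair 𝒰 f U F) : IsConvexEntropyPair 𝒰 f U F :=
  { h with
    hessian_nonneg := fun z hz w => by
      rcases eq_or_ne w 0 with rfl | hw
      · simp
      · exact (h.hessian_pos z hz w hw).le }

/-- The increment of `g` is its slope at an interior point, and `g'` is strictly increasing. -/
theorem add_deriv_lt_of_deriv2_pos {g g' g'' : ℝ → ℝ}
    (h1 : ∀ s ∈ Icc (0 : ℝ) 1, HasDerivAt g (g' s) s)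
    (h2 : ∀ s ∈ Icc (0 : ℝ) 1, HasDerivAt g' (g'' s) s) (hpos : ∀ s ∈ Icc (0 : ℝ) 1, 0 < g'' s) :
    g 0 + g' 0 < g 1 := by
  have hmono : StrictMonoOn g' (Icc 0 1) := by
    refine strictMonoOn_of_deriv_pos (convex_Icc 0 1)
      (fun s hs => (h2 s hs).continuousAt.continuousWithinAt) fun s hs => ?_
    rw [(h2 s (interior_subset hs)).deriv]
    exact hpos s (interior_subset hs)
  obtain ⟨c, hc, hceq⟩ := exists_hasDerivAt_eq_slope g g' (zero_lt_one (α := ℝ))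
    (fun s hs => (h1 s hs).continuousAt.continuousWithinAt) fun s hs => h1 s ⟨hs.1.le, hs.2.le⟩
  have h3 := hmono (left_mem_Icc.2 zero_le_one) ⟨hc.1.le, hc.2.le⟩ hc.1
  rw [sub_zero, div_one] at hceq
  linarith

/-- The graph of a strictly convex entropy lies above its tangent planes. -/
theorem IsStrictlyConvexEntropyPair.add_fderiv_lt (h : IsStrictlyConvexEntropyPair 𝒰 f U F)
    (h𝒰 : IsOpen 𝒰) (h𝒰c : Convex ℝ 𝒰) {b z : State N} (hb : b ∈ 𝒰) (hz : z ∈ 𝒰) (hne : z ≠ b) :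
    U b + fderiv ℝ U b (z - b) < U z := by
  have hmem : ∀ s ∈ Icc (0 : ℝ) 1, b + s • (z - b) ∈ 𝒰 := fun s hs =>
    h𝒰c.add_smul_sub_mem hb hz hs
  have hline : ∀ s : ℝ, HasDerivAt (fun s : ℝ => b + s • (z - b)) (z - b) s := fun s => by
    simpa using ((hasDerivAt_id s).smul_const (z - b)).const_add b
  have h1 : ∀ s ∈ Icc (0 : ℝ) 1, HasDerivAt (fun s => U (b + s • (z - b)))
      (fderiv ℝ U (b + s • (z - b)) (z - b)) s := fun s hs =>
    (((h.contDiffOn_entropy.differentiableOn two_ne_zero).differentiableAt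
      (h𝒰.mem_nhds (hmem s hs))).hasFDerivAt).comp_hasDerivAt s (hline s)
  have h2 : ∀ s ∈ Icc (0 : ℝ) 1, HasDerivAt (fun s => fderiv ℝ U (b + s • (z - b)) (z - b))
      (fderiv ℝ (fderiv ℝ U) (b + s • (z - b)) (z - b) (z - b)) s := fun s hs => by
    have hd : HasFDerivAt (fderiv ℝ U) (fderiv ℝ (fderiv ℝ U) (b + s • (z - b)))
        (b + s • (z - b)) :=
      (((h.contDiffOn_entropy.fderiv_of_isOpen (m := 1) h𝒰 (by norm_num)).differentiableOn
        one_ne_zero).differentiableAt (h𝒰.mem_nhds (hmem s hs))).hasFDerivAt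
    exact (ContinuousLinearMap.apply ℝ ℝ (z - b)).hasFDerivAt.comp_hasDerivAt s
      (hd.comp_hasDerivAt s (hline s))
  have h3 := add_deriv_lt_of_deriv2_pos h1 h2 fun s hs =>
    h.hessian_pos _ (hmem s hs) _ (sub_ne_zero.2 hne)
  simpa only [zero_smul, add_zero, one_smul, add_sub_cancel] using h3

theorem eq_dirac_of_ae_eq {m : Measure (State N)} [IsProbabilityMeasure m] {b : State N}
    (h : ∀ᵐ z ∂m, z = b) : m = Measure.dirac b := by
  have h1 : m.map id = m.map fun _ => b := Measure.map_congr h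
  rwa [Measure.map_id, Measure.map_const, measure_univ, one_smul] at h1

/-- A probability measure that saturates Jensen's inequality is a Dirac mass. -/
theorem IsStrictlyConvexEntropyPair.eq_dirac (h : IsStrictlyConvexEntropyPair 𝒰 f U F)
    (h𝒰 : IsOpen 𝒰) (h𝒰c : Convex ℝ 𝒰) {m : Measure (State N)} [IsProbabilityMeasure m]
    (hm : ∀ᵐ z ∂m, z ∈ 𝒰) (hid : Integrable (fun z => z) m) (hU : Integrable U m) {b : State N}
    (hb : b ∈ 𝒰) (hmean : ∀ j, ∫ z, z j ∂m = b j) (hUb : ∫ z, U z ∂m = U b) :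
    m = Measure.dirac b := by
  have hb' : ∫ z, z ∂m = b := by
    ext j
    rw [← hmean j]
    exact ((EuclideanSpace.proj (𝕜 := ℝ) j).integral_comp_comm hid).symm
  have hsub : Integrable (fun z => z - b) m := hid.sub (integrable_const b)
  have hi : Integrable (fun z => fderiv ℝ U b (z - b)) m :=
    (fderiv ℝ U b).integrable_comp hsub
  have ha : Integrable (fun z => U b + fderiv ℝ U b (z - b)) m := (integrable_const _).add hi
  have hi' : Integrable (fun z => U z - (U b + fderiv ℝ U b (z - b))) m := hU.sub ha
  -- The gap between `U` and its tangent plane at the barycenter is nonnegative with zero integral,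
  -- and it vanishes only at `b`.
  have h0 : ∫ z, (U z - (U b + fderiv ℝ U b (z - b))) ∂m = 0 := by
    rw [integral_sub hU ha, integral_add (integrable_const _) hi,
      (fderiv ℝ U b).integral_comp_comm hsub,
      integral_sub hid (integrable_const b), hb', hUb]
    simp
  have hnn : 0 ≤ᵐ[m] fun z => U z - (U b + fderiv ℝ U b (z - b)) := by
    filter_upwards [hm] with z hz
    rcases eq_or_ne z b with rfl | hne
    · simp
    · exact (sub_pos.2 (h.add_fderiv_lt h𝒰 h𝒰c hb hz hne)).le
  rw [integral_eq_zero_iff_of_nonneg_ae hnn hi'] at h0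
  refine eq_dirac_of_ae_eq ?_
  filter_upwards [h0, hm] with z hz hzU
  by_contra hne
  have := h.add_fderiv_lt h𝒰 h𝒰c hb hzU hne
  simp only [Pi.zero_apply] at hz
  linarith

/-- The coordinate entropies identify the barycenter of `μ₀ t` as `u_B(t)`, and the strictly convex
entropy then shows equality in Jensen's inequality. Only finitely many entropies are tested, so one
null set of times suffices. -/
theorem ViscousFamily.entropyTrace_eq_dirac (hV : ViscousFamily 𝒰 K f ε uIε uBε u)
    (h𝒰c : Convex ℝ 𝒰) (hUF : IsStrictlyConvexEntropyPair 𝒰 f U F)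
    (hD : BoundaryData uBε uB) (hν : IsYoungMeasure 𝒰 (fun n p => u n p.1 p.2) ν)
    (hμ : IsYoungMeasure 𝒰 (fun n p => u n (ε n * p.1) p.2) μ)
    {μ₀ : Kernel ℝ (State N)} (hμ₀ : IsEntropyTrace 𝒰 f μ μ₀) :
    ∀ᵐ t ∂volHalf, μ₀ t = Measure.dirac (uB t) := by
  have hb := hμ₀.toIsBoundaryYoungMeasure
  have := hb.markov
  obtain ⟨K', -, hKU', hsupp⟩ := hb.support
  have hj : ∀ᵐ t ∂volHalf, ∀ j : Fin N, ∫ w, w j ∂(μ₀ t) = uB t j := ae_all_iff.2 fun j =>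
    hV.integral_entropyTrace hD hν hμ hμ₀ (isConvexEntropyPair_coord hV.isOpen hV.smooth j)
  filter_upwards [hj, hV.integral_entropyTrace hD hν hμ hμ₀ hUF.toIsConvexEntropyPair,
    ae_restrict_mem measurableSet_Ioi] with t h1 h2 ht
  refine hUF.eq_dirac hV.isOpen h𝒰c ?_ (hb.integrable continuousOn_id ht)
    (hb.integrable hUF.contDiffOn_entropy.continuousOn ht)
    (hV.subset (hV.boundary_limit_mem hD ht)) h1 h2
  filter_upwards [measure_eq_zero_iff_ae_notMem.1 (hsupp t ht)] with z hz
  exact hKU' (not_not.1 hz)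

end BoundaryLayer

/-! ### Assembly of the theorem -/

theorem theorem2p1 {N : ℕ} (𝒰 : Set (BoundaryLayer.State N)) (h𝒰_open : IsOpen 𝒰)
    (h𝒰_convex : Convex ℝ 𝒰)
    (f : BoundaryLayer.State N → BoundaryLayer.State N) (hf : ContDiffOn ℝ ∞ f 𝒰)
    -- existence of a strictly convex entropy pair
    (h_strict : ∃ U F : BoundaryLayer.State N → ℝ,
      BoundaryLayer.IsStrictlyConvexEntropyPair 𝒰 f U F)
    -- initial and boundary data
    (uI uB : ℝ → BoundaryLayer.State N)
    (huI : MemLp uI ⊤ BoundaryLayer.volHalf) (huI_mem : ∀ᵐ x ∂BoundaryLayer.volHalf, uI x ∈ 𝒰)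
    (huB : BoundaryLayer.IsBV uB) (huB_mem : ∀ t, 0 < t → uB t ∈ 𝒰)
    -- viscosity parameters and approximate data, uniformly bounded in `L^∞` resp. `BV`
    (ε : ℕ → ℝ) (hε_pos : ∀ n, 0 < ε n) (hε : Tendsto ε atTop (𝓝 0))
    (uIε uBε : ℕ → ℝ → BoundaryLayer.State N)
    (huIε_bdd : ∃ C : ℝ, ∀ n x, 0 < x → ‖uIε n x‖ ≤ C)
    (huIε_lim : ∀ᵐ x ∂BoundaryLayer.volHalf, Tendsto (fun n => uIε n x) atTop (𝓝 (uI x)))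
    (huBε_bdd : ∃ C : ℝ, ∀ n t, 0 < t → ‖uBε n t‖ ≤ C)
    (huBε_var : ∀ T : ℝ, ∃ C : NNReal, ∀ n, eVariationOn (uBε n) (Ioo 0 T) ≤ C)
    (huBε_lim : ∀ᵐ t ∂BoundaryLayer.volHalf, Tendsto (fun n => uBε n t) atTop (𝓝 (uB t)))
    -- uniformly bounded viscous approximations
    (u : ℕ → ℝ → ℝ → BoundaryLayer.State N)
    (hu : ∀ n, BoundaryLayer.IsViscousSolution 𝒰 f (ε n) (uIε n) (uBε n) (u n))
    (hu_bdd : ∃ C : ℝ, ∀ n x t, 0 ≤ x → 0 ≤ t → ‖u n x t‖ ≤ C)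
    -- Young measures of `u^ε(x, t)` and of `v^ε(y, t) = u^ε(ε y, t)`
    (ν μ : Kernel (ℝ × ℝ) (BoundaryLayer.State N))
    (hν : BoundaryLayer.IsYoungMeasure 𝒰 (fun n p => u n p.1 p.2) ν)
    (hμ : BoundaryLayer.IsYoungMeasure 𝒰 (fun n p => u n (ε n * p.1) p.2) μ) :
    -- 1) bounded variation of the time averages, and existence of the traces
    (∀ U F : BoundaryLayer.State N → ℝ, BoundaryLayer.IsConvexEntropyPair 𝒰 f U F →
      ∀ θ : ℝ → ℝ, BoundaryLayer.IsBV θ → ∀ T₁ T₂ : ℝ, 0 ≤ T₁ → T₁ < T₂ →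
      ((∀ t, 0 < t → 0 ≤ θ t) ∨
        ∃ j : Fin N, EqOn U (fun w => w j) 𝒰 ∧ EqOn F (fun w => f w j) 𝒰) →
      (∃ G : ℝ → ℝ, BoundaryLayer.IsBV G ∧ BoundaryLayer.IsLayerFlux μ U F θ T₁ T₂ G) ∧
      (∃ g : ℝ → ℝ, BoundaryLayer.IsBV g ∧
        BoundaryLayer.timeAvg ν F θ T₁ T₂ =ᵐ[BoundaryLayer.volHalf] g)) ∧
    (∃ μ₀ : Kernel ℝ (BoundaryLayer.State N), BoundaryLayer.IsEntropyTrace 𝒰 f μ μ₀) ∧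
    (∃ ν₀ : Kernel ℝ (BoundaryLayer.State N), BoundaryLayer.IsFluxTrace 𝒰 f ν ν₀) ∧
    -- 2) the boundary entropy inequalities
    (∀ ν₀ : Kernel ℝ (BoundaryLayer.State N), BoundaryLayer.IsFluxTrace 𝒰 f ν ν₀ →
      ∀ U F : BoundaryLayer.State N → ℝ, BoundaryLayer.IsConvexEntropyPair 𝒰 f U F →
      ∀ θ : ℝ → ℝ, BoundaryLayer.IsBV θ → (∀ t, 0 < t → 0 ≤ θ t) →
      ∀ T₁ T₂ : ℝ, 0 ≤ T₁ → T₁ < T₂ →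
      ∀ G : ℝ → ℝ, BoundaryLayer.IsBV G → BoundaryLayer.IsLayerFlux μ U F θ T₁ T₂ G →
      ∀ y₁ y₂ : ℝ, 0 < y₁ → y₁ < y₂ →
        G y₁ ≤ ∫ t in T₁..T₂,
          (F (uB t) + fderiv ℝ U (uB t) ((∫ w, f w ∂(ν₀ t)) - f (uB t))) * θ t ∧
        G y₂ ≤ G y₁ ∧
        ∫ t in T₁..T₂, (∫ w, F w ∂(ν₀ t)) * θ t ≤ G y₂) ∧
    -- 3) the trace of `μ` is the Dirac mass at the boundary datum
    (∀ μ₀ : Kernel ℝ (BoundaryLayer.State N), BoundaryLayer.IsEntropyTrace 𝒰 f μ μ₀ →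
      ∀ᵐ t ∂BoundaryLayer.volHalf, μ₀ t = Measure.dirac (uB t)) ∧
    -- and the limit `y → ∞`
    (∀ ν₀ : Kernel ℝ (BoundaryLayer.State N), BoundaryLayer.IsFluxTrace 𝒰 f ν ν₀ →
      ∀ U F : BoundaryLayer.State N → ℝ, BoundaryLayer.IsConvexEntropyPair 𝒰 f U F →
      ∀ θ : ℝ → ℝ, BoundaryLayer.IsBV θ → (∀ t, 0 < t → 0 ≤ θ t) →
      ∀ T₁ T₂ : ℝ, 0 ≤ T₁ → T₁ < T₂ →
      ∀ G : ℝ → ℝ, BoundaryLayer.IsBV G → BoundaryLayer.IsLayerFlux μ U F θ T₁ T₂ G →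
        ∃ L : ℝ, Tendsto G atTop (𝓝 L) ∧
          ∫ t in T₁..T₂, (∫ w, F w ∂(ν₀ t)) * θ t ≤ L) := by
  obtain ⟨C, hC⟩ := hu_bdd
  -- The Young measure of `u^ε` suffices to find `K`, since the rescaled functions take values in
  -- the same set.
  obtain ⟨K, hK, hKc, hK𝒰, hmem⟩ := hν.exists_compact_range h𝒰_open h𝒰_convex
    (fun n => (hu n).continuousOn) (fun n p hp => (hu n).mem p.1 p.2 hp.1 hp.2)
    (fun n p hp => hC n p.1 p.2 hp.1 hp.2)
  have hV : BoundaryLayer.ViscousFamily 𝒰 K f ε uIε uBε u :=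
    ⟨h𝒰_open, hK, hKc, hK𝒰, hf, hε_pos, hε, hu, fun n x t hx ht => hmem n (x, t) ⟨hx, ht⟩⟩
  have hD : BoundaryLayer.BoundaryData uBε uB := ⟨huB, huBε_var, huBε_lim⟩
  refine ⟨fun U F hUF θ hθ T₁ T₂ h0 h _ => ⟨hV.exists_layer_isBV hD hν hμ hUF hθ h0 h, ?_⟩,
    hV.exists_entropyTrace hD hν hμ, hV.exists_fluxTrace hν, ?_, ?_, ?_⟩
  · obtain ⟨g, hg, hae, -⟩ := hV.exists_interior_isBV hν hUF hθ h0 h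
    exact ⟨g, hg, hae⟩
  · intro ν₀ hν₀ U F hUF θ hθ hpos T₁ T₂ h0 h G hG hGL y₁ y₂ hy₁ hy
    obtain ⟨h1, h2, h3⟩ := hV.layer_bounds hD hν hμ hν₀ hUF hθ hpos h0 h hG hGL
    exact ⟨h2 y₁ hy₁, h1 hy₁ (hy₁.trans hy) hy.le, h3 y₂ (hy₁.trans hy)⟩
  · intro μ₀ hμ₀
    obtain ⟨U, F, hUF⟩ := h_strict
    exact hV.entropyTrace_eq_dirac h𝒰_convex hUF hD hν hμ hμ₀
  · intro ν₀ hν₀ U F hUF θ hθ hpos T₁ T₂ h0 h G hG hGL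
    obtain ⟨h1, -, h3⟩ := hV.layer_bounds hD hν hμ hν₀ hUF hθ hpos h0 h hG hGL
    exact BoundaryLayer.exists_tendsto_atTop_of_antitoneOn h1 h3
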